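/- Consider germs, at $\sigma=\sigma_0$, $\mu=\mu_0$ and $(u,v,y)=0\in\mathbb R^3$, of families of vector fields $$X_{\mu,\sigma}:\qquad \dot u=u,\qquad \dot v=-v,\qquad \dot y=-\sigma y+F_\mu(u,v,y),$$ where $\sigma$ is a real parameter near $\sigma_0>0$, $\mu$ is a parameter near $\mu_0$ in some Euclidean space $\mathbb R^n$, the function $F_\mu(u,v,y)$ is of class $C^\infty$ in $(\mu,u,v,y)$ near $(\mu_0,0)$, and $F_\mu(u,v,y)=O(|(u,v,y)|^2)$ at the origin for every $\mu$ near $\mu_0$. Put $\nu=uv$. There is an operator $\mathcal N$ that assigns to every such family $X_{\mu,\sigma}$ and every integer $k\ge 1$ a tuple $$\mathcal N(X_{\mu,\sigma},k)=(\delta_k,K(k),\varepsilon_k,\eta_k,G_{\mu,\sigma}),\qquad \delta_k,\varepsilon_k,\eta_k>0,\quad K(k)\in\mathbb N,$$ where the integer $K(k)$ depends only on $k$ and $\sigma_0$ and the germ of $(\mu,\sigma,u,v,y)\mapsto G_{\mu,\sigma}(u,v,y)$ at $(\mu_0,\sigma_0,0)$ depends only on $k$ and the germ of the family, such that the following holds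 for $|\sigma-\sigma_0|\le\delta_k$, $|\mu-\mu_0|<\varepsilon_k$ and $|(u,v,y)|<\eta_k$. The map $(\mu,\sigma,u,v,y)\mapsto G_{\mu,\sigma}(u,v,y)$ is of class $C^k$. For each $(\mu,\sigma)$, the map $$(u,v,y)\mapsto(u,v,Y),\qquad Y=G_{\mu,\sigma}(u,v,y),$$ is a $C^k$ diffeomorphism onto its image which fixes the origin, has derivative $\mathrm{Id}$ there, and brings $X_{\mu,\sigma}$ to a polynomial vector field of degree $\le K(k)$ in $(u,v,Y)$, of the following form. 1. If $\sigma_0\notin\mathbb Q$: $$\dot u=u,\qquad \dot v=-v,\qquad \dot Y=-(\sigma+\varphi_{\mu,\sigma}(\nu))Y.$$ 2. If $\sigma_0=p/q\in\mathbb Q$ with $p,q$ positive coprime integers: $$\dot u=u,\qquad \dot v=-v,\qquad \dot Y=-(\sigma+\varphi_{\mu,\sigma}(\nu))Y+\Phi_{\mu,\sigma}(\nu,u^pY^q)Y+v^p\eta_{\mu,\sigma}(\nu),$$ with $\eta_{\mu,\sigma}\equiv0$ when $q\ne1$, that is, when $\sigma_0\notin\mathbb N$. Here $\varphi_{\mu,\sigma}$,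 $\Phi_{\mu,\sigma}$ and $\eta_{\mu,\sigma}$ are polynomials of degree $\le K(k)$ with coefficients of class $C^\infty$ in $(\mu,\sigma)$, and $\Phi_{\mu,\sigma}(\nu,0)\equiv0$. -/

import Mathlib

open Set Filter Topology Asymptotics
open scoped ContDiff

noncomputable section

namespace SaddleNormalForm

/-- The Euclidean space in which the parameter `μ` lives. -/
abbrev Param (n : ℕ) := EuclideanSpace ℝ (Fin n)

/-- The phase space with coordinates `(u, v, y)`. -/
abbrev Phase := ℝ × ℝ × ℝ

/-- A representative of a germ, at `μ = μ₀`, `σ = σ₀ > 0` and `(u, v, y) = 0`, of a smooth family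
of quasi-linear vector fields `u' = u`, `v' = -v`, `y' = -σ y + F μ (u, v, y)`.
The function `F` is `C^∞` on some neighbourhood of `(μ₀, 0)` and it is `O(|(u, v, y)|²)` at the
origin for every parameter value near `μ₀`. -/
structure SaddleFamily (n : ℕ) where
  σ₀ : ℝ
  μ₀ : Param n
  F : Param n → Phase → ℝ
  σ₀_pos : 0 < σ₀
  smooth : ∀ᶠ z in 𝓝 (μ₀, (0 : Phase)),
    ContDiffAt ℝ ∞ (fun w : Param n × Phase => F w.1 w.2) z
  order_two : ∀ᶠ μ in 𝓝 μ₀, (fun x : Phase => F μ x) =O[𝓝 0] fun x => ‖x‖ ^ 2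

/-- The vector field `X_{μ,σ}` of the family. -/
def SaddleFamily.field {n : ℕ} (X : SaddleFamily n) (μ : Param n) (σ : ℝ) (x : Phase) : Phase :=
  (x.1, -x.2.1, -σ * x.2.2 + X.F μ x)

/-- Two representatives define the same germ of family. -/
def SaddleFamily.SameGerm {n : ℕ} (X X' : SaddleFamily n) : Prop :=
  X.σ₀ = X'.σ₀ ∧ X.μ₀ = X'.μ₀ ∧
    (fun z : Param n × Phase => X.F z.1 z.2) =ᶠ[𝓝 (X.μ₀, 0)] fun z => X'.F z.1 z.2

/-- The values `(δ, K, ε, η, G)` of a normalizing operator. -/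
structure Normalization (n : ℕ) where
  δ : ℝ
  K : ℕ
  ε : ℝ
  η : ℝ
  G : Param n → ℝ → Phase → ℝ

namespace Normalization

variable {n : ℕ}

/-- The parameters with `|μ - μ₀| < ε` and `|σ - σ₀| ≤ δ`. -/
def params (D : Normalization n) (X : SaddleFamily n) : Set (Param n × ℝ) :=
  {a | ‖a.1 - X.μ₀‖ < D.ε ∧ |a.2 - X.σ₀| ≤ D.δ}

/-- The map `(u, v, y) ↦ (u, v, G_{μ,σ}(u, v, y))`. -/
def change (D : Normalization n) (μ : Param n) (σ : ℝ) (x : Phase) : Phase :=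
  (x.1, x.2.1, D.G μ σ x)

/-- The maps `(u, v, y) ↦ (u, v, G_{μ,σ}(u, v, y))` form a parameter-depending change of coordinates
of class `C^k` on `|(u, v, y)| < η`, fixing the origin and with derivative the identity there.
The map `G` is jointly `C^k` in the parameters and the phase variables. An injective `C^k` map
(`k ≥ 1`) of an open set with invertible derivatives is a `C^k` diffeomorphism onto an open set. -/
structure IsCoordinateChange (D : Normalization n) (X : SaddleFamily n) (k : ℕ) : Prop where
  contDiffOn : ContDiffOn ℝ k
    (fun z : (Param n × ℝ) × Phase => D.G z.1.1 z.1.2 z.2) (D.params X ×ˢ Metric.ball 0 D.η)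
  injOn : ∀ a ∈ D.params X, InjOn (D.change a.1 a.2) (Metric.ball 0 D.η)
  invertible : ∀ a ∈ D.params X, ∀ x ∈ Metric.ball (0 : Phase) D.η,
    (fderiv ℝ (D.change a.1 a.2) x).IsInvertible
  map_zero : ∀ a ∈ D.params X, D.G a.1 a.2 0 = 0
  deriv_zero : ∀ a ∈ D.params X,
    HasFDerivAt (D.change a.1 a.2) (ContinuousLinearMap.id ℝ Phase) 0

end Normalization

/-- The vector field `u' = u`, `v' = -v`, `Y' = P(u, v, Y)`, for a polynomial `P` in the variables
`u` (index 0), `v` (index 1) and `Y` (index 2). -/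
def polyField (P : MvPolynomial (Fin 3) ℝ) (w : Phase) : Phase :=
  (w.1, -w.2.1, MvPolynomial.eval ![w.1, w.2.1, w.2.2] P)

/-- The polynomial `ν = u v` in `(u, v, Y)`. -/
def nu : MvPolynomial (Fin 3) ℝ := MvPolynomial.X 0 * MvPolynomial.X 1

/-- `-(σ + φ(ν)) Y` as a polynomial in `(u, v, Y)`. -/
def irrationalForm (σ : ℝ) (φ : Polynomial ℝ) : MvPolynomial (Fin 3) ℝ :=
  -(MvPolynomial.C σ + Polynomial.aeval nu φ) * MvPolynomial.X 2

/-- `-(σ + φ(ν)) Y + Φ(ν, u^p Y^q) Y + v^p η(ν)` as a polynomial in `(u, v, Y)`. -/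
def rationalForm (p q : ℕ) (σ : ℝ) (φ : Polynomial ℝ) (Φ : MvPolynomial (Fin 2) ℝ)
    (η : Polynomial ℝ) : MvPolynomial (Fin 3) ℝ :=
  -(MvPolynomial.C σ + Polynomial.aeval nu φ) * MvPolynomial.X 2
    + MvPolynomial.aeval ![nu, MvPolynomial.X 0 ^ p * MvPolynomial.X 2 ^ q] Φ * MvPolynomial.X 2
    + MvPolynomial.X 1 ^ p * Polynomial.aeval nu η

variable {n : ℕ}

/-- A parameter-depending one-variable polynomial of degree at most `K`, with coefficients of class
`C^∞` in the parameters of `A`. -/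
def IsPolyFamily (A : Set (Param n × ℝ)) (K : ℕ) (φ : Param n × ℝ → Polynomial ℝ) : Prop :=
  (∀ a ∈ A, (φ a).natDegree ≤ K) ∧ ∀ i, ContDiffOn ℝ ∞ (fun a => (φ a).coeff i) A

/-- A parameter-depending two-variable polynomial of degree at most `K`, with coefficients of class
`C^∞` in the parameters of `A`. -/
def IsPolyFamily₂ (A : Set (Param n × ℝ)) (K : ℕ) (Φ : Param n × ℝ → MvPolynomial (Fin 2) ℝ) :
    Prop :=
  (∀ a ∈ A, (Φ a).totalDegree ≤ K) ∧ ∀ i, ContDiffOn ℝ ∞ (fun a => (Φ a).coeff i) A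

/-- The change of coordinates brings the family `X` to the family of polynomial vector fields
`u' = u`, `v' = -v`, `Y' = P_{μ,σ}(u, v, Y)`, of degree at most `K`. -/
def Normalization.BringsTo (D : Normalization n) (X : SaddleFamily n)
    (P : Param n × ℝ → MvPolynomial (Fin 3) ℝ) : Prop :=
  ∀ a ∈ D.params X, (P a).totalDegree ≤ D.K ∧
    ∀ x ∈ Metric.ball (0 : Phase) D.η,
      fderiv ℝ (D.change a.1 a.2) x (X.field a.1 a.2 x) = polyField (P a) (D.change a.1 a.2 x)

/-- `D` is a `C^k` normalization of the family `X`. -/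
structure Normalization.Normalizes (D : Normalization n) (X : SaddleFamily n) (k : ℕ) : Prop where
  δ_pos : 0 < D.δ
  ε_pos : 0 < D.ε
  η_pos : 0 < D.η
  coordinateChange : D.IsCoordinateChange X k
  irrational_case : Irrational X.σ₀ → ∃ φ : Param n × ℝ → Polynomial ℝ,
    IsPolyFamily (D.params X) D.K φ ∧
    D.BringsTo X fun a => irrationalForm a.2 (φ a)
  rational_case : ∀ p q : ℕ, 0 < q → p.Coprime q → X.σ₀ = p / q →
    ∃ (φ : Param n × ℝ → Polynomial ℝ) (Φ : Param n × ℝ → MvPolynomial (Fin 2) ℝ)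
      (η : Param n × ℝ → Polynomial ℝ),
      IsPolyFamily (D.params X) D.K φ ∧ IsPolyFamily₂ (D.params X) D.K Φ ∧
      IsPolyFamily (D.params X) D.K η ∧
      (∀ a ∈ D.params X, ∀ ν : ℝ, MvPolynomial.eval ![ν, 0] (Φ a) = 0) ∧
      (q ≠ 1 → ∀ a ∈ D.params X, η a = 0) ∧
      D.BringsTo X fun a => rationalForm p q a.2 (φ a) (Φ a) (η a)

end SaddleNormalForm

end

/-! The parameters `a = (μ - μ₀, σ - σ₀)` are added to the phase variables with `a' = 0`, so that
regularity in the parameters is part of regularity in all variables. The eigenvalue is frozen at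
`σ₀`, and the term `(σ - σ₀) y` is moved into the nonlinearity (`detuned`).

Formal part: the linear field multiplies `u^i v^j y^l` by `i - j - σ l`. A term of this type in `y'`
is therefore removable when `i - j ≠ σ₀ (l - 1)`, and the divisor stays nonzero for `σ` near `σ₀`.
Only finitely many degrees are treated, so no small divisors arise. `exists_formal_normalization`
leaves a resonant polynomial and an error of any prescribed order `N` in `(u, v, y)`, uniformly in
the parameters. Arithmetic of the resonances (`resonance_of_irrational`, `resonance_of_rational`)
turns the polynomial into the two stated forms.

Flat part: the error is removed by a conjugation which is only `C^k` (`exists_flat_removal`). It is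
split into a term flat along `u = 0` and a term flat along `v = y = 0`; the field contracts towards
the first subspace in backward time and towards the second in forward time. Suppose that `X`
contracts towards a subspace along which `X - Z` is flat, and let `f` and `κ` be the time-one maps
of `X` and `-Z`. Then `κ^n ∘ f^n` converges in `C^k`: derivatives of iterates grow at most
geometrically, and the flatness of `κ ∘ f - id`, evaluated at points contracted by `f^n`, wins if
its order is large (`exists_limit_conjugation`). The limit carries `X` to `Z`
(`exists_conjugation`). The required order depends only on `k`, the contraction rate and bounds of
derivatives. Cutting off and rescaling make these bounds depend on `σ₀` alone, and so the degree
depends only on `k` and `σ₀`.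

Operator: a normalizing map is picked by `Classical.epsilon` from a predicate which is unchanged
when the nonlinearity is replaced by another representative of its germ. -/

set_option maxSynthPendingDepth 3
set_option linter.unusedSectionVars false

noncomputable section

namespace SaddleNormalForm

/-! ### Derivatives of compositions and of their differences. -/

section Bounds

open scoped Nat

variable {E F G : Type} [NormedAddCommGroup E] [NormedSpace ℝ E]
  [NormedAddCommGroup F] [NormedSpace ℝ F] [NormedAddCommGroup G] [NormedSpace ℝ G]

/-- The bound of Mathlib on derivatives of a composition does not need a bound on the outer
function itself. -/
theorem norm_iteratedFDeriv_comp_le_of_one_le {g : F → G} {f : E → F} {n : ℕ} (hn : 1 ≤ n)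
    (hg : ContDiff ℝ n g) (hf : ContDiff ℝ n f) (x : E) {C D : ℝ} (hC0 : 0 ≤ C)
    (hC : ∀ i, 1 ≤ i → i ≤ n → ‖iteratedFDeriv ℝ i g (f x)‖ ≤ C)
    (hD : ∀ i, 1 ≤ i → i ≤ n → ‖iteratedFDeriv ℝ i f x‖ ≤ D ^ i) :
    ‖iteratedFDeriv ℝ n (fun y => g (f y)) x‖ ≤ n ! * C * D ^ n := by
  have key : ∀ {H : Type} [NormedAddCommGroup H] [NormedSpace ℝ H] (h : H → G) (c : G) (i : ℕ) (y : H),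
      1 ≤ i → ContDiff ℝ i h →
      iteratedFDeriv ℝ i (fun z => h z - c) y = iteratedFDeriv ℝ i h y := by
    intro H _ _ h c i y hi hh
    rw [show (fun z => h z - c) = h - fun _ => c from rfl,
      iteratedFDeriv_sub hh contDiff_const, iteratedFDeriv_const_of_ne (by omega)]
    simp
  -- Subtracting the constant `g (f x)` makes the outer function vanish at the point and leaves its
  -- derivatives of positive order unchanged.
  have h2 := norm_iteratedFDeriv_comp_le (g := fun y => g y - g (f x)) (f := f)
    (hg.sub contDiff_const) hf le_rfl x (C := C) (D := D) (fun i hi => by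
      rcases Nat.eq_zero_or_pos i with rfl | h
      · simpa using hC0
      · rw [key g _ i _ h (hg.of_le (by exact_mod_cast hi))]
        exact hC i h hi) hD
  rwa [show ((fun y => g y - g (f x)) ∘ f) = fun z => g (f z) - g (f x) from rfl,
    key (fun z => g (f z)) _ n x hn (hg.comp hf)] at h2

/-- The constants in the estimate of a difference of two compositions. -/
def compConst : ℕ → ℝ
  | 0 => 1
  | j + 1 => 2 ^ j * (compConst j + j !)

theorem compConst_nonneg (j : ℕ) : 0 ≤ compConst j := by
  induction j with
  | zero => simp [compConst]
  | succ j ih => simp only [compConst]; positivity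

theorem compConst_le_succ (j : ℕ) : compConst j ≤ compConst (j + 1) := by
  have h0 := compConst_nonneg j
  have h1 : (1 : ℝ) ≤ 2 ^ j := one_le_pow₀ (by norm_num)
  have h2 : (0 : ℝ) ≤ j ! := by positivity
  simp only [compConst]
  nlinarith

theorem sum_choose_real (j : ℕ) : ∑ i ∈ Finset.range (j + 1), (j.choose i : ℝ) = 2 ^ j := by
  exact_mod_cast Nat.sum_range_choose j

/-- The derivative of `g ∘ a - g ∘ b` is `(Dg(a) - Dg(b)) Da + Dg(b) (Da - Db)`. The induction
hypothesis for `Dg` bounds the first factor, the composition bound gives `j !` for `Dg(b)`, and the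
binomial coefficients of the Leibniz rule sum to `2 ^ j`; this is the recursion of `compConst`. The
target space varies in the induction because `Dg` is operator valued. -/
theorem norm_iteratedFDeriv_comp_sub_le (j : ℕ) :
    ∀ {G : Type} [NormedAddCommGroup G] [NormedSpace ℝ G] {g : F → G} {a b : E → F}
      (_ : ContDiff ℝ (j + 1 : ℕ) g) (_ : ContDiff ℝ j a) (_ : ContDiff ℝ j b) (x : E)
      {C D ε : ℝ} (_ : 0 ≤ C) (_ : 1 ≤ D) (_ : 0 ≤ ε)
      (_ : ∀ i, 1 ≤ i → i ≤ j + 1 → ∀ y, ‖iteratedFDeriv ℝ i g y‖ ≤ C)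
      (_ : ∀ i, 1 ≤ i → i ≤ j → ‖iteratedFDeriv ℝ i a x‖ ≤ D ^ i)
      (_ : ∀ i, 1 ≤ i → i ≤ j → ‖iteratedFDeriv ℝ i b x‖ ≤ D ^ i)
      (_ : ∀ i ≤ j, ‖iteratedFDeriv ℝ i (fun y => a y - b y) x‖ ≤ ε),
      ∀ i ≤ j, ‖iteratedFDeriv ℝ i (fun y => g (a y) - g (b y)) x‖
        ≤ compConst j * C * D ^ i * ε := by
  induction j with
  | zero =>
    intro G _ _ g a b hg ha hb x C D ε hC hD hε hgC haD hbD hab i hi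
    obtain rfl : i = 0 := by omega
    simp only [compConst, norm_iteratedFDeriv_zero, pow_zero, one_mul, mul_one]
    have h1 := Convex.norm_image_sub_le_of_norm_fderiv_le (𝕜 := ℝ) (f := g) (s := univ) (C := C)
      (fun y _ => (hg.differentiable (by simp)) y)
      (fun y _ => by
        have := hgC 1 le_rfl le_rfl y
        rwa [← norm_iteratedFDeriv_fderiv, norm_iteratedFDeriv_zero] at this)
      convex_univ (mem_univ (b x)) (mem_univ (a x))
    refine h1.trans ?_
    have := hab 0 le_rfl
    rw [norm_iteratedFDeriv_zero] at this
    gcongr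
  | succ j ih =>
    intro G _ _ g a b hg ha hb x C D ε hC hD hε hgC haD hbD hab i hi
    have hle : ((j : ℕ) : ℕ∞ω) ≤ ((j + 1 : ℕ) : ℕ∞ω) := by exact_mod_cast Nat.le_succ j
    have hle' : ((j + 1 : ℕ) : ℕ∞ω) ≤ ((j + 1 + 1 : ℕ) : ℕ∞ω) := by
      exact_mod_cast Nat.le_succ (j + 1)
    rcases Nat.lt_or_ge i (j + 1) with hij | hij
    · refine (ih (hg.of_le hle') (ha.of_le hle) (hb.of_le hle) x hC hD hε
        (fun i h1 h2 => hgC i h1 (by omega)) (fun i h1 h2 => haD i h1 (by omega))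
        (fun i h1 h2 => hbD i h1 (by omega)) (fun i h1 => hab i (by omega)) i (by omega)).trans ?_
      have := compConst_le_succ j
      gcongr
    · obtain rfl : i = j + 1 := by omega
      have hgd : Differentiable ℝ g := hg.differentiable (by simp)
      have had : Differentiable ℝ a := ha.differentiable (by simp)
      have hbd : Differentiable ℝ b := hb.differentiable (by simp)
      have hg' : ContDiff ℝ (j + 1 : ℕ) (fderiv ℝ g) := hg.fderiv_right (by norm_cast)
      have ha' : ContDiff ℝ j (fderiv ℝ a) := ha.fderiv_right (by norm_cast)
      have hb' : ContDiff ℝ j (fderiv ℝ b) := hb.fderiv_right (by norm_cast)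
      have hbj := hb.of_le hle
      have haj := ha.of_le hle
      set B := ContinuousLinearMap.compL ℝ E F G with hBdef
      have hB : ‖B‖ ≤ 1 := ContinuousLinearMap.norm_compL_le ℝ E F G
      have hfd : fderiv ℝ (fun y => g (a y) - g (b y)) =
          (fun y => B (fderiv ℝ g (a y) - fderiv ℝ g (b y)) (fderiv ℝ a y)) +
          fun y => B (fderiv ℝ g (b y)) (fderiv ℝ a y - fderiv ℝ b y) := by
        ext1 y
        have h1 : HasFDerivAt (fun y => g (a y) - g (b y))
            ((fderiv ℝ g (a y)).comp (fderiv ℝ a y) - (fderiv ℝ g (b y)).comp (fderiv ℝ b y)) y :=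
          ((hgd (a y)).hasFDerivAt.comp y (had y).hasFDerivAt).sub
            ((hgd (b y)).hasFDerivAt.comp y (hbd y).hasFDerivAt)
        rw [h1.fderiv]
        simp [B]
      have c1 : ContDiff ℝ j (fun y => fderiv ℝ g (a y) - fderiv ℝ g (b y)) :=
        ((hg'.of_le hle).comp haj).sub ((hg'.of_le hle).comp hbj)
      have c2 : ContDiff ℝ j (fun y => fderiv ℝ g (b y)) := (hg'.of_le hle).comp hbj
      have c3 : ContDiff ℝ j (fun y => fderiv ℝ a y - fderiv ℝ b y) := ha'.sub hb'
      rw [← norm_iteratedFDeriv_fderiv, hfd, iteratedFDeriv_add]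
      rotate_left
      · exact B.isBoundedBilinearMap.contDiff.comp (c1.prodMk ha')
      · exact B.isBoundedBilinearMap.contDiff.comp (c2.prodMk c3)
      refine (norm_add_le _ _).trans ?_
      have e1 := B.norm_iteratedFDeriv_le_of_bilinear_of_le_one c1 ha' x (n := j) le_rfl hB
      have e2 := B.norm_iteratedFDeriv_le_of_bilinear_of_le_one c2 c3 x (n := j) le_rfl hB
      have hsub : (fun y => fderiv ℝ a y - fderiv ℝ b y) = fderiv ℝ (fun y => a y - b y) := by
        ext1 y
        exact ((had y).hasFDerivAt.sub (hbd y).hasFDerivAt).fderiv.symm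
      have f1 : ∀ i ∈ Finset.range (j + 1), (j.choose i : ℝ) *
          ‖iteratedFDeriv ℝ i (fun y => fderiv ℝ g (a y) - fderiv ℝ g (b y)) x‖ *
          ‖iteratedFDeriv ℝ (j - i) (fderiv ℝ a) x‖ ≤
          (j.choose i : ℝ) * (compConst j * C * D ^ (j + 1) * ε) := by
        intro i hi
        have hi : i ≤ j := by simpa [Nat.lt_succ_iff] using hi
        have h1 := ih (g := fderiv ℝ g) hg' haj hbj x hC hD hε
          (fun i h1 h2 y => by
            rw [norm_iteratedFDeriv_fderiv]; exact hgC (i + 1) (by omega) (by omega) y)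
          (fun i h1 h2 => haD i h1 (by omega))
          (fun i h1 h2 => hbD i h1 (by omega)) (fun i h1 => hab i (by omega)) i hi
        have h2 := haD (j - i + 1) (by omega) (by omega)
        rw [← norm_iteratedFDeriv_fderiv] at h2
        have hK := compConst_nonneg j
        calc _ ≤ (j.choose i : ℝ) * (compConst j * C * D ^ i * ε) * D ^ (j - i + 1) := by gcongr
          _ = (j.choose i : ℝ) * (compConst j * C * D ^ (i + (j - i + 1)) * ε) := by ring
          _ = _ := by rw [show i + (j - i + 1) = j + 1 by omega]
      have f2 : ∀ i ∈ Finset.range (j + 1), (j.choose i : ℝ) *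
          ‖iteratedFDeriv ℝ i (fun y => fderiv ℝ g (b y)) x‖ *
          ‖iteratedFDeriv ℝ (j - i) (fun y => fderiv ℝ a y - fderiv ℝ b y) x‖ ≤
          (j.choose i : ℝ) * (j ! * C * D ^ (j + 1) * ε) := by
        intro i hi
        have hi : i ≤ j := by simpa [Nat.lt_succ_iff] using hi
        have hij : ((i : ℕ) : ℕ∞ω) ≤ (j : ℕ) := by exact_mod_cast hi
        have h1 := norm_iteratedFDeriv_comp_le (g := fderiv ℝ g) (f := b) (n := i)
          ((hg'.of_le hle).of_le hij) (hbj.of_le hij) le_rfl x (C := C) (D := D)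
          (fun i h1 => by
            rw [norm_iteratedFDeriv_fderiv]; exact hgC (i + 1) (by omega) (by omega) _)
          (fun i h1 h2 => hbD i h1 (by omega))
        have h2 := hab (j - i + 1) (by omega)
        rw [← norm_iteratedFDeriv_fderiv, ← hsub] at h2
        have h3 : (i ! : ℝ) ≤ j ! := by exact_mod_cast Nat.factorial_le hi
        have h4 : D ^ i ≤ D ^ (j + 1) := pow_le_pow_right₀ hD (by omega)
        have h5 : ‖iteratedFDeriv ℝ i (fun y => fderiv ℝ g (b y)) x‖ ≤ j ! * C * D ^ (j + 1) :=
          h1.trans (by gcongr)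
        calc _ ≤ (j.choose i : ℝ) * (j ! * C * D ^ (j + 1)) * ε := by gcongr
          _ = _ := by ring
      have g1 := e1.trans (Finset.sum_le_sum f1)
      have g2 := e2.trans (Finset.sum_le_sum f2)
      rw [← Finset.sum_mul, sum_choose_real] at g1 g2
      refine (add_le_add g1 g2).trans (le_of_eq ?_)
      simp only [compConst]
      ring

end Bounds

/-! ### Limits in `C^k` of locally summable sequences. -/

section Limits

variable {E F : Type} [NormedAddCommGroup E] [NormedSpace ℝ E]
  [NormedAddCommGroup F] [NormedSpace ℝ F]

/-- Sequences whose successive differences are locally summable in `C^k` converge in `C^k`. -/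
theorem exists_contDiff_limit [CompleteSpace F] (k : ℕ) (y : ℕ → E → F)
    (hy : ∀ n, ContDiff ℝ k (y n))
    (hb : ∀ x₀ : E, ∃ r > 0, ∃ u : ℕ → ℝ, Summable u ∧ ∀ n, ∀ j ≤ k, ∀ x ∈ Metric.ball x₀ r,
      ‖iteratedFDeriv ℝ j (fun z => y (n + 1) z - y n z) x‖ ≤ u n) :
    ∃ φ : E → F, ContDiff ℝ k φ ∧
      ∀ j ≤ k, ∀ x, Tendsto (fun n => iteratedFDeriv ℝ j (y n) x) atTop
        (𝓝 (iteratedFDeriv ℝ j φ x)) := by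
  induction k generalizing F with
  | zero =>
    have hloc : ∀ x₀ : E, ∃ r > 0, ∃ u : ℕ → ℝ, Summable u ∧ ∀ n, ∀ x ∈ Metric.ball x₀ r,
        dist (y n x) (y (n + 1) x) ≤ u n := by
      intro x₀
      obtain ⟨r, hr, u, hu, h⟩ := hb x₀
      refine ⟨r, hr, u, hu, fun n x hx => ?_⟩
      have := h n 0 le_rfl x hx
      rwa [norm_iteratedFDeriv_zero, ← dist_eq_norm, dist_comm] at this
    have hlim : ∀ x, ∃ z, Tendsto (fun n => y n x) atTop (𝓝 z) := by
      intro x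
      obtain ⟨r, hr, u, hu, h⟩ := hloc x
      exact cauchySeq_tendsto_of_complete (cauchySeq_of_dist_le_of_summable u
        (fun n => h n x (Metric.mem_ball_self hr)) hu)
    choose φ hφ using hlim
    refine ⟨φ, ?_, ?_⟩
    · refine contDiff_zero.2 (continuous_iff_continuousAt.2 fun x₀ => ?_)
      obtain ⟨r, hr, u, hu, h⟩ := hloc x₀
      have hunif : TendstoUniformlyOn y φ atTop (Metric.ball x₀ r) := by
        rw [Metric.tendstoUniformlyOn_iff]
        intro ε hε
        filter_upwards [(tendsto_sum_nat_add u).eventually (gt_mem_nhds hε)] with n hn x hx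
        rw [dist_comm]
        refine lt_of_le_of_lt ?_ hn
        simpa [add_comm] using dist_le_tsum_of_dist_le_of_tendsto u (fun n => h n x hx) hu (hφ x) n
      exact (hunif.continuousOn (Frequently.of_forall fun n =>
        (hy n).continuous.continuousOn)).continuousAt (Metric.ball_mem_nhds x₀ hr)
    · intro j hj x
      obtain rfl : j = 0 := by omega
      simp only [iteratedFDeriv_zero_eq_comp]
      exact ((continuousMultilinearCurryFin0 ℝ E F).symm.continuous.tendsto _).comp (hφ x)
  | succ k ih =>
    have hle : ((k : ℕ) : ℕ∞ω) ≤ ((k + 1 : ℕ) : ℕ∞ω) := by exact_mod_cast Nat.le_succ k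
    obtain ⟨φ, hφ, hφt⟩ := ih y (fun n => (hy n).of_le hle) (fun x₀ => by
      obtain ⟨r, hr, u, hu, h⟩ := hb x₀
      exact ⟨r, hr, u, hu, fun n j hj => h n j (by omega)⟩)
    have hyd : ∀ n, Differentiable ℝ (y n) := fun n => (hy n).differentiable (by simp)
    have hsub : ∀ n, (fun z => fderiv ℝ (y (n + 1)) z - fderiv ℝ (y n) z) =
        fderiv ℝ (fun z => y (n + 1) z - y n z) := fun n => by
      ext1 z
      exact (((hyd (n + 1)) z).hasFDerivAt.sub ((hyd n) z).hasFDerivAt).fderiv.symm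
    have hb' : ∀ x₀ : E, ∃ r > 0, ∃ u : ℕ → ℝ, Summable u ∧ ∀ n, ∀ j ≤ k, ∀ x ∈ Metric.ball x₀ r,
      ‖iteratedFDeriv ℝ j (fun z => fderiv ℝ (y (n + 1)) z - fderiv ℝ (y n) z) x‖ ≤ u n := by
      intro x₀
      obtain ⟨r, hr, u, hu, h⟩ := hb x₀
      refine ⟨r, hr, u, hu, fun n j hj x hx => ?_⟩
      rw [hsub, norm_iteratedFDeriv_fderiv]
      exact h n (j + 1) (by omega) x hx
    -- The induction hypothesis is used twice, for the maps and for their derivatives; the limit `ψ`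
    -- of the latter is then identified with the derivative of `φ` by locally uniform convergence.
    obtain ⟨ψ, hψ, hψt⟩ := ih (fun n => fderiv ℝ (y n))
      (fun n => (hy n).fderiv_right (by norm_cast)) hb'
    have ht0 : ∀ x, Tendsto (fun n => y n x) atTop (𝓝 (φ x)) := fun x => by
      have := hφt 0 (by omega) x
      simp only [iteratedFDeriv_zero_eq_comp] at this
      simpa [Function.comp_def] using
        ((continuousMultilinearCurryFin0 ℝ E F).continuous.tendsto _).comp this
    have ht1 : ∀ x, Tendsto (fun n => fderiv ℝ (y n) x) atTop (𝓝 (ψ x)) := fun x => by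
      have := hψt 0 (by omega) x
      simp only [iteratedFDeriv_zero_eq_comp] at this
      simpa [Function.comp_def] using
        ((continuousMultilinearCurryFin0 ℝ E (E →L[ℝ] F)).continuous.tendsto _).comp this
    have hder : ∀ x, HasFDerivAt φ (ψ x) x := by
      intro x₀
      obtain ⟨r, hr, u, hu, h⟩ := hb' x₀
      refine hasFDerivAt_of_tendstoUniformlyOn (l := atTop) (f := y)
        (f' := fun n => fderiv ℝ (y n)) Metric.isOpen_ball (s := Metric.ball x₀ r) ?_
        (fun n x _ => (hyd n x).hasFDerivAt) (fun x _ => ht0 x) (Metric.mem_ball_self hr)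
      rw [Metric.tendstoUniformlyOn_iff]
      intro ε hε
      filter_upwards [(tendsto_sum_nat_add u).eventually (gt_mem_nhds hε)] with n hn x hx
      rw [dist_comm]
      refine lt_of_le_of_lt ?_ hn
      have hd : ∀ n, dist (fderiv ℝ (y n) x) (fderiv ℝ (y (n + 1)) x) ≤ u n := fun n => by
        have := h n 0 (by omega) x hx
        rwa [norm_iteratedFDeriv_zero, ← dist_eq_norm, dist_comm] at this
      simpa [add_comm] using dist_le_tsum_of_dist_le_of_tendsto u hd hu (ht1 x) n
    have hfd : fderiv ℝ φ = ψ := by ext1 x; exact (hder x).fderiv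
    refine ⟨φ, ?_, ?_⟩
    · have : ((k + 1 : ℕ) : ℕ∞ω) = (k : ℕ∞ω) + 1 := by norm_cast
      rw [this, contDiff_succ_iff_fderiv]
      exact ⟨fun x => (hder x).differentiableAt, by simp, hfd ▸ hψ⟩
    · intro j hj x
      rcases Nat.eq_zero_or_pos j with rfl | hj0
      · exact hφt 0 (by omega) x
      · obtain ⟨i, rfl⟩ : ∃ i, j = i + 1 := ⟨j - 1, by omega⟩
        simp only [iteratedFDeriv_succ_eq_comp_right, hfd, Function.comp_apply]
        exact ((continuousMultilinearCurryRightEquiv' ℝ i E F).symm.continuous.tendsto _).comp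
          (hψt i (by omega) x)

end Limits

/-! ### Superposition operators on spaces of curves and Picard iterates. -/

section Superposition

open unitInterval

variable {E F : Type} [NormedAddCommGroup E] [NormedSpace ℝ E]
  [NormedAddCommGroup F] [NormedSpace ℝ F]

/-- Smooth maps all of whose derivatives are bounded. -/
def BddDeriv (V : E → F) : Prop :=
  ContDiff ℝ ∞ V ∧ ∀ j : ℕ, 1 ≤ j → ∃ C : ℝ, ∀ x, ‖iteratedFDeriv ℝ j V x‖ ≤ C

theorem BddDeriv.continuous {V : E → F} (hV : BddDeriv V) : Continuous V := hV.1.continuous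

theorem BddDeriv.differentiable {V : E → F} (hV : BddDeriv V) : Differentiable ℝ V :=
  hV.1.differentiable (by simp)

theorem BddDeriv.contDiff_nat {V : E → F} (hV : BddDeriv V) (n : ℕ) : ContDiff ℝ n V :=
  hV.1.of_le (by exact_mod_cast le_top)

theorem BddDeriv.fderiv {V : E → F} (hV : BddDeriv V) : BddDeriv (fderiv ℝ V) := by
  refine ⟨hV.1.fderiv_right (by simp), fun j hj => ?_⟩
  obtain ⟨C, hC⟩ := hV.2 (j + 1) (by omega)
  exact ⟨C, fun x => by rw [norm_iteratedFDeriv_fderiv]; exact hC x⟩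

theorem norm_fderiv_eq_norm_iteratedFDeriv_one (V : E → F) (x : E) :
    ‖fderiv ℝ V x‖ = ‖iteratedFDeriv ℝ 1 V x‖ := by
  rw [← norm_iteratedFDeriv_fderiv, norm_iteratedFDeriv_zero]

theorem norm_iteratedFDeriv_clm_le (L : E →L[ℝ] F) {j : ℕ} (hj : 1 ≤ j) (x : E) :
    ‖iteratedFDeriv ℝ j L x‖ ≤ ‖L‖ := by
  obtain ⟨i, rfl⟩ : ∃ i, j = i + 1 := ⟨j - 1, by omega⟩
  have hL : fderiv ℝ L = fun _ => L := by ext1 y; exact L.fderiv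
  rw [← norm_iteratedFDeriv_fderiv, hL]
  rcases Nat.eq_zero_or_pos i with rfl | hi
  · rw [norm_iteratedFDeriv_zero]
  · rw [iteratedFDeriv_const_of_ne (by omega)]
    simp

theorem norm_sub_le_of_norm_fderiv_le {V : E → F} (hV : Differentiable ℝ V) {C : ℝ}
    (hC : ∀ x, ‖fderiv ℝ V x‖ ≤ C) (x y : E) : ‖V x - V y‖ ≤ C * ‖x - y‖ :=
  Convex.norm_image_sub_le_of_norm_fderiv_le (𝕜 := ℝ) (s := univ)
    (fun y _ => hV y) (fun y _ => hC y) convex_univ (mem_univ y) (mem_univ x)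

theorem norm_taylor_one_le {V : E → F} (hV : ContDiff ℝ 2 V) {C : ℝ}
    (hC : ∀ x, ‖iteratedFDeriv ℝ 2 V x‖ ≤ C) (x h : E) :
    ‖V (x + h) - V x - fderiv ℝ V x h‖ ≤ C * ‖h‖ ^ 2 := by
  have hd : Differentiable ℝ V := hV.differentiable (by simp)
  have hC0 : 0 ≤ C := (norm_nonneg _).trans (hC x)
  have hd' : Differentiable ℝ (fderiv ℝ V) :=
    (hV.fderiv_right (m := 1) (by norm_num)).differentiable (by simp)
  have h1 : ∀ z ∈ Metric.closedBall x ‖h‖, ‖fderiv ℝ V z - fderiv ℝ V x‖ ≤ C * ‖h‖ := by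
    intro z hz
    refine (norm_sub_le_of_norm_fderiv_le hd' (C := C) (fun y => ?_) z x).trans ?_
    · rw [norm_fderiv_eq_norm_iteratedFDeriv_one, norm_iteratedFDeriv_fderiv]
      exact hC y
    · gcongr
      simpa [dist_eq_norm] using hz
  have h2 := (convex_closedBall x ‖h‖).norm_image_sub_le_of_norm_hasFDerivWithin_le'
    (f := V) (f' := fun z => fderiv ℝ V z) (φ := fderiv ℝ V x) (x := x) (y := x + h)
    (fun z _ => (hd z).hasFDerivAt.hasFDerivWithinAt) h1
    (by simp) (by simp)
  simpa [pow_two, mul_assoc] using h2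

/-- The superposition operator `γ ↦ V ∘ γ` on curves. -/
def superpose (V : E → F) (hV : Continuous V) (γ : C(I, E)) : C(I, F) :=
  (⟨V, hV⟩ : C(E, F)).comp γ

@[simp] theorem superpose_apply (V : E → F) (hV : Continuous V) (γ : C(I, E)) (t : I) :
    superpose V hV γ t = V (γ t) := rfl

/-- Pointwise evaluation of a curve of operators on a curve. -/
def curveApply : C(I, E →L[ℝ] F) →L[ℝ] C(I, E) →L[ℝ] C(I, F) :=
  LinearMap.mkContinuous₂
    (LinearMap.mk₂ ℝ (fun A h => (⟨fun t => A t (h t), by fun_prop⟩ : C(I, F)))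
      (fun _ _ _ => by ext; simp) (fun _ _ _ => by ext; simp)
      (fun _ _ _ => by ext; simp) (fun _ _ _ => by ext; simp)) 1
    (fun A h => by
      rw [one_mul]
      refine (ContinuousMap.norm_le _ (by positivity)).2 fun t => ?_
      exact ((A t).le_opNorm _).trans
        (mul_le_mul (A.norm_coe_le_norm t) (h.norm_coe_le_norm t) (norm_nonneg _) (norm_nonneg _)))

@[simp] theorem curveApply_apply (A : C(I, E →L[ℝ] F)) (h : C(I, E)) (t : I) :
    curveApply A h t = A t (h t) := rfl

theorem norm_curveApply_le : ‖(curveApply : C(I, E →L[ℝ] F) →L[ℝ] C(I, E) →L[ℝ] C(I, F))‖ ≤ 1 :=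
  LinearMap.mkContinuous₂_norm_le _ zero_le_one _

/-- The pointwise Taylor remainder is at most `C ‖h t‖ ^ 2` with one constant `C` for all points,
because the second derivative is globally bounded; the estimate therefore holds in the sup norm. -/
theorem hasFDerivAt_superpose {V : E → F} (hV : BddDeriv V) (γ : C(I, E)) :
    HasFDerivAt (superpose V hV.continuous)
      (curveApply (superpose (fderiv ℝ V) hV.fderiv.continuous γ)) γ := by
  obtain ⟨C, hC⟩ := hV.2 2 (by norm_num)
  have hC0 : 0 ≤ C := (norm_nonneg _).trans (hC 0)
  rw [hasFDerivAt_iff_isLittleO_nhds_zero]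
  have h1 : (fun h : C(I, E) => superpose V hV.continuous (γ + h) - superpose V hV.continuous γ -
      curveApply (superpose (fderiv ℝ V) hV.fderiv.continuous γ) h) =O[𝓝 0]
      fun h => ‖h‖ ^ 2 := by
    refine IsBigO.of_bound C (Eventually.of_forall fun h => ?_)
    rw [norm_pow, norm_norm]
    refine (ContinuousMap.norm_le _ (by positivity)).2 fun t => ?_
    refine (norm_taylor_one_le (hV.contDiff_nat 2) hC (γ t) (h t)).trans ?_
    have := h.norm_coe_le_norm t
    gcongr
  refine h1.trans_isLittleO ?_
  exact isLittleO_norm_pow_id one_lt_two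

theorem fderiv_superpose {V : E → F} (hV : BddDeriv V) :
    fderiv ℝ (superpose V hV.continuous) =
      fun γ => curveApply (superpose (fderiv ℝ V) hV.fderiv.continuous γ) :=
  funext fun γ => (hasFDerivAt_superpose hV γ).fderiv

/-- The derivative is the superposition operator of `DV` followed by the bounded map `curveApply`,
so the order of smoothness can be raised by induction with `V` replaced by `DV`. -/
theorem contDiff_superpose (n : ℕ) : ∀ {F : Type} [NormedAddCommGroup F] [NormedSpace ℝ F]
    {V : E → F} (hV : BddDeriv V), ContDiff ℝ n (superpose V hV.continuous) := by
  induction n with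
  | zero =>
    intro F _ _ V hV
    exact contDiff_zero.2 (continuous_iff_continuousAt.2 fun γ =>
      (hasFDerivAt_superpose hV γ).continuousAt)
  | succ n ih =>
    intro F _ _ V hV
    have : ((n + 1 : ℕ) : ℕ∞ω) = (n : ℕ∞ω) + 1 := by norm_cast
    rw [this, contDiff_succ_iff_fderiv]
    refine ⟨fun γ => (hasFDerivAt_superpose hV γ).differentiableAt, by simp, ?_⟩
    rw [fderiv_superpose hV]
    exact curveApply.contDiff.comp (ih hV.fderiv)

/-- No constant is lost: `curveApply` has norm at most one, so passing from `V` to `DV` preserves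
the bound at each step. -/
theorem norm_iteratedFDeriv_superpose_le (j : ℕ) :
    ∀ {F : Type} [NormedAddCommGroup F] [NormedSpace ℝ F]
    {V : E → F} (hV : BddDeriv V) {C : ℝ} (_ : ∀ x, ‖iteratedFDeriv ℝ (j + 1) V x‖ ≤ C)
    (γ : C(I, E)), ‖iteratedFDeriv ℝ (j + 1) (superpose V hV.continuous) γ‖ ≤ C := by
  induction j with
  | zero =>
    intro F _ _ V hV C hC γ
    have hC0 : 0 ≤ C := (norm_nonneg _).trans (hC 0)
    rw [zero_add, ← norm_fderiv_eq_norm_iteratedFDeriv_one, fderiv_superpose hV]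
    refine (ContinuousLinearMap.le_opNorm _ _).trans ?_
    refine (mul_le_of_le_one_left (norm_nonneg _) norm_curveApply_le).trans ?_
    refine (ContinuousMap.norm_le _ hC0).2 fun t => ?_
    rw [superpose_apply, norm_fderiv_eq_norm_iteratedFDeriv_one]
    exact hC _
  | succ j ih =>
    intro F _ _ V hV C hC γ
    rw [← norm_iteratedFDeriv_fderiv, fderiv_superpose hV]
    refine (curveApply.norm_iteratedFDeriv_comp_left (f :=
      superpose (fderiv ℝ V) hV.fderiv.continuous)
      ((contDiff_superpose (j + 1) hV.fderiv).contDiffAt) le_rfl).trans ?_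
    refine (mul_le_of_le_one_left (norm_nonneg _) norm_curveApply_le).trans ?_
    refine ih hV.fderiv (fun x => ?_) γ
    rw [norm_iteratedFDeriv_fderiv]
    exact hC x

variable [CompleteSpace E]

/-- The primitive of a curve which vanishes at time zero. -/
def primitive : C(I, E) →L[ℝ] C(I, E) :=
  LinearMap.mkContinuous
    { toFun := fun γ => ⟨fun t => ∫ s in (0 : ℝ)..t, γ (projIcc 0 1 zero_le_one s), by
        have h : Continuous fun s : ℝ => γ (projIcc 0 1 zero_le_one s) :=
          γ.continuous.comp continuous_projIcc
        exact (intervalIntegral.continuous_primitive (fun a b => h.intervalIntegrable a b) 0).comp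
          continuous_subtype_val⟩
      map_add' := fun γ δ => by
        ext t
        have h : ∀ γ : C(I, E), Continuous fun s : ℝ => γ (projIcc 0 1 zero_le_one s) :=
          fun γ => γ.continuous.comp continuous_projIcc
        exact intervalIntegral.integral_add ((h γ).intervalIntegrable _ _)
          ((h δ).intervalIntegrable _ _)
      map_smul' := fun c γ => by
        ext t
        exact intervalIntegral.integral_smul c _ } 1
    (fun γ => by
      rw [one_mul]
      refine (ContinuousMap.norm_le _ (norm_nonneg _)).2 fun t => ?_
      refine (intervalIntegral.norm_integral_le_of_norm_le_const (C := ‖γ‖)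
        (fun s _ => γ.norm_coe_le_norm _)).trans ?_
      have h0 := t.2.1
      have h1 := t.2.2
      rw [sub_zero, abs_of_nonneg h0]
      exact mul_le_of_le_one_right (norm_nonneg _) h1)

theorem primitive_apply (γ : C(I, E)) (t : I) :
    primitive γ t = ∫ s in (0 : ℝ)..t, γ (projIcc 0 1 zero_le_one s) := rfl

theorem norm_primitive_le (γ : C(I, E)) : ‖primitive γ‖ ≤ ‖γ‖ := by
  refine (ContinuousMap.norm_le _ (norm_nonneg _)).2 fun t => ?_
  rw [primitive_apply]
  refine (intervalIntegral.norm_integral_le_of_norm_le_const (C := ‖γ‖)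
    (fun s _ => γ.norm_coe_le_norm _)).trans ?_
  rw [sub_zero, abs_of_nonneg t.2.1]
  exact mul_le_of_le_one_right (norm_nonneg _) t.2.2

theorem norm_primitive_le_one : ‖(primitive : C(I, E) →L[ℝ] C(I, E))‖ ≤ 1 :=
  ContinuousLinearMap.opNorm_le_bound _ zero_le_one fun γ => by
    rw [one_mul]; exact norm_primitive_le γ

/-- Constant curves. -/
def constCurve : E →L[ℝ] C(I, E) :=
  LinearMap.mkContinuous
    { toFun := fun x => ContinuousMap.const I x
      map_add' := fun _ _ => rfl
      map_smul' := fun _ _ => rfl } 1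
    (fun x => by
      rw [one_mul]
      exact (ContinuousMap.norm_le _ (norm_nonneg _)).2 fun t => le_rfl)

@[simp] theorem constCurve_apply (x : E) (t : I) : constCurve x t = x := rfl

theorem norm_constCurve_le : ‖(constCurve : E →L[ℝ] C(I, E))‖ ≤ 1 :=
  LinearMap.mkContinuous_norm_le _ zero_le_one _

/-- A curve solving the integral equation solves the differential equation. -/
theorem exists_integral_curve {V : E → E} (hV : Continuous V) {x : E} {γ : C(I, E)}
    (h : γ = constCurve x + primitive (superpose V hV γ)) :
    ∃ g : ℝ → E, (∀ t : I, g t = γ t) ∧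
      ∀ t, HasDerivAt g (V (γ (projIcc 0 1 zero_le_one t))) t := by
  refine ⟨fun t => x + ∫ s in (0 : ℝ)..t, V (γ (projIcc 0 1 zero_le_one s)), fun t => ?_, fun t => ?_⟩
  · conv_rhs => rw [h]
    rfl
  · have hc : Continuous fun s : ℝ => V (γ (projIcc 0 1 zero_le_one s)) :=
      hV.comp (γ.continuous.comp continuous_projIcc)
    exact (hc.integral_hasStrictDerivAt 0 t).hasDerivAt.const_add x

/-- The iterates of the Picard operator. -/
def picard (V : E → E) (hV : Continuous V) : ℕ → E → C(I, E)
  | 0 => constCurve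
  | n + 1 => fun x => constCurve x + primitive (superpose V hV (picard V hV n x))

end Superposition

/-! ### Time-one maps of vector fields with small derivatives. -/

section TimeOneMap

open unitInterval

variable {E : Type} [NormedAddCommGroup E] [NormedSpace ℝ E] [CompleteSpace E]

/-- The size of the derivatives of order `1, …, k + 1` of a vector field for which the time-one
map is of class `C^k`, with bounds depending only on `k`. -/
def smallSize (k : ℕ) : ℝ := 1 / (2 * (k.factorial + compConst k * 2 ^ k))

theorem smallSize_pos (k : ℕ) : 0 < smallSize k := by
  have := compConst_nonneg k
  have : (0 : ℝ) < k.factorial := by exact_mod_cast k.factorial_pos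
  unfold smallSize
  positivity

/-- The term `k !` in the denominator of `smallSize` serves this inequality, which keeps the
derivatives of Picard iterates bounded. -/
theorem factorial_mul_smallSize_le {k j : ℕ} (hj : j ≤ k) :
    (j.factorial : ℝ) * smallSize k ≤ 1 / 2 := by
  have h1 := compConst_nonneg k
  have h2 : (0 : ℝ) < k.factorial := by exact_mod_cast k.factorial_pos
  have h3 : (j.factorial : ℝ) ≤ k.factorial := by exact_mod_cast Nat.factorial_le hj
  have h4 : (0 : ℝ) ≤ compConst k * 2 ^ k := by positivity
  unfold smallSize
  rw [mul_one_div, div_le_iff₀ (by positivity)]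
  linarith

theorem smallSize_le_half (k : ℕ) : smallSize k ≤ 1 / 2 := by
  simpa using factorial_mul_smallSize_le (Nat.zero_le k)

/-- The other term of the denominator makes the Picard step contract differences in `C^k` by the
factor `1 / 2`. -/
theorem compConst_mul_smallSize_le (k : ℕ) :
    compConst k * smallSize k * 2 ^ k ≤ 1 / 2 := by
  have h1 := compConst_nonneg k
  have h2 : (0 : ℝ) < k.factorial := by exact_mod_cast k.factorial_pos
  have h4 : (0 : ℝ) ≤ compConst k * 2 ^ k := by positivity
  unfold smallSize
  rw [mul_one_div, div_mul_eq_mul_div, div_le_iff₀ (by positivity)]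
  linarith

theorem contDiff_primitive_superpose {V : E → E} (hV : BddDeriv V) (n : ℕ) :
    ContDiff ℝ n fun γ => primitive (superpose V hV.continuous γ) :=
  (primitive : C(I, E) →L[ℝ] C(I, E)).contDiff.comp (contDiff_superpose n hV)

theorem norm_iteratedFDeriv_primitive_superpose_le {V : E → E} (hV : BddDeriv V) {j : ℕ}
    (hj : 1 ≤ j) {C : ℝ} (hC : ∀ x, ‖iteratedFDeriv ℝ j V x‖ ≤ C) (γ : C(I, E)) :
    ‖iteratedFDeriv ℝ j (fun γ => primitive (superpose V hV.continuous γ)) γ‖ ≤ C := by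
  obtain ⟨i, rfl⟩ : ∃ i, j = i + 1 := ⟨j - 1, by omega⟩
  refine ((primitive : C(I, E) →L[ℝ] C(I, E)).norm_iteratedFDeriv_comp_left
    ((contDiff_superpose (i + 1) hV).contDiffAt) le_rfl).trans ?_
  refine (mul_le_of_le_one_left (norm_nonneg _) norm_primitive_le_one).trans ?_
  exact norm_iteratedFDeriv_superpose_le i hV hC γ

theorem contDiff_picard {V : E → E} (hV : BddDeriv V) (k n : ℕ) :
    ContDiff ℝ k (picard V hV.continuous n) := by
  induction n with
  | zero => exact (constCurve : E →L[ℝ] C(I, E)).contDiff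
  | succ n ih => exact (constCurve : E →L[ℝ] C(I, E)).contDiff.add ((contDiff_primitive_superpose hV k).comp ih)

/-- The bound `2 ^ j` reproduces itself: one Picard step gives at most `1 + j ! * smallSize k * 2 ^
j ≤ 1 + 2 ^ j / 2`, and `2 ≤ 2 ^ j`. -/
theorem norm_iteratedFDeriv_picard_le {V : E → E} (hV : BddDeriv V) {k : ℕ}
    (hVk : ∀ j, 1 ≤ j → j ≤ k + 1 → ∀ x, ‖iteratedFDeriv ℝ j V x‖ ≤ smallSize k) (n : ℕ) :
    ∀ j, 1 ≤ j → j ≤ k → ∀ x, ‖iteratedFDeriv ℝ j (picard V hV.continuous n) x‖ ≤ 2 ^ j := by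
  have h0 : ∀ j, 1 ≤ j → ∀ x : E, ‖iteratedFDeriv ℝ j (constCurve : E →L[ℝ] C(I, E)) x‖ ≤ 1 :=
    fun j hj x => (norm_iteratedFDeriv_clm_le _ hj x).trans norm_constCurve_le
  induction n with
  | zero =>
    intro j h1 hj x
    exact (h0 j h1 x).trans (one_le_pow₀ (by norm_num))
  | succ n ih =>
    intro j h1 hj x
    have h2 := norm_iteratedFDeriv_comp_le_of_one_le h1 (contDiff_primitive_superpose hV j)
      (contDiff_picard hV j n) x (smallSize_pos k).le
      (fun i hi1 hi => norm_iteratedFDeriv_primitive_superpose_le hV hi1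
        (hVk i hi1 (by omega)) _) (fun i hi1 hi => ih i hi1 (by omega) x)
    have h3 : iteratedFDeriv ℝ j (picard V hV.continuous (n + 1)) x =
        iteratedFDeriv ℝ j (constCurve : E →L[ℝ] C(I, E)) x + iteratedFDeriv ℝ j
          (fun y => primitive (superpose V hV.continuous (picard V hV.continuous n y))) x :=
      congrFun (iteratedFDeriv_add (constCurve : E →L[ℝ] C(I, E)).contDiff
        ((contDiff_primitive_superpose hV j).comp (contDiff_picard hV j n))) x
    rw [h3]
    refine (norm_add_le _ _).trans ((add_le_add (h0 j h1 x) h2).trans ?_)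
    have h4 := factorial_mul_smallSize_le hj
    have h5 : (2 : ℝ) ≤ 2 ^ j := by simpa using pow_le_pow_right₀ (one_le_two (α := ℝ)) h1
    nlinarith

/-- The initial curve cancels in a difference of successive iterates, which leaves two compositions
with the same outer map; the estimate for such differences, with `D = 2`, halves the `C^k` size. -/
theorem norm_iteratedFDeriv_picard_sub_le {V : E → E} (hV : BddDeriv V) {k : ℕ}
    (hVk : ∀ j, 1 ≤ j → j ≤ k + 1 → ∀ x, ‖iteratedFDeriv ℝ j V x‖ ≤ smallSize k) (x : E) {ε : ℝ}
    (hε : 0 ≤ ε) (h0 : ∀ j ≤ k, ‖iteratedFDeriv ℝ j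
      (fun z => picard V hV.continuous 1 z - picard V hV.continuous 0 z) x‖ ≤ ε) (n : ℕ) :
    ∀ j ≤ k, ‖iteratedFDeriv ℝ j (fun z => picard V hV.continuous (n + 1) z -
      picard V hV.continuous n z) x‖ ≤ ε * (1 / 2) ^ n := by
  induction n with
  | zero => simpa using h0
  | succ n ih =>
    intro j hj
    have h1 := norm_iteratedFDeriv_comp_sub_le k (contDiff_primitive_superpose hV (k + 1))
      (contDiff_picard hV k (n + 1)) (contDiff_picard hV k n) x (smallSize_pos k).le
      one_le_two (ε := ε * (1 / 2) ^ n) (by positivity)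
      (fun i hi1 hi y => norm_iteratedFDeriv_primitive_superpose_le hV hi1 (hVk i hi1 hi) y)
      (fun i hi1 hi => norm_iteratedFDeriv_picard_le hV hVk (n + 1) i hi1 hi x)
      (fun i hi1 hi => norm_iteratedFDeriv_picard_le hV hVk n i hi1 hi x) ih j hj
    have h2 : (fun z => picard V hV.continuous (n + 1 + 1) z - picard V hV.continuous (n + 1) z) =
        fun z => primitive (superpose V hV.continuous (picard V hV.continuous (n + 1) z)) -
          primitive (superpose V hV.continuous (picard V hV.continuous n z)) := by
      ext1 z
      exact add_sub_add_left_eq_sub _ _ _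
    rw [h2]
    refine h1.trans ?_
    have h3 := compConst_mul_smallSize_le k
    have h4 := compConst_nonneg k
    have h5 := (smallSize_pos k).le
    have h6 : (2 : ℝ) ^ j ≤ 2 ^ k := pow_le_pow_right₀ one_le_two hj
    calc compConst k * smallSize k * 2 ^ j * (ε * (1 / 2) ^ n)
        ≤ compConst k * smallSize k * 2 ^ k * (ε * (1 / 2) ^ n) := by gcongr
      _ ≤ 1 / 2 * (ε * (1 / 2) ^ n) := by gcongr
      _ = _ := by ring

theorem exists_flow {V : E → E} (hV : BddDeriv V) {k : ℕ}
    (hVk : ∀ j, 1 ≤ j → j ≤ k + 1 → ∀ x, ‖iteratedFDeriv ℝ j V x‖ ≤ smallSize k) :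
    ∃ Φ : E → C(I, E), ContDiff ℝ k Φ ∧
      (∀ j, 1 ≤ j → j ≤ k → ∀ x, ‖iteratedFDeriv ℝ j Φ x‖ ≤ 2 ^ j) ∧
      ∀ x, Φ x = constCurve x + primitive (superpose V hV.continuous (Φ x)) := by
  obtain ⟨Φ, hΦ, hlim⟩ := exists_contDiff_limit k (picard V hV.continuous)
    (fun n => contDiff_picard hV k n) (fun x₀ => by
      have hc : ContDiff ℝ k
          (fun z => picard V hV.continuous 1 z - picard V hV.continuous 0 z) :=
        (contDiff_picard hV k 1).sub (contDiff_picard hV k 0)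
      -- The first Picard difference is of the size of `V`, which may be unbounded; only a local
      -- bound, from continuity, is available.
      have hcont : Continuous fun z => ∑ j ∈ Finset.range (k + 1), ‖iteratedFDeriv ℝ j
          (fun z => picard V hV.continuous 1 z - picard V hV.continuous 0 z) z‖ :=
        continuous_finsetSum _ fun j hj => (hc.continuous_iteratedFDeriv (by
          exact_mod_cast Nat.lt_succ_iff.1 (Finset.mem_range.1 hj))).norm
      set f := fun z => ∑ j ∈ Finset.range (k + 1), ‖iteratedFDeriv ℝ j
          (fun z => picard V hV.continuous 1 z - picard V hV.continuous 0 z) z‖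
      obtain ⟨r, hr, h⟩ := Metric.eventually_nhds_iff_ball.1
        (hcont.continuousAt.eventually (gt_mem_nhds (lt_add_one (f x₀))))
      have hf0 : 0 ≤ f x₀ := Finset.sum_nonneg fun _ _ => norm_nonneg _
      refine ⟨r, hr, fun n => (f x₀ + 1) * (1 / 2) ^ n,
        summable_geometric_two.mul_left _, fun n j hj x hx => ?_⟩
      refine norm_iteratedFDeriv_picard_sub_le hV hVk x (by positivity) (fun i hi => ?_) n j hj
      exact (Finset.single_le_sum (f := fun j => ‖iteratedFDeriv ℝ j
          (fun z => picard V hV.continuous 1 z - picard V hV.continuous 0 z) x‖)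
          (fun _ _ => norm_nonneg _) (Finset.mem_range.2 (Nat.lt_succ_of_le hi))).trans (h x hx).le)
  refine ⟨Φ, hΦ, fun j h1 hj x => le_of_tendsto (hlim j hj x).norm (Eventually.of_forall fun n =>
    norm_iteratedFDeriv_picard_le hV hVk n j h1 hj x), fun x => ?_⟩
  have ht : Tendsto (fun n => picard V hV.continuous n x) atTop (𝓝 (Φ x)) := by
    have := hlim 0 (by omega) x
    simp only [iteratedFDeriv_zero_eq_comp] at this
    simpa [Function.comp_def] using
      ((continuousMultilinearCurryFin0 ℝ E C(I, E)).continuous.tendsto _).comp this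
  refine tendsto_nhds_unique (ht.comp (tendsto_add_atTop_nat 1)) ?_
  exact tendsto_const_nhds.add ((((contDiff_primitive_superpose hV 0).continuous).tendsto _).comp ht)

/-- The difference of two solutions is a fixed point of a linear map of norm at most `ε < 1`. -/
theorem eq_of_linear_integral_eq {A : C(I, E →L[ℝ] E)} {ε : ℝ} (hA : ∀ t, ‖A t‖ ≤ ε) (hε : ε < 1)
    {c w w' : C(I, E)} (h : w = c + primitive (curveApply A w))
    (h' : w' = c + primitive (curveApply A w')) : w = w' := by
  have h1 : w - w' = primitive (curveApply A (w - w')) := by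
    conv_lhs => rw [h, h']
    rw [map_sub, map_sub]
    abel
  have h2 : ‖curveApply A (w - w')‖ ≤ ε * ‖w - w'‖ := by
    have hε0 : 0 ≤ ε := (norm_nonneg _).trans (hA 0)
    refine (ContinuousMap.norm_le _ (by positivity)).2 fun t => ?_
    exact ((A t).le_opNorm _).trans
      (mul_le_mul (hA t) ((w - w').norm_coe_le_norm t) (norm_nonneg _) hε0)
  have h3 : ‖w - w'‖ ≤ ε * ‖w - w'‖ := by
    conv_lhs => rw [h1]
    exact (norm_primitive_le _).trans h2
  have h4 : ‖w - w'‖ = 0 := by nlinarith [norm_nonneg (w - w')]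
  exact sub_eq_zero.1 (norm_eq_zero.1 h4)

/-- The derivative of the flow map sends the vector field to the vector field. -/
theorem fderiv_flow_apply_field {V : E → E} (hV : BddDeriv V) {ε : ℝ} (hε : ε < 1)
    (hV1 : ∀ x, ‖fderiv ℝ V x‖ ≤ ε) {Φ : E → C(I, E)} (hΦd : Differentiable ℝ Φ)
    (hΦ : ∀ x, Φ x = constCurve x + primitive (superpose V hV.continuous (Φ x))) (x : E) :
    fderiv ℝ Φ x (V x) = superpose V hV.continuous (Φ x) := by
  set A := superpose (fderiv ℝ V) hV.fderiv.continuous (Φ x)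
  -- Both sides solve the variational equation along the trajectory with initial value `V x`: one is
  -- the variation of the flow in the direction `V x`, the other the velocity of the trajectory.
  refine eq_of_linear_integral_eq (A := A) (c := constCurve (V x)) (fun t => hV1 _) hε ?_ ?_
  · have h1 : HasFDerivAt Φ (constCurve + (primitive ∘L (curveApply A)) ∘L fderiv ℝ Φ x) x := by
      have h2 : HasFDerivAt (fun x => constCurve x + primitive (superpose V hV.continuous (Φ x)))
          (constCurve + (primitive ∘L (curveApply A)) ∘L fderiv ℝ Φ x) x :=
        (constCurve : E →L[ℝ] C(I, E)).hasFDerivAt.add (((primitive : C(I, E) →L[ℝ] C(I, E)).hasFDerivAt.comp _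
          (hasFDerivAt_superpose hV (Φ x))).comp x (hΦd x).hasFDerivAt)
      exact h2.congr_of_eventuallyEq (Eventually.of_forall hΦ)
    conv_lhs => rw [h1.fderiv]
    rfl
  · obtain ⟨g, hg, hg'⟩ := exists_integral_curve hV.continuous (hΦ x)
    have hproj : ∀ t : I, projIcc (0 : ℝ) 1 zero_le_one t = t := fun t => projIcc_val _ t
    ext t
    have hc : Continuous g := continuous_iff_continuousAt.2 fun s => (hg' s).continuousAt
    have hint : ∫ s in (0 : ℝ)..t,
        fderiv ℝ V (g s) (V (Φ x (projIcc 0 1 zero_le_one s))) = V (g t) - V (g 0) := by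
      refine intervalIntegral.integral_eq_sub_of_hasDerivAt (f := fun s => V (g s))
        (fun s _ => (hV.differentiable (g s)).hasFDerivAt.comp_hasDerivAt s (hg' s))
        (Continuous.intervalIntegrable ?_ _ _)
      exact (hV.fderiv.continuous.comp hc).clm_apply
        (hV.continuous.comp ((Φ x).continuous.comp continuous_projIcc))
    have hg0 : g 0 = x := by
      have := hg 0
      rw [hΦ x] at this
      simpa [primitive_apply] using this
    have hcongr : ∫ s in (0 : ℝ)..t, (curveApply A (superpose V hV.continuous (Φ x)))
        (projIcc 0 1 zero_le_one s) = ∫ s in (0 : ℝ)..t,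
        fderiv ℝ V (g s) (V (Φ x (projIcc 0 1 zero_le_one s))) := by
      refine intervalIntegral.integral_congr fun s hs => ?_
      rw [uIcc_of_le t.2.1] at hs
      have hs' : s ∈ I := ⟨hs.1, hs.2.trans t.2.2⟩
      have := hg ⟨s, hs'⟩
      simp only [curveApply_apply, superpose_apply, A, projIcc_of_mem zero_le_one hs']
      rw [← this]
    rw [ContinuousMap.add_apply, primitive_apply, hcongr, hint, hg0, hg t]
    simp

/-- The time-one map of a vector field with small derivatives. -/
theorem exists_time_one_map {V : E → E} (hV : BddDeriv V) {k : ℕ} (hk : 1 ≤ k)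
    (hVk : ∀ j, 1 ≤ j → j ≤ k + 1 → ∀ x, ‖iteratedFDeriv ℝ j V x‖ ≤ smallSize k) :
    ∃ φ : E → E, ContDiff ℝ k φ ∧
      (∀ j, 1 ≤ j → j ≤ k → ∀ x, ‖iteratedFDeriv ℝ j φ x‖ ≤ 2 ^ j) ∧
      (∀ x, fderiv ℝ φ x (V x) = V (φ x)) ∧
      ∀ x, ∃ g : ℝ → E, g 0 = x ∧ g 1 = φ x ∧ ∀ t ∈ Icc (0 : ℝ) 1, HasDerivAt g (V (g t)) t := by
  obtain ⟨Φ, hΦ, hb, heq⟩ := exists_flow hV hVk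
  set ev : C(I, E) →L[ℝ] E := ContinuousMap.evalCLM ℝ (1 : I) with hev
  have hevn : ‖ev‖ ≤ 1 := ContinuousLinearMap.opNorm_le_bound _ zero_le_one fun γ => by
    rw [one_mul]; exact γ.norm_coe_le_norm _
  have hΦd : Differentiable ℝ Φ := hΦ.differentiable (by
    exact_mod_cast Nat.one_le_iff_ne_zero.1 hk)
  refine ⟨fun x => Φ x 1, ev.contDiff.comp hΦ, fun j h1 hj x => ?_, fun x => ?_, fun x => ?_⟩
  · refine (ev.norm_iteratedFDeriv_comp_left (hΦ.contDiffAt (x := x))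
      (by exact_mod_cast hj)).trans ?_
    exact (mul_le_of_le_one_left (norm_nonneg _) hevn).trans (hb j h1 hj x)
  · have h1 : HasFDerivAt (fun x => Φ x 1) (ev ∘L fderiv ℝ Φ x) x :=
      ev.hasFDerivAt.comp x (hΦd x).hasFDerivAt
    have h2 := fderiv_flow_apply_field hV (ε := smallSize k)
      ((smallSize_le_half k).trans_lt (by norm_num)) (fun x => by
        rw [norm_fderiv_eq_norm_iteratedFDeriv_one]
        exact hVk 1 le_rfl (by omega) x) hΦd heq x
    rw [h1.fderiv, ContinuousLinearMap.comp_apply, h2]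
    rfl
  · obtain ⟨g, hg, hg'⟩ := exists_integral_curve hV.continuous (heq x)
    refine ⟨g, ?_, hg 1, fun t ht => ?_⟩
    · have := hg 0
      rw [heq x] at this
      simpa [primitive_apply] using this
    · have := hg' t
      rwa [projIcc_of_mem zero_le_one ht, ← hg ⟨t, ht⟩] at this

end TimeOneMap

/-! ### Flatness passes from a function to its derivatives. -/

section Flatness

variable {E F W : Type} [NormedAddCommGroup E] [NormedSpace ℝ E]
  [NormedAddCommGroup F] [NormedSpace ℝ F] [NormedAddCommGroup W] [NormedSpace ℝ W]

/-- A `C²` map with bounded derivatives which is flat of order `2m` along the kernel of `ℓ` has a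
derivative which is flat of order `m`. -/
theorem exists_norm_fderiv_le_of_flat {g : E → F} (hg : ContDiff ℝ 2 g) (ℓ : E →L[ℝ] W) {m : ℕ}
    (hm : 1 ≤ m) {C : ℝ} (h1 : ∀ w, ‖fderiv ℝ g w‖ ≤ C) (h2 : ∀ w, ‖iteratedFDeriv ℝ 2 g w‖ ≤ C)
    (h : ∀ w, ‖g w‖ ≤ C * ‖ℓ w‖ ^ (2 * m)) :
    ∃ C', 0 ≤ C' ∧ ∀ w, ‖fderiv ℝ g w‖ ≤ C' * ‖ℓ w‖ ^ m := by
  have hC : 0 ≤ C := (norm_nonneg _).trans (h1 0)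
  set L := 1 + ‖ℓ‖ with hL
  have hL1 : 1 ≤ L := by simp [hL]
  refine ⟨C * (L ^ (2 * m) + 2), by positivity, fun w => ?_⟩
  rcases le_or_gt 1 ‖ℓ w‖ with hw | hw
  · refine (h1 w).trans ?_
    have h3 : (1 : ℝ) ≤ ‖ℓ w‖ ^ m := one_le_pow₀ hw
    have h4 : (1 : ℝ) ≤ L ^ (2 * m) + 2 := by
      have : 0 ≤ L ^ (2 * m) := by positivity
      linarith
    calc C = C * 1 * 1 := by ring
      _ ≤ _ := by gcongr
  -- The positive auxiliary radius `s` avoids a displacement of length zero when `ℓ w = 0`; it is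
  -- sent to `‖ℓ w‖` at the end.
  · have key : ∀ s : ℝ, ‖ℓ w‖ < s → s < 1 → ‖fderiv ℝ g w‖ ≤ C * (L ^ (2 * m) + 2) * s ^ m := by
      intro s hs hs1
      have hs0 : 0 < s := (norm_nonneg _).trans_lt hs
      refine ContinuousLinearMap.opNorm_le_bound _ (by positivity) fun e => ?_
      rcases eq_or_ne e 0 with rfl | he
      · simp
      have he' : 0 < ‖e‖ := norm_pos_iff.2 he
      -- With a displacement of length `s ^ m` the quadratic Taylor remainder has the size `s ^ (2 *
      -- m)` of the function itself; division by `s ^ m` leaves order `m` for the derivative.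
      set h' := (s ^ m / ‖e‖) • e with hh'
      have hn : ‖h'‖ = s ^ m := by
        rw [hh', norm_smul, Real.norm_of_nonneg (by positivity)]
        field_simp
      have hsm : s ^ m ≤ s := by
        simpa using pow_le_pow_of_le_one hs0.le hs1.le hm
      have hℓ : ‖ℓ (w + h')‖ ≤ L * s := by
        rw [map_add]
        refine (norm_add_le _ _).trans ?_
        have := ℓ.le_opNorm h'
        rw [hn] at this
        have : ‖ℓ‖ * s ^ m ≤ ‖ℓ‖ * s := by gcongr
        rw [hL]
        linarith
      have t1 := norm_taylor_one_le hg h2 w h'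
      have t2 : ‖fderiv ℝ g w h'‖ ≤ C * (L * s) ^ (2 * m) + C * s ^ (2 * m) + C * (s ^ m) ^ 2 := by
        have e1 : fderiv ℝ g w h' = g (w + h') - g w - (g (w + h') - g w - fderiv ℝ g w h') := by
          abel
        rw [e1]
        refine (norm_sub_le _ _).trans (add_le_add ((norm_sub_le _ _).trans
          (add_le_add ((h _).trans ?_) ((h _).trans ?_))) (hn ▸ t1))
        · gcongr
        · gcongr
      have t3 : C * (L * s) ^ (2 * m) + C * s ^ (2 * m) + C * (s ^ m) ^ 2 =
          (C * (L ^ (2 * m) + 2) * s ^ m) * s ^ m := by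
        rw [mul_pow, pow_mul' s 2 m]
        ring
      rw [t3, hh', map_smul, norm_smul, Real.norm_of_nonneg (by positivity),
        div_mul_eq_mul_div, div_le_iff₀ he'] at t2
      have hsm0 : 0 < s ^ m := by positivity
      refine le_of_mul_le_mul_left ?_ hsm0
      calc _ ≤ _ := t2
        _ = _ := by ring
    have hcont : Tendsto (fun s : ℝ => C * (L ^ (2 * m) + 2) * s ^ m) (𝓝[>] ‖ℓ w‖)
        (𝓝 (C * (L ^ (2 * m) + 2) * ‖ℓ w‖ ^ m)) :=
      (Continuous.tendsto (by fun_prop) _).mono_left nhdsWithin_le_nhds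
    refine ge_of_tendsto hcont ?_
    filter_upwards [Ioo_mem_nhdsGT hw] with s hs
    exact key s hs.1 hs.2

/-- Each differentiation halves the order of flatness, hence the factor `2 ^ k`. -/
theorem exists_norm_iteratedFDeriv_le_of_flat (k : ℕ) : ∀ {F : Type} [NormedAddCommGroup F]
    [NormedSpace ℝ F] {δ : E → F} (_ : ContDiff ℝ (k + 1 : ℕ) δ) (ℓ : E →L[ℝ] W) {m : ℕ}
    (_ : 1 ≤ m) {C : ℝ} (_ : ∀ j ≤ k + 1, ∀ w, ‖iteratedFDeriv ℝ j δ w‖ ≤ C)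
    (_ : ∀ w, ‖δ w‖ ≤ C * ‖ℓ w‖ ^ (2 ^ k * m)),
    ∃ C', 0 ≤ C' ∧ ∀ j ≤ k, ∀ w, ‖iteratedFDeriv ℝ j δ w‖ ≤ C' * ‖ℓ w‖ ^ m := by
  induction k with
  | zero =>
    intro F _ _ δ hδ ℓ m hm C hC h
    refine ⟨C, (norm_nonneg _).trans (hC 0 (by omega) 0), fun j hj w => ?_⟩
    obtain rfl : j = 0 := by omega
    rw [norm_iteratedFDeriv_zero]
    simpa using h w
  | succ k ih =>
    intro F _ _ δ hδ ℓ m hm C hC h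
    have hC0 : 0 ≤ C := (norm_nonneg _).trans (hC 0 (by omega) 0)
    obtain ⟨C₁, hC₁, h1⟩ := exists_norm_fderiv_le_of_flat (m := 2 ^ k * m)
      (hδ.of_le (by exact_mod_cast (by omega : 2 ≤ k + 1 + 1))) ℓ
      (Nat.one_le_iff_ne_zero.2 (by positivity))
      (fun w => by rw [norm_fderiv_eq_norm_iteratedFDeriv_one]; exact hC 1 (by omega) w)
      (hC 2 (by omega)) (fun w => by
        have := h w
        rwa [pow_succ', mul_assoc] at this)
    obtain ⟨C₂, hC₂, h2⟩ := ih (δ := fderiv ℝ δ) (hδ.fderiv_right (by norm_cast)) ℓ hm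
      (C := max C C₁) (fun j hj w => by
        rw [norm_iteratedFDeriv_fderiv]
        exact (hC (j + 1) (by omega) w).trans (le_max_left _ _)) (fun w => (h1 w).trans (by
          gcongr; exact le_max_right _ _))
    refine ⟨max C C₂, by positivity, fun j hj w => ?_⟩
    rcases Nat.eq_zero_or_pos j with rfl | hj0
    · have h3 : ‖iteratedFDeriv ℝ 0 δ w‖ ≤ C * ‖ℓ w‖ ^ m := by
        rcases le_or_gt 1 ‖ℓ w‖ with hw | hw
        · exact (hC 0 (by omega) w).trans (le_mul_of_one_le_right hC0 (one_le_pow₀ hw))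
        · rw [norm_iteratedFDeriv_zero]
          refine (h w).trans (mul_le_mul_of_nonneg_left ?_ hC0)
          exact pow_le_pow_of_le_one (norm_nonneg _) hw.le
            (Nat.le_mul_of_pos_left m (by positivity))
      refine h3.trans ?_
      gcongr
      exact le_max_left _ _
    · obtain ⟨i, rfl⟩ : ∃ i, j = i + 1 := ⟨j - 1, by omega⟩
      rw [← norm_iteratedFDeriv_fderiv]
      refine (h2 i (by omega) w).trans ?_
      gcongr
      exact le_max_right _ _

end Flatness

/-! ### Contraction, Gronwall estimates and uniqueness along trajectories. -/

section Curves

variable {E W : Type} [NormedAddCommGroup E] [NormedSpace ℝ E]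

/-- The contraction inequality says that `exp (2 m t) ‖ℓ (g t)‖ ^ 2` has a nonpositive derivative.
-/
theorem norm_le_exp_mul_of_contracting [NormedAddCommGroup W] [InnerProductSpace ℝ W]
    {X : E → E} (ℓ : E →L[ℝ] W) {m : ℝ}
    (hℓ : ∀ w, inner ℝ (ℓ w) (ℓ (X w)) ≤ -m * ‖ℓ w‖ ^ 2) {g : ℝ → E}
    (hg : ∀ t ∈ Icc (0 : ℝ) 1, HasDerivAt g (X (g t)) t) {t : ℝ} (ht : t ∈ Icc (0 : ℝ) 1) :
    ‖ℓ (g t)‖ ≤ Real.exp (-m * t) * ‖ℓ (g 0)‖ := by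
  set q : ℝ → ℝ := fun t => Real.exp (2 * m * t) * ‖ℓ (g t)‖ ^ 2
  have hq : ∀ t ∈ Icc (0 : ℝ) 1, HasDerivAt q
      (Real.exp (2 * m * t) * (2 * m) * ‖ℓ (g t)‖ ^ 2 +
        Real.exp (2 * m * t) * (2 * inner ℝ (ℓ (g t)) (ℓ (X (g t))))) t := by
    intro t ht
    have h1 : HasDerivAt (fun t => Real.exp (2 * m * t)) (Real.exp (2 * m * t) * (2 * m)) t := by
      simpa using ((hasDerivAt_id t).const_mul (2 * m)).exp
    have h2 : HasDerivAt (fun t => ℓ (g t)) (ℓ (X (g t))) t :=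
      ℓ.hasFDerivAt.comp_hasDerivAt t (hg t ht)
    exact h1.mul h2.norm_sq
  have hanti : AntitoneOn q (Icc 0 1) := by
    refine antitoneOn_of_deriv_nonpos (convex_Icc 0 1)
      (fun t ht => (hq t ht).continuousAt.continuousWithinAt)
      (fun t ht => (hq t (interior_subset ht)).differentiableAt.differentiableWithinAt)
      (fun t ht => ?_)
    rw [(hq t (interior_subset ht)).deriv]
    have := hℓ (g t)
    have he := Real.exp_pos (2 * m * t)
    nlinarith
  have h3 : q t ≤ q 0 := hanti ⟨le_rfl, zero_le_one⟩ ht ht.1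
  simp only [q, mul_zero, Real.exp_zero, one_mul] at h3
  have h4 : ‖ℓ (g t)‖ ^ 2 ≤ (Real.exp (-m * t) * ‖ℓ (g 0)‖) ^ 2 := by
    have e1 : Real.exp (2 * m * t) * Real.exp (-m * t) ^ 2 = 1 := by
      rw [← Real.exp_nat_mul, ← Real.exp_add, Real.exp_eq_one_iff]
      push_cast
      ring
    have e2 := sq_nonneg (Real.exp (-m * t))
    rw [mul_pow]
    calc ‖ℓ (g t)‖ ^ 2 = Real.exp (-m * t) ^ 2 * (Real.exp (2 * m * t) * ‖ℓ (g t)‖ ^ 2) := by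
          rw [← mul_assoc, mul_comm (Real.exp (-m * t) ^ 2), e1, one_mul]
      _ ≤ _ := by gcongr
  exact le_of_sq_le_sq h4 (by positivity)

/-- Following the field `X` during a unit of time and then `-Z` almost brings back to the initial
point, if `X` and `Z` are close along the trajectory. -/
theorem norm_round_trip_le {X Z : E → E} (hZ : Differentiable ℝ Z)
    (hZ1 : ∀ x, ‖fderiv ℝ Z x‖ ≤ 1) {g b : ℝ → E}
    (hg : ∀ t ∈ Icc (0 : ℝ) 1, HasDerivAt g (X (g t)) t)
    (hb : ∀ t ∈ Icc (0 : ℝ) 1, HasDerivAt b (-Z (b t)) t) (h01 : b 0 = g 1) {e : ℝ}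
    (he : ∀ t ∈ Icc (0 : ℝ) 1, ‖X (g t) - Z (g t)‖ ≤ e) : ‖b 1 - g 0‖ ≤ 2 * e := by
  have he0 : 0 ≤ e := (norm_nonneg _).trans (he 0 (by simp))
  have hlip : LipschitzWith 1 fun x => -Z x :=
    (LipschitzWith.of_dist_le_mul fun x y => by
      rw [dist_eq_norm, dist_eq_norm, NNReal.coe_one]
      exact norm_sub_le_of_norm_fderiv_le hZ hZ1 x y).neg
  -- The reversed trajectory `g (1 - t)` solves the equation of `-Z` up to the error `e` and starts
  -- at the same point as `b`. Gronwall's inequality gives the factor `exp 1 - 1`, which is less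
  -- than `2`.
  have ha : ∀ t ∈ Icc (0 : ℝ) 1, HasDerivAt (fun t => g (1 - t)) (-X (g (1 - t))) t := by
    intro t ht
    have := (hg (1 - t) ⟨by linarith [ht.2], by linarith [ht.1]⟩).scomp t
      ((hasDerivAt_id t).const_sub 1)
    simpa [Function.comp_def] using this
  have := dist_le_of_approx_trajectories_ODE (v := fun _ x => -Z x) (K := 1) (fun _ => hlip)
    (f := b) (f' := fun t => -Z (b t)) (g := fun t => g (1 - t)) (g' := fun t => -X (g (1 - t)))
    (a := 0) (b := 1) (εf := 0) (εg := e) (δ := 0)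
    (fun t ht => (hb t ht).continuousAt.continuousWithinAt)
    (fun t ht => (hb t ⟨ht.1, ht.2.le⟩).hasDerivWithinAt) (fun t _ => by simp)
    (fun t ht => (ha t ht).continuousAt.continuousWithinAt)
    (fun t ht => (ha t ⟨ht.1, ht.2.le⟩).hasDerivWithinAt)
    (fun t ht => by
      rw [dist_eq_norm, neg_sub_neg, norm_sub_rev]
      exact he (1 - t) ⟨by linarith [ht.2], by linarith [ht.1]⟩)
    (by simp [h01]) 1 (by simp)
  rw [gronwallBound_of_K_ne_0 (by simp)] at this
  simp only [zero_mul, zero_add, sub_self, NNReal.coe_one, div_one, sub_zero, one_mul,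
    dist_eq_norm] at this
  have h3 := Real.exp_one_lt_d9
  nlinarith

theorem eq_of_linear_ode [NormedAddCommGroup W] [NormedSpace ℝ W] (B : W →L[ℝ] W)
    {α β : ℝ → W} (hα : ∀ t ∈ Icc (0 : ℝ) 1, HasDerivAt α (B (α t)) t)
    (hβ : ∀ t ∈ Icc (0 : ℝ) 1, HasDerivAt β (B (β t)) t) (h : α 0 = β 0) : α 1 = β 1 := by
  have := dist_le_of_trajectories_ODE (v := fun _ x => B x) (K := ‖B‖₊) (fun _ => B.lipschitz)
    (f := α) (g := β) (a := 0) (b := 1) (δ := 0)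
    (fun t ht => (hα t ht).continuousAt.continuousWithinAt)
    (fun t ht => (hα t ⟨ht.1, ht.2.le⟩).hasDerivWithinAt)
    (fun t ht => (hβ t ht).continuousAt.continuousWithinAt)
    (fun t ht => (hβ t ⟨ht.1, ht.2.le⟩).hasDerivWithinAt) (by simp [h]) 1 (by simp)
  rw [zero_mul] at this
  exact dist_le_zero.1 this

end Curves

/-! ### Iterates of a map. -/

section Iterates

variable {E : Type} [NormedAddCommGroup E] [NormedSpace ℝ E]

theorem contDiff_iterate {f : E → E} {k : ℕ} (hf : ContDiff ℝ k f) (n : ℕ) :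
    ContDiff ℝ k f^[n] := by
  induction n with
  | zero => exact contDiff_id
  | succ n ih => rw [Function.iterate_succ']; exact hf.comp ih

/-- The form `(Λ ^ n) ^ i` is the one required of the inner map in the composition bound, so the
induction closes: the new factor `i ! * B ≤ Λ` is absorbed in `Λ ^ i`, as `1 ≤ i`. -/
theorem norm_iteratedFDeriv_iterate_le {f : E → E} {k : ℕ} (hf : ContDiff ℝ k f) {B Λ : ℝ}
    (hB : 0 ≤ B) (hΛ : k.factorial * B ≤ Λ) (hΛ1 : 1 ≤ Λ)
    (hfB : ∀ i, 1 ≤ i → i ≤ k → ∀ x, ‖iteratedFDeriv ℝ i f x‖ ≤ B) (n : ℕ) :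
    ∀ i, 1 ≤ i → i ≤ k → ∀ x, ‖iteratedFDeriv ℝ i f^[n] x‖ ≤ (Λ ^ n) ^ i := by
  induction n with
  | zero =>
    intro i h1 hi x
    simp only [Function.iterate_zero, pow_zero, one_pow]
    exact (norm_iteratedFDeriv_clm_le (ContinuousLinearMap.id ℝ E) h1 x).trans
      ContinuousLinearMap.norm_id_le
  | succ n ih =>
    intro i h1 hi x
    have hik : ((i : ℕ) : ℕ∞ω) ≤ k := by exact_mod_cast hi
    rw [Function.iterate_succ']
    refine (norm_iteratedFDeriv_comp_le_of_one_le h1 (hf.of_le hik) ((contDiff_iterate hf n).of_le hik) x hB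
      (fun j hj1 hj => hfB j hj1 (by omega) _) (fun j hj1 hj => ih j hj1 (by omega) x)).trans ?_
    have h2 : (i.factorial : ℝ) ≤ k.factorial := by exact_mod_cast Nat.factorial_le hi
    calc (i.factorial : ℝ) * B * (Λ ^ n) ^ i ≤ k.factorial * B * (Λ ^ n) ^ i := by gcongr
      _ ≤ Λ * (Λ ^ n) ^ i := by gcongr
      _ ≤ Λ ^ i * (Λ ^ n) ^ i := by
        gcongr
        exact le_self_pow₀ hΛ1 (by omega)
      _ = _ := by rw [← mul_pow, ← pow_succ']

theorem fderiv_iterate_apply_field {f X : E → E} (hf : Differentiable ℝ f)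
    (h : ∀ x, fderiv ℝ f x (X x) = X (f x)) (n : ℕ) (x : E) :
    fderiv ℝ f^[n] x (X x) = X (f^[n] x) := by
  induction n with
  | zero => simp
  | succ n ih =>
    rw [Function.iterate_succ', fderiv_comp x (hf _) (hf.iterate n x),
      ContinuousLinearMap.comp_apply, ih, h]
    rfl

end Iterates

/-! ### Conjugations as limits of `κ^n ∘ f^n`. -/

section Conjugation

variable {E : Type} [NormedAddCommGroup E] [NormedSpace ℝ E] [CompleteSpace E]

/-- The limit of `κ^n ∘ f^n`, when `κ` is almost inverse to `f` along the orbits of `f`. -/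
theorem exists_limit_conjugation {k : ℕ} {B Λ θ : ℝ} {m : ℕ} {W : Type}
    [NormedAddCommGroup W] [NormedSpace ℝ W] (hB : 0 ≤ B)
    (hΛ : (k + 1).factorial * B ≤ Λ) (hΛ1 : 1 ≤ Λ) (hθ : 0 ≤ θ)
    (hsmall : Λ ^ (3 * k + 1) * θ ^ m ≤ 1 / 2) {f κ : E → E}
    (hf : ContDiff ℝ (k + 1 : ℕ) f) (hκ : ContDiff ℝ (k + 1 : ℕ) κ)
    (hfB : ∀ i, 1 ≤ i → i ≤ k + 1 → ∀ x, ‖iteratedFDeriv ℝ i f x‖ ≤ B)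
    (hκB : ∀ i, 1 ≤ i → i ≤ k + 1 → ∀ x, ‖iteratedFDeriv ℝ i κ x‖ ≤ B)
    (ℓ : E →L[ℝ] W) (hℓ : ∀ x, ‖ℓ (f x)‖ ≤ θ * ‖ℓ x‖) {C : ℝ} (hC : 0 ≤ C)
    (hδ : ∀ j ≤ k, ∀ w, ‖iteratedFDeriv ℝ j (fun x => κ (f x) - x) w‖ ≤ C * ‖ℓ w‖ ^ m) :
    ∃ G : E → E, ContDiff ℝ k G ∧
      (∀ j ≤ k, ∀ x, Tendsto (fun n => iteratedFDeriv ℝ j (fun z => κ^[n] (f^[n] z)) x) atTop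
        (𝓝 (iteratedFDeriv ℝ j G x))) ∧
      ∃ C', ∀ x, ‖G x - x‖ ≤ C' * ‖ℓ x‖ ^ m := by
  have hkk : ((k : ℕ) : ℕ∞ω) ≤ ((k + 1 : ℕ) : ℕ∞ω) := by exact_mod_cast Nat.le_succ k
  have hfk := hf.of_le hkk
  have hκk := hκ.of_le hkk
  have hfac : (k.factorial : ℝ) * B ≤ Λ := by
    refine le_trans ?_ hΛ
    gcongr
    exact Nat.le_succ k
  have hfn := norm_iteratedFDeriv_iterate_le hfk hB hfac hΛ1 (fun i h1 hi => hfB i h1 (by omega))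
  have hκn := norm_iteratedFDeriv_iterate_le hκ hB hΛ hΛ1 hκB
  have hℓn : ∀ n x, ‖ℓ (f^[n] x)‖ ≤ θ ^ n * ‖ℓ x‖ := by
    intro n x
    induction n with
    | zero => simp
    | succ n ih =>
      rw [Function.iterate_succ']
      refine (hℓ _).trans ?_
      rw [pow_succ', mul_assoc]
      gcongr
  have hΛ0 : 0 ≤ Λ := zero_le_one.trans hΛ1
  have hK := compConst_nonneg k
  set A : ℝ := compConst k * Λ ^ (2 * k) * (k.factorial * C) with hA
  have hA0 : 0 ≤ A := by positivity
  -- Both terms are `κ^n` applied to nearby points, `κ (f^(n+1) z)` and `f^n z`, whose difference is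
  -- `κ ∘ f - id` evaluated at `f^n z`. Per unit of `n` the powers of `Λ` are `k + 1` from `κ^n`,
  -- `k` from the inner maps and `k` from `f^n` inside the difference; this is the exponent `3 * k +
  -- 1`, set against `θ ^ m`.
  have hdiff : ∀ n, ∀ j ≤ k, ∀ x, ‖iteratedFDeriv ℝ j
      (fun z => κ^[n + 1] (f^[n + 1] z) - κ^[n] (f^[n] z)) x‖ ≤ A * ‖ℓ x‖ ^ m * (1 / 2) ^ n := by
    intro n j hj x
    have hfnc := contDiff_iterate hfk n
    have ha : ContDiff ℝ k fun z => κ (f^[n + 1] z) := hκk.comp (contDiff_iterate hfk (n + 1))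
    have hD1 : 1 ≤ Λ ^ (n + 2) := one_le_pow₀ hΛ1
    have hda : ∀ i, 1 ≤ i → i ≤ k →
        ‖iteratedFDeriv ℝ i (fun z => κ (f^[n + 1] z)) x‖ ≤ (Λ ^ (n + 2)) ^ i := by
      intro i h1 hi
      have hik : ((i : ℕ) : ℕ∞ω) ≤ k := by exact_mod_cast hi
      refine (norm_iteratedFDeriv_comp_le_of_one_le h1 (hκk.of_le hik)
        ((contDiff_iterate hfk (n + 1)).of_le hik) x hB
        (fun j hj1 hj => hκB j hj1 (by omega) _)
        (fun j hj1 hj => hfn (n + 1) j hj1 (by omega) x)).trans ?_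
      have h2 : (i.factorial : ℝ) ≤ k.factorial := by exact_mod_cast Nat.factorial_le hi
      calc (i.factorial : ℝ) * B * (Λ ^ (n + 1)) ^ i
          ≤ k.factorial * B * (Λ ^ (n + 1)) ^ i := by gcongr
        _ ≤ Λ * (Λ ^ (n + 1)) ^ i := by gcongr
        _ ≤ Λ ^ i * (Λ ^ (n + 1)) ^ i := by
          gcongr
          exact le_self_pow₀ hΛ1 (by omega)
        _ = _ := by rw [← mul_pow, ← pow_succ']
    have hdb : ∀ i, 1 ≤ i → i ≤ k → ‖iteratedFDeriv ℝ i f^[n] x‖ ≤ (Λ ^ (n + 2)) ^ i := by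
      intro i h1 hi
      refine (hfn n i h1 hi x).trans (pow_le_pow_left₀ (by positivity) ?_ i)
      exact pow_le_pow_right₀ hΛ1 (by omega)
    have hε : ∀ i ≤ k, ‖iteratedFDeriv ℝ i (fun z => κ (f^[n + 1] z) - f^[n] z) x‖ ≤
        k.factorial * C * (Λ ^ n) ^ k * (θ ^ n * ‖ℓ x‖) ^ m := by
      intro i hi
      have hik : ((i : ℕ) : ℕ∞ω) ≤ k := by exact_mod_cast hi
      have e1 : (fun z => κ (f^[n + 1] z) - f^[n] z) = (fun x => κ (f x) - x) ∘ f^[n] := by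
        ext1 z
        simp only [Function.comp_apply, Function.iterate_succ']
      rw [e1]
      refine (norm_iteratedFDeriv_comp_le (n := i) (((hκk.comp hfk).sub contDiff_id).of_le hik)
        (hfnc.of_le hik) le_rfl x (C := C * (θ ^ n * ‖ℓ x‖) ^ m) (D := Λ ^ n)
        (fun j hj => (hδ j (by omega) _).trans (by gcongr; exact hℓn n x))
        (fun j h1 hj => hfn n j h1 (by omega) x)).trans ?_
      have h2 : (i.factorial : ℝ) ≤ k.factorial := by exact_mod_cast Nat.factorial_le hi
      have h3 : (Λ ^ n) ^ i ≤ (Λ ^ n) ^ k := pow_le_pow_right₀ (one_le_pow₀ hΛ1) hi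
      calc _ ≤ (k.factorial : ℝ) * (C * (θ ^ n * ‖ℓ x‖) ^ m) * (Λ ^ n) ^ k := by gcongr
        _ = _ := by ring
    have e2 : (fun z => κ^[n + 1] (f^[n + 1] z) - κ^[n] (f^[n] z)) =
        fun z => κ^[n] (κ (f^[n + 1] z)) - κ^[n] (f^[n] z) := by
      ext1 z
      rw [Function.iterate_succ_apply κ]
    rw [e2]
    refine (norm_iteratedFDeriv_comp_sub_le k (contDiff_iterate hκ n) ha hfnc x
      (C := (Λ ^ n) ^ (k + 1)) (D := Λ ^ (n + 2)) (by positivity) hD1 (by positivity)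
      (fun i h1 hi y => (hκn n i h1 hi y).trans (pow_le_pow_right₀ (one_le_pow₀ hΛ1) hi))
      hda hdb hε j hj).trans ?_
    have h4 : (Λ ^ (n + 2)) ^ j ≤ (Λ ^ (n + 2)) ^ k := pow_le_pow_right₀ hD1 hj
    calc _ ≤ compConst k * (Λ ^ n) ^ (k + 1) * (Λ ^ (n + 2)) ^ k *
          (k.factorial * C * (Λ ^ n) ^ k * (θ ^ n * ‖ℓ x‖) ^ m) := by gcongr
      _ = A * ‖ℓ x‖ ^ m * (Λ ^ (3 * k + 1) * θ ^ m) ^ n := by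
        rw [hA]
        ring
      _ ≤ _ := by gcongr
  have hcd : ∀ n, ContDiff ℝ k fun z => κ^[n] (f^[n] z) := fun n =>
    (contDiff_iterate hκk n).comp (contDiff_iterate hfk n)
  obtain ⟨G, hG, hlim⟩ := exists_contDiff_limit k (fun n z => κ^[n] (f^[n] z)) hcd (fun x₀ => by
    have hcont : Continuous fun x => A * ‖ℓ x‖ ^ m := by fun_prop
    obtain ⟨r, hr, h⟩ := Metric.eventually_nhds_iff_ball.1
      (hcont.continuousAt.eventually (gt_mem_nhds (lt_add_one (A * ‖ℓ x₀‖ ^ m))))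
    refine ⟨r, hr, fun n => (A * ‖ℓ x₀‖ ^ m + 1) * (1 / 2) ^ n,
      summable_geometric_two.mul_left _, fun n j hj x hx => (hdiff n j hj x).trans ?_⟩
    exact mul_le_mul_of_nonneg_right (h x hx).le (by positivity))
  refine ⟨G, hG, hlim, 2 * A, fun x => ?_⟩
  have ht : Tendsto (fun n => κ^[n] (f^[n] x)) atTop (𝓝 (G x)) := by
    have := hlim 0 (by omega) x
    simp only [iteratedFDeriv_zero_eq_comp] at this
    simpa [Function.comp_def] using
      ((continuousMultilinearCurryFin0 ℝ E E).continuous.tendsto _).comp this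
  have h5 := dist_le_tsum_of_dist_le_of_tendsto₀ (fun n => A * ‖ℓ x‖ ^ m * (1 / 2) ^ n)
    (f := fun n => κ^[n] (f^[n] x)) (fun n => by
      have := hdiff n 0 (by omega) x
      rwa [norm_iteratedFDeriv_zero, ← dist_eq_norm, dist_comm] at this)
    (summable_geometric_two.mul_left _) ht
  rw [tsum_mul_left, tsum_geometric_two, dist_comm, dist_eq_norm] at h5
  calc _ ≤ _ := h5
    _ = _ := by ring

theorem norm_iteratedFDeriv_neg_field (V : E → E) (j : ℕ) (x : E) :
    ‖iteratedFDeriv ℝ j (fun x => -V x) x‖ = ‖iteratedFDeriv ℝ j V x‖ := by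
  have : iteratedFDeriv ℝ j (fun x => -V x) x = -iteratedFDeriv ℝ j V x :=
    iteratedFDeriv_neg_apply
  rw [this, norm_neg]

/-- The exponent needed to conjugate two vector fields of small size. -/
theorem exists_order (k : ℕ) {m : ℝ} (hm : 0 < m) :
    ∃ N : ℕ, 2 ≤ N ∧ (((k + 1).factorial : ℝ) * 2 ^ (k + 1)) ^ (3 * k + 1) * Real.exp (-m) ^ N
      ≤ 1 / 2 := by
  set a := (((k + 1).factorial : ℝ) * 2 ^ (k + 1)) ^ (3 * k + 1)
  have h1 : Tendsto (fun N : ℕ => a * Real.exp (-m) ^ N) atTop (𝓝 (a * 0)) :=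
    (tendsto_pow_atTop_nhds_zero_of_lt_one (Real.exp_pos _).le
      (Real.exp_lt_one_iff.2 (by linarith))).const_mul a
  rw [mul_zero] at h1
  obtain ⟨N, hN, hN2⟩ := ((h1.eventually (ge_mem_nhds (by norm_num : (0 : ℝ) < 1 / 2))).and
    (eventually_ge_atTop 2)).exists
  exact ⟨N, hN2, hN⟩

/-- With `f` and `κ` the time-one maps of `X` and `-Z`, the round trip `κ ∘ f` differs from the
identity by a term as flat as `X - Z`; the flatness lemma makes its derivatives flat, which is where
the factor `2 ^ k` in `M` is spent. The last clause lets the conjugation preserve every linear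
projection on which both fields induce the same linear field. The order `M` precedes the spaces and
the fields, which keeps the degree of the normal form uniform. -/
theorem exists_conjugation_of_small {k : ℕ} (hk : 1 ≤ k) {m : ℝ} (hm : 0 < m) :
    ∃ M : ℕ, 2 ≤ M ∧ ∀ {E : Type} [NormedAddCommGroup E] [NormedSpace ℝ E] [CompleteSpace E]
      {W : Type} [NormedAddCommGroup W] [InnerProductSpace ℝ W] {X Z : E → E}
      (_ : BddDeriv X) (_ : BddDeriv Z)
      (_ : ∀ j, 1 ≤ j → j ≤ k + 2 → ∀ x, ‖iteratedFDeriv ℝ j X x‖ ≤ smallSize (k + 1))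
      (_ : ∀ j, 1 ≤ j → j ≤ k + 2 → ∀ x, ‖iteratedFDeriv ℝ j Z x‖ ≤ smallSize (k + 1))
      (ℓ : E →L[ℝ] W) (_ : ∀ w, inner ℝ (ℓ w) (ℓ (X w)) ≤ -m * ‖ℓ w‖ ^ 2) {C : ℝ}
      (_ : ∀ w, ‖X w - Z w‖ ≤ C) (_ : ∀ w, ‖X w - Z w‖ ≤ C * ‖ℓ w‖ ^ M),
      ∃ G : E → E, ContDiff ℝ k G ∧ (∀ x, fderiv ℝ G x (X x) = Z (G x)) ∧
        (∃ C', ∀ x, ‖ℓ x‖ ≤ 1 → ‖G x - x‖ ≤ C' * ‖ℓ x‖ ^ 2) ∧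
        ∀ {V : Type} [NormedAddCommGroup V] [NormedSpace ℝ V] (π : E →L[ℝ] V) (B : V →L[ℝ] V),
          (∀ w, π (X w) = B (π w)) → (∀ w, π (Z w) = B (π w)) → ∀ x, π (G x) = π x := by
  obtain ⟨m', hm'2, hm'⟩ := exists_order k hm
  refine ⟨2 ^ k * m', hm'2.trans (Nat.le_mul_of_pos_left _ (by positivity)), ?_⟩
  intro E _ _ _ W _ _ X Z hX hZ hXs hZs ℓ hℓ C hC hCM
  obtain ⟨f, hf, hfB, hfX, hfg⟩ := exists_time_one_map hX (k := k + 1) (by omega) hXs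
  have hnZ : BddDeriv fun x => -Z x := ⟨hZ.1.neg, fun j hj => by
    obtain ⟨C, hC⟩ := hZ.2 j hj
    exact ⟨C, fun x => by rw [norm_iteratedFDeriv_neg_field]; exact hC x⟩⟩
  obtain ⟨κ, hκ, hκB, hκZ, hκg⟩ := exists_time_one_map hnZ (k := k + 1) (by omega)
    (fun j h1 hj x => by rw [norm_iteratedFDeriv_neg_field]; exact hZs j h1 hj x)
  have hB : ∀ {h : E → E}, (∀ j, 1 ≤ j → j ≤ k + 1 → ∀ x, ‖iteratedFDeriv ℝ j h x‖ ≤ 2 ^ j) →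
      ∀ j, 1 ≤ j → j ≤ k + 1 → ∀ x, ‖iteratedFDeriv ℝ j h x‖ ≤ 2 ^ (k + 1) :=
    fun h j h1 hj x => (h j h1 hj x).trans (pow_le_pow_right₀ one_le_two hj)
  set Λ : ℝ := ((k + 1).factorial : ℝ) * 2 ^ (k + 1) with hΛ
  have hΛ1 : 1 ≤ Λ := by
    have h1 : (1 : ℝ) ≤ (k + 1).factorial := by
      exact_mod_cast Nat.succ_le_of_lt (Nat.factorial_pos (k + 1))
    have h2 : (1 : ℝ) ≤ 2 ^ (k + 1) := one_le_pow₀ one_le_two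
    nlinarith
  have hZ1 : ∀ x, ‖fderiv ℝ Z x‖ ≤ 1 := fun x => by
    rw [norm_fderiv_eq_norm_iteratedFDeriv_one]
    exact (hZs 1 le_rfl (by omega) x).trans ((smallSize_le_half _).trans (by norm_num))
  have hfℓ : ∀ x, ‖ℓ (f x)‖ ≤ Real.exp (-m) * ‖ℓ x‖ := by
    intro x
    obtain ⟨g, h0, h1, hg⟩ := hfg x
    have := norm_le_exp_mul_of_contracting ℓ hℓ hg (t := 1) (by simp)
    rwa [h0, h1, mul_one] at this
  have hC0 : 0 ≤ C := (norm_nonneg _).trans (hC 0)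
  -- The trajectory of `X` never leaves the region `‖ℓ w‖ ≤ ‖ℓ x‖`, by contraction, so the closeness
  -- of the two fields is needed only there.
  have htrip : ∀ x e, (∀ w, ‖ℓ w‖ ≤ ‖ℓ x‖ → ‖X w - Z w‖ ≤ e) → ‖κ (f x) - x‖ ≤ 2 * e := by
    intro x e he
    obtain ⟨g, h0, h1, hg⟩ := hfg x
    obtain ⟨b, hb0, hb1, hb⟩ := hκg (f x)
    have := norm_round_trip_le hZ.differentiable hZ1 hg hb (hb0.trans h1.symm) (e := e)
      (fun t ht => he _ (by
        refine (norm_le_exp_mul_of_contracting ℓ hℓ hg ht).trans ?_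
        rw [h0]
        refine mul_le_of_le_one_left (norm_nonneg _) (Real.exp_le_one_iff.2 ?_)
        nlinarith [ht.1]))
    rwa [hb1, h0] at this
  have hδ : ContDiff ℝ (k + 1 : ℕ) fun x => κ (f x) - x := (hκ.comp hf).sub contDiff_id
  have hδb : ∃ C₁, ∀ j ≤ k + 1, ∀ w, ‖iteratedFDeriv ℝ j (fun x => κ (f x) - x) w‖ ≤ C₁ := by
    refine ⟨max (2 * C) ((k + 1).factorial * 2 ^ (k + 1) * 2 ^ (k + 1) + 1), fun j hj w => ?_⟩
    rcases Nat.eq_zero_or_pos j with rfl | hj0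
    · rw [norm_iteratedFDeriv_zero]
      exact (htrip w C fun w _ => hC w).trans (le_max_left _ _)
    · have hjk : ((j : ℕ) : ℕ∞ω) ≤ ((k + 1 : ℕ) : ℕ∞ω) := by exact_mod_cast hj
      refine le_trans ?_ (le_max_right _ _)
      have e1 : iteratedFDeriv ℝ j (fun x => κ (f x) - x) w =
          iteratedFDeriv ℝ j (fun x => κ (f x)) w - iteratedFDeriv ℝ j (fun x => x) w :=
        congrFun (iteratedFDeriv_sub ((hκ.comp hf).of_le hjk) contDiff_id) w
      rw [e1]
      refine (norm_sub_le _ _).trans (add_le_add ?_ ?_)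
      · refine (norm_iteratedFDeriv_comp_le_of_one_le hj0 (hκ.of_le hjk) (hf.of_le hjk) w
          (C := 2 ^ (k + 1)) (by positivity) (fun i h1 hi => hB hκB i h1 (by omega) _)
          (fun i h1 hi => hfB i h1 (by omega) w)).trans ?_
        have h2 : (j.factorial : ℝ) ≤ (k + 1).factorial := by exact_mod_cast Nat.factorial_le hj
        have h3 : (2 : ℝ) ^ j ≤ 2 ^ (k + 1) := pow_le_pow_right₀ one_le_two hj
        gcongr
      · exact (norm_iteratedFDeriv_clm_le (ContinuousLinearMap.id ℝ E) hj0 w).trans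
          ContinuousLinearMap.norm_id_le
  obtain ⟨C₁, hC₁⟩ := hδb
  obtain ⟨C₂, hC₂0, hC₂⟩ := exists_norm_iteratedFDeriv_le_of_flat k hδ ℓ (m := m') (by omega)
    (C := max C₁ (2 * C)) (fun j hj w => (hC₁ j hj w).trans (le_max_left _ _)) (fun w => by
      refine (htrip w (C * ‖ℓ w‖ ^ (2 ^ k * m')) fun w' hw' => (hCM w').trans
        (by gcongr)).trans ?_
      rw [← mul_assoc]
      gcongr
      exact le_max_right _ _)
  obtain ⟨G, hG, hlim, C', hC'⟩ := exists_limit_conjugation (by positivity) hΛ.ge hΛ1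
    (Real.exp_pos _).le hm' hf hκ (hB hfB) (hB hκB) ℓ hfℓ hC₂0 hC₂
  have ht : ∀ x, Tendsto (fun n => κ^[n] (f^[n] x)) atTop (𝓝 (G x)) := fun x => by
    have := hlim 0 (by omega) x
    simp only [iteratedFDeriv_zero_eq_comp] at this
    simpa [Function.comp_def] using
      ((continuousMultilinearCurryFin0 ℝ E E).continuous.tendsto _).comp this
  have hfd : Differentiable ℝ f := hf.differentiable (by simp)
  have hκd : Differentiable ℝ κ := hκ.differentiable (by simp)
  refine ⟨G, hG, fun x => ?_, ⟨max C' 0, fun x hx => ?_⟩, ?_⟩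
  · have ht1 : Tendsto (fun n => fderiv ℝ (fun z => κ^[n] (f^[n] z)) x) atTop
        (𝓝 (fderiv ℝ G x)) := by
      have := hlim 1 hk x
      simp only [iteratedFDeriv_succ_eq_comp_right, iteratedFDeriv_zero_eq_comp,
        Function.comp_apply] at this
      simpa [Function.comp_def] using
        (((continuousMultilinearCurryFin0 ℝ E (E →L[ℝ] E)).continuous.comp
          (continuousMultilinearCurryRightEquiv' ℝ 0 E E).continuous).tendsto _).comp this
    have ht2 : Tendsto (fun n => fderiv ℝ (fun z => κ^[n] (f^[n] z)) x (X x)) atTop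
        (𝓝 (fderiv ℝ G x (X x))) :=
      ((ContinuousLinearMap.apply ℝ E (X x)).continuous.tendsto _).comp ht1
    -- The iterates of `f` carry `X` to `X`, those of `κ` carry `Z` to `Z`. The mismatch `X - Z` at
    -- `f^n x` is enlarged by at most `Λ ^ n`, while its own decay is faster. The limit is thus a
    -- conjugation of the vector fields and not merely of their time-one maps.
    have e1 : ∀ n, fderiv ℝ (fun z => κ^[n] (f^[n] z)) x (X x) = Z (κ^[n] (f^[n] x)) +
        fderiv ℝ κ^[n] (f^[n] x) (X (f^[n] x) - Z (f^[n] x)) := by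
      intro n
      have h1 : fderiv ℝ (fun z => κ^[n] (f^[n] z)) x =
          (fderiv ℝ κ^[n] (f^[n] x)).comp (fderiv ℝ f^[n] x) :=
        fderiv_comp (g := κ^[n]) (f := f^[n]) x (hκd.iterate n _) (hfd.iterate n x)
      have h2 := fderiv_iterate_apply_field hκd hκZ n (f^[n] x)
      simp only [map_neg, neg_inj] at h2
      rw [h1, ContinuousLinearMap.comp_apply, fderiv_iterate_apply_field hfd hfX, map_sub, h2]
      abel
    have ht3 : Tendsto (fun n => fderiv ℝ κ^[n] (f^[n] x) (X (f^[n] x) - Z (f^[n] x))) atTop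
        (𝓝 0) := by
      refine squeeze_zero_norm (a := fun n => C * ‖ℓ x‖ ^ (2 ^ k * m') * (1 / 2) ^ n)
        (fun n => ?_) (by
        simpa using (tendsto_pow_atTop_nhds_zero_of_lt_one (by norm_num)
          (by norm_num : (1 / 2 : ℝ) < 1)).const_mul (C * ‖ℓ x‖ ^ (2 ^ k * m')))
      have hκn := norm_iteratedFDeriv_iterate_le hκ (B := 2 ^ (k + 1)) (by positivity) hΛ.ge hΛ1
        (hB hκB) n 1 le_rfl (by omega) (f^[n] x)
      rw [← norm_fderiv_eq_norm_iteratedFDeriv_one, pow_one] at hκn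
      have hℓn : ∀ n, ‖ℓ (f^[n] x)‖ ≤ Real.exp (-m) ^ n * ‖ℓ x‖ := by
        intro n
        induction n with
        | zero => simp
        | succ n ih =>
          rw [Function.iterate_succ']
          refine (hfℓ _).trans ?_
          rw [pow_succ', mul_assoc]
          gcongr
      have h3 : ‖X (f^[n] x) - Z (f^[n] x)‖ ≤
          C * (Real.exp (-m) ^ n * ‖ℓ x‖) ^ (2 ^ k * m') := (hCM _).trans (by
        gcongr; exact hℓn n)
      have hexp1 : Real.exp (-m) ≤ 1 := Real.exp_le_one_iff.2 (by linarith)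
      have h4 : Real.exp (-m) ^ (2 ^ k * m') ≤ Real.exp (-m) ^ m' :=
        pow_le_pow_of_le_one (Real.exp_pos _).le hexp1 (Nat.le_mul_of_pos_left _ (by positivity))
      have h5 : Λ ≤ Λ ^ (3 * k + 1) := le_self_pow₀ hΛ1 (by omega)
      calc _ ≤ _ := ContinuousLinearMap.le_opNorm _ _
        _ ≤ Λ ^ n * (C * (Real.exp (-m) ^ n * ‖ℓ x‖) ^ (2 ^ k * m')) := by gcongr
        _ = C * ‖ℓ x‖ ^ (2 ^ k * m') * (Λ * Real.exp (-m) ^ (2 ^ k * m')) ^ n := by ring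
        _ ≤ C * ‖ℓ x‖ ^ (2 ^ k * m') * (Λ ^ (3 * k + 1) * Real.exp (-m) ^ m') ^ n := by gcongr
        _ ≤ _ := by gcongr
    refine tendsto_nhds_unique ht2 ?_
    simp only [e1]
    simpa using ((hZ.continuous.tendsto _).comp (ht x)).add ht3
  · refine (hC' x).trans ?_
    calc C' * ‖ℓ x‖ ^ m' ≤ max C' 0 * ‖ℓ x‖ ^ m' := by gcongr; exact le_max_left _ _
      _ ≤ _ := by
        exact mul_le_mul_of_nonneg_left (pow_le_pow_of_le_one (norm_nonneg _) hx hm'2)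
          (le_max_right _ _)
  · intro V _ _ π B hπX hπZ x
    have hcurve : ∀ {v : E → E} {g : ℝ → E} {B : V →L[ℝ] V}, (∀ w, π (v w) = B (π w)) →
        (∀ t ∈ Icc (0 : ℝ) 1, HasDerivAt g (v (g t)) t) →
        ∀ t ∈ Icc (0 : ℝ) 1, HasDerivAt (fun t => π (g t)) (B (π (g t))) t :=
      fun hv hg t ht => hv _ ▸ π.hasFDerivAt.comp_hasDerivAt t (hg t ht)
    have hnB : ∀ w, π (-Z w) = (-B) (π w) := fun w => by
      rw [map_neg, hπZ, neg_apply]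
    -- Under `π` the trajectories become solutions of the linear equation of `B`, forwards for `f`
    -- and backwards for `κ`, so uniqueness makes the round trip trivial after projection.
    have p1 : ∀ x y, π x = π y → π (κ x) = π (κ y) := by
      intro x y hxy
      obtain ⟨g, h0, h1, hg⟩ := hκg x
      obtain ⟨b, hb0, hb1, hb⟩ := hκg y
      rw [← h1, ← hb1]
      exact eq_of_linear_ode (-B) (hcurve hnB hg) (hcurve hnB hb) (by rw [h0, hb0, hxy])
    have p2 : ∀ x, π (κ (f x)) = π x := by
      intro x
      obtain ⟨g, h0, h1, hg⟩ := hfg x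
      obtain ⟨b, hb0, hb1, hb⟩ := hκg (f x)
      rw [← hb1, ← h0]
      have hrev : ∀ t ∈ Icc (0 : ℝ) 1, HasDerivAt (fun t => π (g (1 - t)))
          ((-B) (π (g (1 - t)))) t := by
        intro t ht
        have := (hcurve hπX hg (1 - t) ⟨by linarith [ht.2], by linarith [ht.1]⟩).scomp t
          ((hasDerivAt_id t).const_sub 1)
        simpa [Function.comp_def] using this
      have := eq_of_linear_ode (-B) (hcurve hnB hb) hrev (by simp [hb0, h1])
      simpa using this
    have p3 : ∀ n x y, π x = π y → π (κ^[n] x) = π (κ^[n] y) := by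
      intro n
      induction n with
      | zero => intro x y h; simpa using h
      | succ n ih =>
        intro x y h
        simp only [Function.iterate_succ_apply]
        exact ih _ _ (p1 x y h)
    have p4 : ∀ n, π (κ^[n] (f^[n] x)) = π x := by
      intro n
      induction n with
      | zero => simp
      | succ n ih =>
        rw [Function.iterate_succ_apply, Function.iterate_succ_apply' f]
        rw [p3 n _ (f^[n] x) (p2 _), ih]
    refine tendsto_nhds_unique ((π.continuous.tendsto _).comp (ht x)) ?_
    simp only [Function.comp_def, p4]
    exact tendsto_const_nhds

/-- Conjugation of two vector fields which are close to each other along the subspace `ℓ = 0`,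
towards which the first one contracts. -/
theorem exists_conjugation {k : ℕ} (hk : 1 ≤ k) {m c : ℝ} (hm : 0 < m) (hc : 0 < c) :
    ∃ M : ℕ, 2 ≤ M ∧ ∀ {E : Type} [NormedAddCommGroup E] [NormedSpace ℝ E] [CompleteSpace E]
      {W : Type} [NormedAddCommGroup W] [InnerProductSpace ℝ W] {X Z : E → E}
      (_ : BddDeriv X) (_ : BddDeriv Z)
      (_ : ∀ j, 1 ≤ j → j ≤ k + 2 → ∀ x, ‖iteratedFDeriv ℝ j X x‖ ≤ c)
      (_ : ∀ j, 1 ≤ j → j ≤ k + 2 → ∀ x, ‖iteratedFDeriv ℝ j Z x‖ ≤ c)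
      (ℓ : E →L[ℝ] W) (_ : ∀ w, inner ℝ (ℓ w) (ℓ (X w)) ≤ -m * ‖ℓ w‖ ^ 2) {C : ℝ}
      (_ : ∀ w, ‖X w - Z w‖ ≤ C) (_ : ∀ w, ‖X w - Z w‖ ≤ C * ‖ℓ w‖ ^ M),
      ∃ G : E → E, ContDiff ℝ k G ∧ (∀ x, fderiv ℝ G x (X x) = Z (G x)) ∧
        (∃ C', ∀ x, ‖ℓ x‖ ≤ 1 → ‖G x - x‖ ≤ C' * ‖ℓ x‖ ^ 2) ∧
        ∀ {V : Type} [NormedAddCommGroup V] [NormedSpace ℝ V] (π : E →L[ℝ] V) (B : V →L[ℝ] V),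
          (∀ w, π (X w) = B (π w)) → (∀ w, π (Z w) = B (π w)) → ∀ x, π (G x) = π x := by
  -- A conjugation of `τ X` to `τ Z` also conjugates `X` to `Z`. Slowing time by `τ` makes the
  -- derivatives small and only changes the contraction rate to `τ * m`.
  set τ := smallSize (k + 1) / c with hτ
  have hτ0 : 0 < τ := div_pos (smallSize_pos _) hc
  obtain ⟨M, hM2, hM⟩ := exists_conjugation_of_small hk (m := τ * m) (by positivity)
  refine ⟨M, hM2, fun {E} _ _ _ {W} _ _ {X} {Z} hX hZ hXc hZc ℓ hℓ {C} hC hCM => ?_⟩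
  have hsc : ∀ {V : E → E}, BddDeriv V → ∀ j : ℕ, ∀ x,
      ‖iteratedFDeriv ℝ j (fun x => τ • V x) x‖ = τ * ‖iteratedFDeriv ℝ j V x‖ := by
    intro V hV j x
    have : iteratedFDeriv ℝ j (fun x => τ • V x) x = τ • iteratedFDeriv ℝ j V x :=
      iteratedFDeriv_const_smul_apply ((hV.contDiff_nat j).contDiffAt)
    rw [this, norm_smul, Real.norm_of_nonneg hτ0.le]
  have hbd : ∀ {V : E → E}, BddDeriv V → BddDeriv fun x => τ • V x := fun {V} hV =>
    ⟨hV.1.const_smul τ, fun j hj => by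
      obtain ⟨C, hC⟩ := hV.2 j hj
      exact ⟨τ * C, fun x => by rw [hsc hV]; gcongr; exact hC x⟩⟩
  have hτc : τ * c = smallSize (k + 1) := div_mul_cancel₀ _ hc.ne'
  obtain ⟨G, hG, hGX, hGC, hGπ⟩ := hM (hbd hX) (hbd hZ)
    (fun j h1 hj x => by rw [hsc hX, ← hτc]; gcongr; exact hXc j h1 hj x)
    (fun j h1 hj x => by rw [hsc hZ, ← hτc]; gcongr; exact hZc j h1 hj x) ℓ
    (fun w => by
      rw [map_smul, real_inner_smul_right]
      have := hℓ w
      nlinarith) (C := τ * C)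
    (fun w => by
      rw [← smul_sub, norm_smul, Real.norm_of_nonneg hτ0.le]; gcongr; exact hC w)
    (fun w => by
      rw [← smul_sub, norm_smul, Real.norm_of_nonneg hτ0.le, mul_assoc]; gcongr; exact hCM w)
  refine ⟨G, hG, fun x => ?_, hGC, fun π B hX hZ => hGπ π (τ • B) (fun w => ?_) (fun w => ?_)⟩
  · have := hGX x
    rw [map_smul] at this
    exact smul_right_injective E hτ0.ne' this
  · rw [map_smul, hX]; rfl
  · rw [map_smul, hZ]; rfl

end Conjugation

/-! ### Taylor expansion along lines. -/

section Taylor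

/-- The Taylor formula at the origin, with a bound of the remainder which is uniform in sign. -/
theorem abs_sub_taylor_le (n : ℕ) : ∀ {g : ℝ → ℝ} (_ : ContDiff ℝ ∞ g) {C : ℝ}
    (_ : ∀ t, |iteratedDeriv n g t| ≤ C) (t : ℝ),
    |g t - ∑ j ∈ Finset.range n, t ^ j / j.factorial * iteratedDeriv j g 0| ≤ C * |t| ^ n := by
  induction n with
  | zero =>
    intro g hg C hC t
    simpa using hC t
  | succ n ih =>
    intro g hg C hC t
    have hC0 : 0 ≤ C := (abs_nonneg _).trans (hC 0)
    have hg' : ContDiff ℝ ∞ (deriv g) := (contDiff_infty_iff_deriv.1 hg).2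
    have hgd : Differentiable ℝ g := (contDiff_infty_iff_deriv.1 hg).1
    have hih := ih hg' (C := C) (fun t => by rw [← iteratedDeriv_succ']; exact hC t)
    set h : ℝ → ℝ := fun t => g t - ∑ j ∈ Finset.range (n + 1),
      t ^ j / j.factorial * iteratedDeriv j g 0 with hh
    have hder : ∀ s, HasDerivAt h (deriv g s - ∑ j ∈ Finset.range n,
        s ^ j / j.factorial * iteratedDeriv j (deriv g) 0) s := by
      intro s
      refine (hgd s).hasDerivAt.sub ?_
      simp_rw [← iteratedDeriv_succ']
      have e1 : HasDerivAt (fun t : ℝ => ∑ j ∈ Finset.range n,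
          t ^ (j + 1) / (j + 1).factorial * iteratedDeriv (j + 1) g 0)
          (∑ j ∈ Finset.range n, s ^ j / j.factorial * iteratedDeriv (j + 1) g 0) s := by
        refine HasDerivAt.fun_sum fun j _ => ?_
        refine HasDerivAt.mul_const ?_ _
        have := (hasDerivAt_pow (j + 1) s).div_const ((j + 1).factorial : ℝ)
        convert this using 1
        have h1 : ((j + 1).factorial : ℝ) = (j + 1) * j.factorial := by
          exact_mod_cast Nat.factorial_succ j
        have h2 : (j.factorial : ℝ) ≠ 0 := by exact_mod_cast Nat.factorial_ne_zero j
        rw [h1]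
        push_cast
        field_simp
      simp_rw [Finset.sum_range_succ', pow_zero]
      exact e1.add_const _
    have h0 : h 0 = 0 := by
      simp [hh, Finset.sum_range_succ']
    have hb := (convex_closedBall (0 : ℝ) |t|).norm_image_sub_le_of_norm_hasDerivWithin_le
      (f := h) (C := C * |t| ^ n) (fun s _ => (hder s).hasDerivWithinAt) (fun s hs => by
        refine (hih s).trans ?_
        have : |s| ≤ |t| := by simpa using hs
        gcongr) (x := 0) (y := t) (by simp) (by simp)
    rw [h0, sub_zero, sub_zero, Real.norm_eq_abs, Real.norm_eq_abs] at hb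
    calc _ ≤ _ := hb
      _ = _ := by ring

/-- If the derivatives of order below `j` vanish, Taylor's formula shows that `t ^ j / j !` times
the next one is `O(t ^ (j + 1))`; division by `t ^ j` and `t → 0` give the claim. -/
theorem iteratedDeriv_zero_eq_zero_of_flat {g : ℝ → ℝ} (hg : ContDiff ℝ ∞ g) {N : ℕ} {C : ℝ}
    (hb : ∀ j ≤ N, ∃ C', ∀ t, |iteratedDeriv j g t| ≤ C') (h : ∀ t, |g t| ≤ C * |t| ^ N) :
    ∀ j < N, iteratedDeriv j g 0 = 0 := by
  intro j
  induction j using Nat.strong_induction_on with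
  | _ j ih =>
    intro hj
    obtain ⟨C', hC'⟩ := hb (j + 1) hj
    have hC0 : 0 ≤ C' := (abs_nonneg _).trans (hC' 0)
    have hT := abs_sub_taylor_le (j + 1) hg hC'
    have hC1 : 0 ≤ |C| := abs_nonneg C
    have hz : ∀ t : ℝ, ∑ i ∈ Finset.range (j + 1), t ^ i / i.factorial * iteratedDeriv i g 0 =
        t ^ j / j.factorial * iteratedDeriv j g 0 := fun t => by
      rw [Finset.sum_range_succ, Finset.sum_eq_zero, zero_add]
      intro i hi
      have hi := Finset.mem_range.1 hi
      rw [ih i hi (by omega), mul_zero]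
    have key : ∀ t : ℝ, 0 < t → t < 1 →
        |iteratedDeriv j g 0| ≤ j.factorial * (C' + |C|) * t := by
      intro t ht0 ht1
      have h1 := hT t
      rw [hz, abs_of_pos ht0] at h1
      have h2 := h t
      rw [abs_of_pos ht0] at h2
      have h3 : t ^ N ≤ t ^ (j + 1) := pow_le_pow_of_le_one ht0.le ht1.le hj
      have h4 : |t ^ j / j.factorial * iteratedDeriv j g 0| ≤ (C' + |C|) * t ^ (j + 1) := by
        have e : t ^ j / j.factorial * iteratedDeriv j g 0 =
          g t - (g t - t ^ j / j.factorial * iteratedDeriv j g 0) := by ring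
        rw [e]
        refine (abs_sub _ _).trans ?_
        have h5 : |g t| ≤ |C| * t ^ (j + 1) := h2.trans (by
          calc C * t ^ N ≤ |C| * t ^ N := by gcongr; exact le_abs_self C
            _ ≤ _ := by gcongr)
        linarith
      have hf : (0 : ℝ) < j.factorial := by exact_mod_cast j.factorial_pos
      rw [abs_mul, abs_of_pos (by positivity : 0 < t ^ j / (j.factorial : ℝ)),
        div_mul_eq_mul_div, div_le_iff₀ hf] at h4
      have ht : 0 < t ^ j := by positivity
      refine le_of_mul_le_mul_left ?_ ht
      calc _ ≤ _ := h4
        _ = _ := by ring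
    have hlim : Tendsto (fun t : ℝ => j.factorial * (C' + |C|) * t) (𝓝[>] 0)
        (𝓝 (j.factorial * (C' + |C|) * 0)) :=
      (Continuous.tendsto (by fun_prop) _).mono_left nhdsWithin_le_nhds
    rw [mul_zero] at hlim
    have := ge_of_tendsto hlim (by
      filter_upwards [Ioo_mem_nhdsGT one_pos] with t ht
      exact key t ht.1 ht.2)
    exact abs_nonpos_iff.1 this

variable {E : Type} [NormedAddCommGroup E] [NormedSpace ℝ E]

theorem iteratedDeriv_line {f : E → ℝ} (hf : ContDiff ℝ ∞ f) (z e : E) (j : ℕ) (t : ℝ) :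
    iteratedDeriv j (fun t : ℝ => f (z + t • e)) t =
      iteratedFDeriv ℝ j f (z + t • e) fun _ => e := by
  induction j generalizing t with
  | zero => simp
  | succ j ih =>
    have hd : Differentiable ℝ (iteratedFDeriv ℝ j f) :=
      (hf.iteratedFDeriv_right (m := 1) (by norm_cast; exact le_top)).differentiable (by simp)
    have h1 : HasDerivAt (fun t : ℝ => z + t • e) e t := by
      simpa using ((hasDerivAt_id t).smul_const e).const_add z
    have h2 : HasDerivAt (fun t : ℝ => iteratedFDeriv ℝ j f (z + t • e) fun _ => e)
        (fderiv ℝ (iteratedFDeriv ℝ j f) (z + t • e) e fun _ => e) t :=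
      (ContinuousMultilinearMap.apply ℝ (fun _ : Fin j => E) ℝ fun _ => e).hasFDerivAt.comp_hasDerivAt
        t ((hd _).hasFDerivAt.comp_hasDerivAt t h1)
    rw [iteratedDeriv_succ, funext ih, h2.deriv, iteratedFDeriv_succ_apply_left]
    rfl

end Taylor

/-! ### Cutoff functions and rescaling at the origin. -/

section Cutoff

variable {E F : Type} [NormedAddCommGroup E] [NormedSpace ℝ E]
  [NormedAddCommGroup F] [NormedSpace ℝ F]

/-- Smoothness on a neighbourhood of the origin. -/
def SmoothNear (f : E → F) : Prop := ∀ᶠ z in 𝓝 (0 : E), ContDiffAt ℝ ∞ f z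

theorem ContDiff.smoothNear {f : E → F} (hf : ContDiff ℝ ∞ f) : SmoothNear f :=
  Eventually.of_forall fun _ => hf.contDiffAt

theorem exists_cutoff [FiniteDimensional ℝ E] {p : E → Prop} (hp : ∀ᶠ z in 𝓝 (0 : E), p z) :
    ∃ χ : E → ℝ, ContDiff ℝ ∞ χ ∧ HasCompactSupport χ ∧ (∀ᶠ z in 𝓝 0, χ z = 1) ∧
      (∀ z, 0 ≤ χ z ∧ χ z ≤ 1) ∧ ∀ z ∈ tsupport χ, p z := by
  obtain ⟨r, hr, h⟩ := Metric.eventually_nhds_iff_ball.1 hp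
  let b : ContDiffBump (0 : E) := ⟨r / 4, r / 2, by positivity, by linarith⟩
  refine ⟨b, b.contDiff, b.hasCompactSupport, b.eventuallyEq_one, fun z => ⟨b.nonneg, b.le_one⟩,
    fun z hz => h z ?_⟩
  rw [b.tsupport_eq] at hz
  exact Metric.closedBall_subset_ball (by change r / 2 < r; linarith) hz

theorem contDiff_cutoff_mul {χ f : E → ℝ} (hχ : ContDiff ℝ ∞ χ)
    (hf : ∀ z ∈ tsupport χ, ContDiffAt ℝ ∞ f z) : ContDiff ℝ ∞ fun z => χ z * f z := by
  refine contDiff_iff_contDiffAt.2 fun z => ?_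
  by_cases hz : z ∈ tsupport χ
  · exact hχ.contDiffAt.mul (hf z hz)
  · refine (contDiffAt_const (c := (0 : ℝ))).congr_of_eventuallyEq ?_
    filter_upwards [notMem_tsupport_iff_eventuallyEq.1 hz] with w hw
    simp [hw]

theorem exists_bound_of_hasCompactSupport {f : E → F} (hf : ContDiff ℝ ∞ f)
    (hs : HasCompactSupport f) (j : ℕ) : ∃ C, ∀ x, ‖iteratedFDeriv ℝ j f x‖ ≤ C :=
  (hf.continuous_iteratedFDeriv (by exact_mod_cast le_top)).bounded_above_of_compact_support
    (hs.iteratedFDeriv j)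

theorem exists_bound_of_hasCompactSupport_le {f : E → F} (hf : ContDiff ℝ ∞ f)
    (hs : HasCompactSupport f) (n : ℕ) :
    ∃ C, 0 ≤ C ∧ ∀ j ≤ n, ∀ x, ‖iteratedFDeriv ℝ j f x‖ ≤ C := by
  choose C hC using exists_bound_of_hasCompactSupport hf hs
  have hC0 : ∀ j, 0 ≤ C j := fun j => (norm_nonneg _).trans (hC j 0)
  refine ⟨∑ j ∈ Finset.range (n + 1), C j, Finset.sum_nonneg fun j _ => hC0 j, fun j hj x => ?_⟩
  exact (hC j x).trans (Finset.single_le_sum (fun i _ => hC0 i) (by simpa [Nat.lt_succ_iff]))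

/-- A function rescaled at the origin, and cut off. -/
def rescale (χ f : E → ℝ) (ρ : ℝ) (z : E) : ℝ := χ z * (ρ⁻¹ * f (ρ • z))

theorem contDiff_rescale {χ f : E → ℝ} (hχ : ContDiff ℝ ∞ χ) (hf : ContDiff ℝ ∞ f) (ρ : ℝ) :
    ContDiff ℝ ∞ (rescale χ f ρ) :=
  hχ.mul (contDiff_const.mul (hf.comp (contDiff_const_smul ρ)))

/-- As `f` vanishes to second order, `ρ⁻¹ f(ρ z)` is `O(ρ)` with its derivatives on the support of
`χ`: Taylor's formula handles order zero, the mean value inequality order one, and for orders `i ≥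
2` the chain rule already supplies `ρ ^ i`. -/
theorem rescale_small {χ f : E → ℝ} (hχ : ContDiff ℝ ∞ χ) (hχs : HasCompactSupport χ)
    (hf : ContDiff ℝ ∞ f) (hfs : HasCompactSupport f) (h0 : f 0 = 0) (h1 : fderiv ℝ f 0 = 0)
    (n : ℕ) {η : ℝ} (hη : 0 < η) :
    ∀ᶠ ρ in 𝓝[>] (0 : ℝ), ∀ j ≤ n, ∀ z, ‖iteratedFDeriv ℝ j (rescale χ f ρ) z‖ ≤ η := by
  obtain ⟨Cχ, hCχ0, hCχ⟩ := exists_bound_of_hasCompactSupport_le hχ hχs n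
  obtain ⟨C, hC0, hC⟩ := exists_bound_of_hasCompactSupport_le hf hfs (n + 2)
  obtain ⟨R, hR1, hR⟩ : ∃ R : ℝ, 1 ≤ R ∧ ∀ z ∈ tsupport χ, ‖z‖ ≤ R := by
    obtain ⟨R, hR⟩ := hχs.isBounded.exists_norm_le
    exact ⟨max 1 R, le_max_left _ _, fun z hz => (hR z hz).trans (le_max_right _ _)⟩
  set A := 2 ^ n * Cχ * (C * R ^ 2) with hA
  have hA0 : 0 ≤ A := by positivity
  have hev : ∀ᶠ ρ in 𝓝[>] (0 : ℝ), A * ρ < η := by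
    have : Tendsto (fun ρ : ℝ => A * ρ) (𝓝[>] 0) (𝓝 (A * 0)) :=
      (Continuous.tendsto (by fun_prop) _).mono_left nhdsWithin_le_nhds
    rw [mul_zero] at this
    exact this.eventually (gt_mem_nhds hη)
  filter_upwards [hev, Ioo_mem_nhdsGT one_pos] with ρ hρη hρ j hj z
  have hρ0 := hρ.1
  have hρ1 := hρ.2
  by_cases hz : z ∈ tsupport χ
  swap
  · have : z ∉ tsupport (iteratedFDeriv ℝ j (rescale χ f ρ)) := fun h => hz
      (closure_mono (fun w hw => left_ne_zero_of_mul hw)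
        (tsupport_iteratedFDeriv_subset (𝕜 := ℝ) j h))
    rw [image_eq_zero_of_notMem_tsupport this, norm_zero]
    exact hη.le
  have hzR := hR z hz
  have hsm : ContDiff ℝ ∞ fun z => ρ⁻¹ * f (ρ • z) :=
    contDiff_const.mul (hf.comp (contDiff_const_smul ρ))
  have hi : ∀ i ≤ n, ‖iteratedFDeriv ℝ i (fun z => ρ⁻¹ * f (ρ • z)) z‖ ≤ C * R ^ 2 * ρ := by
    intro i hi
    have hfi : ContDiff ℝ i f := hf.of_le (by exact_mod_cast le_top)
    have e1 : iteratedFDeriv ℝ i (fun z => ρ⁻¹ * f (ρ • z)) z =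
        ρ⁻¹ • iteratedFDeriv ℝ i (fun z => f (ρ • z)) z :=
      iteratedFDeriv_const_smul_apply (a := ρ⁻¹) (f := fun z => f (ρ • z))
        ((hfi.comp (contDiff_const_smul ρ)).contDiffAt)
    have e2 : ‖iteratedFDeriv ℝ i f (ρ • z)‖ * ρ ^ i ≤ C * R ^ 2 * ρ ^ 2 := by
      have hρz : ‖ρ • z‖ ≤ R * ρ := by
        rw [norm_smul, Real.norm_of_nonneg hρ0.le, mul_comm]
        gcongr
      rcases Nat.lt_or_ge i 2 with h2 | h2
      · interval_cases i
        · have := norm_taylor_one_le (contDiff_infty.1 hf 2) (hC 2 (by omega)) 0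
            (ρ • z)
          rw [zero_add, h0, h1, zero_apply, sub_zero, sub_zero] at this
          rw [norm_iteratedFDeriv_zero, pow_zero, mul_one]
          calc _ ≤ _ := this
            _ ≤ C * (R * ρ) ^ 2 := by gcongr
            _ = _ := by ring
        · have hd : Differentiable ℝ (fderiv ℝ f) :=
            (hf.fderiv_right (m := ∞) (by simp)).differentiable (by simp)
          have := norm_sub_le_of_norm_fderiv_le hd (C := C) (fun x => by
            rw [norm_fderiv_eq_norm_iteratedFDeriv_one, norm_iteratedFDeriv_fderiv]
            exact hC 2 (by omega) x) (ρ • z) 0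
          rw [h1, sub_zero, sub_zero] at this
          rw [← norm_fderiv_eq_norm_iteratedFDeriv_one, pow_one]
          calc _ ≤ C * ‖ρ • z‖ * ρ := by gcongr
            _ ≤ C * (R * ρ) * ρ := by gcongr
            _ = C * R ^ 1 * ρ ^ 2 := by ring
            _ ≤ _ := by gcongr
      · have h3 : ρ ^ i ≤ ρ ^ 2 := pow_le_pow_of_le_one hρ0.le hρ1.le h2
        have h4 : (1 : ℝ) ≤ R ^ 2 := one_le_pow₀ hR1
        calc _ ≤ C * ρ ^ 2 := by gcongr; exact hC i (by omega) _
          _ = C * 1 * ρ ^ 2 := by ring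
          _ ≤ _ := by gcongr
    rw [e1, norm_smul, iteratedFDeriv_comp_const_smul ρ hfi, norm_smul, norm_pow,
      Real.norm_of_nonneg hρ0.le, Real.norm_of_nonneg (inv_nonneg.2 hρ0.le), mul_comm (ρ ^ i)]
    calc _ ≤ ρ⁻¹ * (C * R ^ 2 * ρ ^ 2) := by gcongr
      _ = _ := by field_simp
  refine (norm_iteratedFDeriv_mul_le (N := ∞) hχ hsm z (by exact_mod_cast le_top)).trans ?_
  have h5 : ∀ i ∈ Finset.range (j + 1), (j.choose i : ℝ) * ‖iteratedFDeriv ℝ i χ z‖ *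
      ‖iteratedFDeriv ℝ (j - i) (fun z => ρ⁻¹ * f (ρ • z)) z‖ ≤
      (j.choose i : ℝ) * (Cχ * (C * R ^ 2 * ρ)) := by
    intro i hi'
    have : i ≤ j := by simpa [Nat.lt_succ_iff] using hi'
    rw [mul_assoc]
    gcongr
    · exact hCχ i (by omega) z
    · exact hi (j - i) (by omega)
  refine (Finset.sum_le_sum h5).trans ?_
  rw [← Finset.sum_mul, sum_choose_real]
  have h6 : (2 : ℝ) ^ j ≤ 2 ^ n := pow_le_pow_right₀ one_le_two hj
  calc _ ≤ 2 ^ n * (Cχ * (C * R ^ 2 * ρ)) := by gcongr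
    _ = A * ρ := by rw [hA]; ring
    _ ≤ η := hρη.le

theorem hasFDerivAt_zero_of_isBigO {f : E → F} (h : f =O[𝓝 0] fun z => ‖z‖ ^ 2) :
    HasFDerivAt f (0 : E →L[ℝ] F) 0 := by
  have h0 : f 0 = 0 := by
    obtain ⟨C, hC⟩ := h.bound
    simpa using hC.self_of_nhds
  rw [hasFDerivAt_iff_isLittleO_nhds_zero]
  simpa [h0] using h.trans_isLittleO (isLittleO_norm_pow_id one_lt_two)

end Cutoff

/-! ### Saddle fields with parameters as variables, and their local conjugation. -/

section Saddle

variable {A : Type} [NormedAddCommGroup A] [NormedSpace ℝ A]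

/-- The linear part of the extended vector field, in which the parameters are variables. -/
def saddleLin (A : Type) [NormedAddCommGroup A] [NormedSpace ℝ A] (σ₀ : ℝ) :
    A × Phase →L[ℝ] A × Phase :=
  LinearMap.mkContinuous
    { toFun := fun z => (0, (z.2.1, -z.2.2.1, -σ₀ * z.2.2.2))
      map_add' := fun z w => by ext <;> simp <;> ring
      map_smul' := fun c z => by ext <;> simp; ring } (1 + |σ₀|)
    (fun z => by
      have h1 : |z.2.1| ≤ ‖z‖ := (norm_fst_le z.2).trans (norm_snd_le z)
      have h2 : |z.2.2.1| ≤ ‖z‖ := ((norm_fst_le z.2.2).trans (norm_snd_le z.2)).trans (norm_snd_le z)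
      have h3 : |z.2.2.2| ≤ ‖z‖ := ((norm_snd_le z.2.2).trans (norm_snd_le z.2)).trans (norm_snd_le z)
      have h0 : 0 ≤ |σ₀| * ‖z‖ := by positivity
      have h4 := norm_nonneg z
      simp only [LinearMap.coe_mk, AddHom.coe_mk]
      refine norm_prod_le_iff.2 ⟨by simp; positivity, norm_prod_le_iff.2 ⟨?_, norm_prod_le_iff.2 ⟨?_, ?_⟩⟩⟩
      · rw [Real.norm_eq_abs]; linarith
      · rw [norm_neg, Real.norm_eq_abs]; linarith
      · simp only [Real.norm_eq_abs, abs_mul, abs_neg]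
        have : |σ₀| * |z.2.2.2| ≤ |σ₀| * ‖z‖ := by gcongr
        linarith)

@[simp] theorem saddleLin_apply (σ₀ : ℝ) (z : A × Phase) :
    saddleLin A σ₀ z = (0, (z.2.1, -z.2.2.1, -σ₀ * z.2.2.2)) := rfl

theorem norm_saddleLin_le (σ₀ : ℝ) : ‖saddleLin A σ₀‖ ≤ 1 + |σ₀| :=
  LinearMap.mkContinuous_norm_le _ (by positivity) _

/-- The embedding of the last coordinate axis. -/
def embedY (A : Type) [NormedAddCommGroup A] [NormedSpace ℝ A] : ℝ →L[ℝ] A × Phase :=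
  (ContinuousLinearMap.inr ℝ A Phase) ∘L (ContinuousLinearMap.inr ℝ ℝ (ℝ × ℝ)) ∘L
    (ContinuousLinearMap.inr ℝ ℝ ℝ)

@[simp] theorem embedY_apply (t : ℝ) : embedY A t = (0, (0, 0, t)) := rfl

theorem norm_embedY_le : ‖embedY A‖ ≤ 1 :=
  ContinuousLinearMap.opNorm_le_bound _ zero_le_one fun t => by simp [Prod.norm_def]

/-- The coordinates `(a, u, v)`. -/
def baseProj (A : Type) [NormedAddCommGroup A] [NormedSpace ℝ A] : A × Phase →L[ℝ] A × (ℝ × ℝ) :=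
  (ContinuousLinearMap.fst ℝ A Phase).prod
    (((ContinuousLinearMap.fst ℝ ℝ (ℝ × ℝ)) ∘L ContinuousLinearMap.snd ℝ A Phase).prod
      ((ContinuousLinearMap.fst ℝ ℝ ℝ) ∘L (ContinuousLinearMap.snd ℝ ℝ (ℝ × ℝ)) ∘L
        ContinuousLinearMap.snd ℝ A Phase))

@[simp] theorem baseProj_apply (z : A × Phase) : baseProj A z = (z.1, (z.2.1, z.2.2.1)) := rfl

/-- The vector field induced on the coordinates `(a, u, v)`. -/
def baseLin (A : Type) [NormedAddCommGroup A] [NormedSpace ℝ A] :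
    A × (ℝ × ℝ) →L[ℝ] A × (ℝ × ℝ) :=
  (0 : A × (ℝ × ℝ) →L[ℝ] A).prod
    (((ContinuousLinearMap.fst ℝ ℝ ℝ) ∘L ContinuousLinearMap.snd ℝ A (ℝ × ℝ)).prod
      (-((ContinuousLinearMap.snd ℝ ℝ ℝ) ∘L ContinuousLinearMap.snd ℝ A (ℝ × ℝ))))

@[simp] theorem baseLin_apply (z : A × (ℝ × ℝ)) : baseLin A z = (0, (z.2.1, -z.2.2)) := rfl

/-- The vector field `a' = 0`, `u' = u`, `v' = -v`, `y' = -σ₀ y + F(a, u, v, y)`. -/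
def saddleField (σ₀ : ℝ) (F : A × Phase → ℝ) (z : A × Phase) : A × Phase :=
  saddleLin A σ₀ z + embedY A (F z)

theorem saddleField_apply (σ₀ : ℝ) (F : A × Phase → ℝ) (z : A × Phase) :
    saddleField σ₀ F z = (0, (z.2.1, -z.2.2.1, -σ₀ * z.2.2.2 + F z)) := by
  simp [saddleField]

theorem baseProj_saddleField (σ₀ : ℝ) (F : A × Phase → ℝ) (z : A × Phase) :
    baseProj A (saddleField σ₀ F z) = baseLin A (baseProj A z) := by
  simp [saddleField_apply]

theorem saddleField_sub (σ₀ : ℝ) (F G : A × Phase → ℝ) (z : A × Phase) :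
    saddleField σ₀ F z - saddleField σ₀ G z = embedY A (F z - G z) := by
  simp [saddleField]

theorem bddDeriv_saddleField (σ₀ : ℝ) {F : A × Phase → ℝ} (hF : BddDeriv F) {s η c : ℝ} {n : ℕ}
    (hs : |s| = 1) (hη : ∀ j ≤ n, ∀ z, ‖iteratedFDeriv ℝ j F z‖ ≤ η) (hc : 1 + |σ₀| + η ≤ c) :
    BddDeriv (fun z => s • saddleField σ₀ F z) ∧
      ∀ j, 1 ≤ j → j ≤ n → ∀ z, ‖iteratedFDeriv ℝ j (fun z => s • saddleField σ₀ F z) z‖ ≤ c := by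
  have hcd : ContDiff ℝ ∞ (saddleField σ₀ F) :=
    (saddleLin A σ₀).contDiff.add ((embedY A).contDiff.comp hF.1)
  have key : ∀ j : ℕ, 1 ≤ j → ∀ z, ‖iteratedFDeriv ℝ j (fun z => s • saddleField σ₀ F z) z‖ ≤
      1 + |σ₀| + ‖iteratedFDeriv ℝ j F z‖ := by
    intro j hj z
    have hF' : ContDiff ℝ j F := hF.contDiff_nat j
    have e1 : iteratedFDeriv ℝ j (fun z => s • saddleField σ₀ F z) z =
        s • iteratedFDeriv ℝ j (saddleField σ₀ F) z :=
      iteratedFDeriv_const_smul_apply (a := s) (f := saddleField σ₀ F)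
        ((hcd.of_le (by exact_mod_cast le_top)).contDiffAt)
    have e2 : iteratedFDeriv ℝ j (saddleField σ₀ F) z = iteratedFDeriv ℝ j (saddleLin A σ₀) z +
        iteratedFDeriv ℝ j (fun z => embedY A (F z)) z :=
      congrFun (iteratedFDeriv_add (saddleLin A σ₀).contDiff
        ((embedY A).contDiff.comp hF')) z
    rw [e1, norm_smul, Real.norm_eq_abs, hs, one_mul, e2]
    refine (norm_add_le _ _).trans (add_le_add ((norm_iteratedFDeriv_clm_le _ hj z).trans
      (norm_saddleLin_le σ₀)) ?_)
    exact ((embedY A).norm_iteratedFDeriv_comp_left hF'.contDiffAt le_rfl).trans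
      (mul_le_of_le_one_left (norm_nonneg _) norm_embedY_le)
  refine ⟨⟨hcd.const_smul s, fun j hj => ?_⟩, fun j h1 hj z => ?_⟩
  · obtain ⟨C, hC⟩ := hF.2 j hj
    exact ⟨1 + |σ₀| + C, fun z => (key j hj z).trans (by gcongr; exact hC z)⟩
  · exact (key j h1 z).trans (le_trans (by gcongr; exact hη j hj z) hc)

/-- The map `Θ` conjugates `X` to `Y` near the origin. -/
def ConjNear (Θ X Y : A × Phase → A × Phase) : Prop :=
  ∀ᶠ z in 𝓝 (0 : A × Phase), fderiv ℝ Θ z (X z) = Y (Θ z)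

/-- The map `Θ` preserves the coordinates `(a, u, v)` near the origin. -/
def FiberedNear (Θ : A × Phase → A × Phase) : Prop :=
  ∀ᶠ z in 𝓝 (0 : A × Phase), baseProj A (Θ z) = baseProj A z

/-- Local conjugation of two saddle fields which differ by a term which is flat along `ℓ = 0`. -/
theorem exists_local_conjugation {k : ℕ} (hk : 1 ≤ k) {m : ℝ} (hm : 0 < m) (σ₀ : ℝ) :
    ∃ M : ℕ, 2 ≤ M ∧ ∀ {A : Type} [NormedAddCommGroup A] [NormedSpace ℝ A] [FiniteDimensional ℝ A]
      {W : Type} [NormedAddCommGroup W] [InnerProductSpace ℝ W] (ℓ : A × Phase →L[ℝ] W)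
      {s η : ℝ} (_ : |s| = 1) (_ : 0 < η) (S : Set (A × Phase))
      (_ : ∀ z ∈ S, ∀ r : ℝ, r • z ∈ S)
      (_ : ∀ F : A × Phase → ℝ, Differentiable ℝ F → (∀ z, ‖fderiv ℝ F z‖ ≤ η) →
        (∀ z ∈ S, F z = 0) → ∀ w, inner ℝ (ℓ w) (ℓ (s • saddleField σ₀ F w)) ≤ -m * ‖ℓ w‖ ^ 2)
      {F₁ F₂ : A × Phase → ℝ} (_ : SmoothNear F₁) (_ : SmoothNear F₂)
      (_ : F₁ 0 = 0) (_ : F₂ 0 = 0) (_ : fderiv ℝ F₁ 0 = 0) (_ : fderiv ℝ F₂ 0 = 0)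
      (_ : ∀ᶠ z in 𝓝 0, z ∈ S → F₁ z = 0)
      (_ : (fun z => F₁ z - F₂ z) =O[𝓝 0] fun z => ‖ℓ z‖ ^ M),
      ∃ Θ : A × Phase → A × Phase, ContDiff ℝ k Θ ∧ FiberedNear Θ ∧
        ((fun z => Θ z - z) =O[𝓝 0] fun z => ‖ℓ z‖ ^ 2) ∧
        ConjNear Θ (saddleField σ₀ F₁) (saddleField σ₀ F₂) := by
  obtain ⟨M, hM2, hM⟩ := exists_conjugation hk hm (c := 1 + |σ₀| + 1) (by positivity)
  refine ⟨M, hM2, fun {A} _ _ _ {W} _ _ ℓ {s η} hs hη S hS hcontr {F₁ F₂} hF₁ hF₂ h10 h20 h11 h21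
    h1S h12 => ?_⟩
  obtain ⟨C, hC0, hC⟩ := h12.exists_nonneg
  have hs2 : s * s = 1 := by rw [← abs_mul_abs_self, hs, one_mul]
  -- global versions of the two functions
  obtain ⟨χ₀, hχ₀, hχ₀s, hχ₀1, hχ₀01, hχ₀p⟩ := exists_cutoff ((hF₁.and hF₂).and (h1S.and hC.bound))
  set f₁ : A × Phase → ℝ := fun z => χ₀ z * F₁ z
  set f₂ : A × Phase → ℝ := fun z => χ₀ z * F₂ z
  have hf₁ : ContDiff ℝ ∞ f₁ := contDiff_cutoff_mul hχ₀ fun z hz => (hχ₀p z hz).1.1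
  have hf₂ : ContDiff ℝ ∞ f₂ := contDiff_cutoff_mul hχ₀ fun z hz => (hχ₀p z hz).1.2
  have hf₁s : HasCompactSupport f₁ := hχ₀s.mul_right
  have hf₂s : HasCompactSupport f₂ := hχ₀s.mul_right
  have hf₁e : f₁ =ᶠ[𝓝 0] F₁ := by filter_upwards [hχ₀1] with z hz; simp [f₁, hz]
  have hf₂e : f₂ =ᶠ[𝓝 0] F₂ := by filter_upwards [hχ₀1] with z hz; simp [f₂, hz]
  have hf₁S : ∀ z ∈ S, f₁ z = 0 := fun z hz => by
    by_cases h : z ∈ tsupport χ₀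
    · simp [f₁, (hχ₀p z h).2.1 hz]
    · simp [f₁, image_eq_zero_of_notMem_tsupport h]
  have hf₁₂ : ∀ z, |f₁ z - f₂ z| ≤ C * ‖ℓ z‖ ^ M := fun z => by
    by_cases h : z ∈ tsupport χ₀
    · have h1 := (hχ₀p z h).2.2
      rw [Real.norm_eq_abs, Real.norm_of_nonneg (by positivity)] at h1
      have h2 := hχ₀01 z
      simp only [f₁, f₂, ← mul_sub, abs_mul, abs_of_nonneg h2.1]
      exact (mul_le_of_le_one_left (abs_nonneg _) h2.2).trans h1
    · simp only [f₁, f₂, image_eq_zero_of_notMem_tsupport h, zero_mul, sub_zero, abs_zero]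
      positivity
  -- rescaling
  obtain ⟨χ, hχ, hχs, hχ1, hχ01, -⟩ := exists_cutoff (E := A × Phase)
    (p := fun _ => True) (Eventually.of_forall fun _ => trivial)
  -- The bound `η` secures the contraction hypothesis, the bound `1` keeps all derivatives below the
  -- constant `1 + |σ₀| + 1` from which `M` was chosen. Rescaling preserves vanishing on `S` because
  -- `S` is a cone.
  have hη' : 0 < min η 1 := lt_min hη one_pos
  obtain ⟨ρ, ⟨hρ₁, hρ₂⟩, hρ⟩ := ((rescale_small hχ hχs hf₁ hf₁s (by simp [f₁, h10])
    (hf₁e.fderiv_eq.trans h11) (k + 2) hη').and (rescale_small hχ hχs hf₂ hf₂s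
    (by simp [f₂, h20]) (hf₂e.fderiv_eq.trans h21) (k + 2) hη') |>.and
    (self_mem_nhdsWithin)).exists
  have hρ0 : 0 < ρ := hρ
  have hg₁ := contDiff_rescale hχ hf₁ ρ
  have hg₂ := contDiff_rescale hχ hf₂ ρ
  have hg₁s : HasCompactSupport (rescale χ f₁ ρ) := hχs.mul_right
  have hg₂s : HasCompactSupport (rescale χ f₂ ρ) := hχs.mul_right
  set g₁ := rescale χ f₁ ρ with hg₁def
  set g₂ := rescale χ f₂ ρ with hg₂def
  have hb₁ : BddDeriv g₁ := ⟨hg₁, fun j _ => exists_bound_of_hasCompactSupport hg₁ hg₁s j⟩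
  have hb₂ : BddDeriv g₂ := ⟨hg₂, fun j _ => exists_bound_of_hasCompactSupport hg₂ hg₂s j⟩
  have hc : 1 + |σ₀| + min η 1 ≤ 1 + |σ₀| + 1 := by gcongr; exact min_le_right _ _
  obtain ⟨hX, hXc⟩ := bddDeriv_saddleField σ₀ hb₁ hs hρ₁ hc
  obtain ⟨hZ, hZc⟩ := bddDeriv_saddleField σ₀ hb₂ hs hρ₂ hc
  have hcon := hcontr g₁ hb₁.differentiable (fun z => by
    rw [norm_fderiv_eq_norm_iteratedFDeriv_one]
    exact (hρ₁ 1 (by omega) z).trans (min_le_left _ _)) (fun z hz => by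
      simp [hg₁def, rescale, hf₁S _ (hS z hz ρ)])
  have hdiff : ∀ w, ‖s • saddleField σ₀ g₁ w - s • saddleField σ₀ g₂ w‖ ≤ |g₁ w - g₂ w| := by
    intro w
    rw [← smul_sub, norm_smul, Real.norm_eq_abs, hs, one_mul, saddleField_sub]
    exact ((embedY A).le_opNorm _).trans (mul_le_of_le_one_left (norm_nonneg _) norm_embedY_le)
  obtain ⟨C₁, hC₁⟩ := (hg₁.continuous.sub hg₂.continuous).bounded_above_of_compact_support
    (hg₁s.sub hg₂s)
  have hdiffM : ∀ w, |g₁ w - g₂ w| ≤ ρ⁻¹ * (C * ρ ^ M) * ‖ℓ w‖ ^ M := by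
    intro w
    have h2 := hχ01 w
    have e1 : g₁ w - g₂ w = χ w * (ρ⁻¹ * (f₁ (ρ • w) - f₂ (ρ • w))) := by
      simp only [hg₁def, hg₂def, rescale]; ring
    rw [e1, abs_mul, abs_mul, abs_of_nonneg h2.1, abs_of_pos (inv_pos.2 hρ0)]
    refine (mul_le_of_le_one_left (by positivity) h2.2).trans ?_
    have h3 := hf₁₂ (ρ • w)
    rw [map_smul, norm_smul, Real.norm_of_nonneg hρ0.le, mul_pow] at h3
    calc _ ≤ ρ⁻¹ * (C * (ρ ^ M * ‖ℓ w‖ ^ M)) := by gcongr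
      _ = _ := by ring
  obtain ⟨G, hG, hGX, ⟨C', hGC⟩, hGπ⟩ := hM hX hZ hXc hZc ℓ hcon
    (C := max C₁ (ρ⁻¹ * (C * ρ ^ M))) (fun w => (hdiff w).trans ((hC₁ w).trans (le_max_left _ _)))
    (fun w => (hdiff w).trans ((hdiffM w).trans (by gcongr; exact le_max_right _ _)))
  have hGbase := hGπ (baseProj A) (s • baseLin A)
    (fun w => by rw [map_smul, baseProj_saddleField]; rfl)
    (fun w => by rw [map_smul, baseProj_saddleField]; rfl)
  have hG0 : G 0 = 0 := by
    have := hGC 0 (by simp)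
    simpa using this
  have hGd : Differentiable ℝ G := hG.differentiable (by exact_mod_cast Nat.one_le_iff_ne_zero.1 hk)
  have hsc : Tendsto (fun z : A × Phase => ρ⁻¹ • z) (𝓝 0) (𝓝 0) := by
    have : Continuous fun z : A × Phase => ρ⁻¹ • z := continuous_const_smul _
    simpa using this.tendsto 0
  have hsc' : Tendsto (fun z : A × Phase => ρ • z) (𝓝 0) (𝓝 0) := by
    have : Continuous fun z : A × Phase => ρ • z := continuous_const_smul _
    simpa using this.tendsto 0
  have hGt : Tendsto G (𝓝 0) (𝓝 0) := by simpa [hG0] using hG.continuous.tendsto 0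
  have hfield : ∀ {f F g : A × Phase → ℝ}, f =ᶠ[𝓝 0] F → g = rescale χ f ρ →
      ∀ᶠ w in 𝓝 (0 : A × Phase), ρ • saddleField σ₀ g w = saddleField σ₀ F (ρ • w) := by
    intro f F g hfF hg
    filter_upwards [hχ1, hsc'.eventually hfF] with w h1 h2
    simp only [saddleField, smul_add, ← map_smul, hg, rescale, h1, h2, one_mul, smul_eq_mul,
      mul_inv_cancel_left₀ hρ0.ne']
  refine ⟨fun z => ρ • G (ρ⁻¹ • z), ?_, ?_, ?_, ?_⟩
  · exact (hG.comp (contDiff_const_smul _)).const_smul ρ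
  · refine Eventually.of_forall fun z => ?_
    rw [map_smul, hGbase, map_smul, smul_inv_smul₀ hρ0.ne']
  · have hball : ∀ᶠ z in 𝓝 (0 : A × Phase), ‖ℓ (ρ⁻¹ • z)‖ ≤ 1 := by
      have : Tendsto (fun z : A × Phase => ‖ℓ (ρ⁻¹ • z)‖) (𝓝 0) (𝓝 0) := by
        have h := (ℓ.continuous.norm.tendsto 0).comp hsc
        simpa [Function.comp_def] using h
      exact this.eventually (ge_mem_nhds one_pos)
    refine IsBigO.of_bound (ρ * |C'| * ρ⁻¹ ^ 2) ?_
    filter_upwards [hball] with z hz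
    have e1 : ρ • G (ρ⁻¹ • z) - z = ρ • (G (ρ⁻¹ • z) - ρ⁻¹ • z) := by
      rw [smul_sub, smul_inv_smul₀ hρ0.ne']
    have h3 := hGC _ hz
    rw [map_smul, norm_smul, Real.norm_of_nonneg (inv_nonneg.2 hρ0.le)] at h3
    rw [e1, norm_smul, Real.norm_of_nonneg hρ0.le, Real.norm_of_nonneg (by positivity)]
    calc _ ≤ ρ * (|C'| * (ρ⁻¹ * ‖ℓ z‖) ^ 2) := by
          gcongr
          exact h3.trans (by gcongr; exact le_abs_self _)
      _ = _ := by ring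
  · have h1 := hsc.eventually (hfield hf₁e hg₁def)
    have h2 := (hGt.comp hsc).eventually (hfield hf₂e hg₂def)
    filter_upwards [h1, h2] with z hz1 hz2
    rw [smul_inv_smul₀ hρ0.ne'] at hz1
    have e1 : HasFDerivAt (fun z => ρ • G (ρ⁻¹ • z))
        (ρ • ((fderiv ℝ G (ρ⁻¹ • z)).comp (ρ⁻¹ • ContinuousLinearMap.id ℝ (A × Phase)))) z :=
      ((hGd _).hasFDerivAt.comp z ((hasFDerivAt_id z).const_smul ρ⁻¹)).const_smul ρ
    have e2 := hGX (ρ⁻¹ • z)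
    rw [map_smul] at e2
    have e3 : fderiv ℝ G (ρ⁻¹ • z) (saddleField σ₀ g₁ (ρ⁻¹ • z)) =
        saddleField σ₀ g₂ (G (ρ⁻¹ • z)) := by
      have := congrArg (fun w => s • w) e2
      simpa only [smul_smul, hs2, one_smul] using this
    rw [e1.fderiv, ← hz1]
    simp only [Function.comp_apply] at hz2
    rw [← hz2, ← e3]
    simp [smul_smul, hρ0.ne']

end Saddle

/-! ### Removal of terms which are flat at the origin. -/

section Flat

variable {A : Type} [NormedAddCommGroup A] [NormedSpace ℝ A]

theorem tendsto_of_sub_isBigO {Θ : A × Phase → A × Phase}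
    (h : (fun z => Θ z - z) =O[𝓝 0] fun z => ‖z.2‖ ^ 2) : Tendsto Θ (𝓝 0) (𝓝 0) := by
  have h1 : Tendsto (fun z : A × Phase => ‖z.2‖ ^ 2) (𝓝 0) (𝓝 0) := by
    have : Continuous fun z : A × Phase => ‖z.2‖ ^ 2 := by fun_prop
    simpa using this.tendsto 0
  simpa using (h.trans_tendsto h1).add tendsto_id

theorem comp_sub_isBigO {Θ₁ Θ₂ : A × Phase → A × Phase}
    (h₁ : (fun z => Θ₁ z - z) =O[𝓝 0] fun z => ‖z.2‖ ^ 2)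
    (h₂ : (fun z => Θ₂ z - z) =O[𝓝 0] fun z => ‖z.2‖ ^ 2) :
    (fun z => Θ₂ (Θ₁ z) - z) =O[𝓝 0] fun z => ‖z.2‖ ^ 2 := by
  have h3 : (fun z => Θ₂ (Θ₁ z) - Θ₁ z) =O[𝓝 0] fun z => ‖(Θ₁ z).2‖ ^ 2 :=
    h₂.comp_tendsto (tendsto_of_sub_isBigO h₁)
  have h4 : (fun z : A × Phase => ‖z.2‖ ^ 2) =O[𝓝 0] fun z => z.2 := by
    have : (fun z : A × Phase => z.2) =O[𝓝 0] fun _ => (1 : ℝ) :=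
      (continuous_snd.tendsto 0).isBigO_one ℝ
    simpa [pow_two] using this.norm_left.mul (isBigO_refl (fun z : A × Phase => ‖z.2‖) (𝓝 0))
  have h5 : (fun z => (Θ₁ z).2) =O[𝓝 0] fun z => z.2 := by
    have e : (fun z => (Θ₁ z).2) = fun z => (Θ₁ z - z).2 + z.2 := by ext1 z; simp
    rw [e]
    exact (isBigO_snd_prod'.trans (h₁.trans h4)).add (isBigO_refl _ _)
  have h6 := h3.trans (h5.norm_norm.pow 2)
  simpa using h6.add h₁

theorem conjNear_comp {Θ₁ Θ₂ X Y Z : A × Phase → A × Phase}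
    (hd₁ : ∀ᶠ z in 𝓝 0, DifferentiableAt ℝ Θ₁ z) (hd₂ : Differentiable ℝ Θ₂) (h : Tendsto Θ₁ (𝓝 0) (𝓝 0)) (h₁ : ConjNear Θ₁ X Y)
    (h₂ : ConjNear Θ₂ Y Z) : ConjNear (fun z => Θ₂ (Θ₁ z)) X Z := by
  filter_upwards [hd₁, h₁, h.eventually h₂] with z hz e1 e2
  have : HasFDerivAt (fun z => Θ₂ (Θ₁ z)) ((fderiv ℝ Θ₂ (Θ₁ z)).comp (fderiv ℝ Θ₁ z)) z :=
    (hd₂ _).hasFDerivAt.comp z hz.hasFDerivAt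
  rw [this.fderiv, ContinuousLinearMap.comp_apply, e1, e2]

theorem fiberedNear_comp {Θ₁ Θ₂ : A × Phase → A × Phase} (h : Tendsto Θ₁ (𝓝 0) (𝓝 0))
    (h₁ : FiberedNear Θ₁) (h₂ : FiberedNear Θ₂) : FiberedNear fun z => Θ₂ (Θ₁ z) := by
  filter_upwards [h₁, h.eventually h₂] with z e1 e2
  rw [e2, e1]

/-- A flat function splits into a part which is flat along `v = y = 0` and a part which is flat
along `u = 0`. -/
theorem exists_flat_splitting [FiniteDimensional ℝ A] (M : ℕ) {R : A × Phase → ℝ}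
    (hR : SmoothNear R) (hRN : R =O[𝓝 0] fun z => ‖z.2‖ ^ (2 ^ M * M)) :
    ∃ R₁ : A × Phase → ℝ, ContDiff ℝ ∞ R₁ ∧ (R₁ =O[𝓝 0] fun z => ‖z.2.2‖ ^ M) ∧
      (fun z => R z - R₁ z) =O[𝓝 0] fun z => ‖z.2.1‖ ^ M := by
  rcases Nat.eq_zero_or_pos M with rfl | hM
  · refine ⟨0, contDiff_const, isBigO_zero _ _, by simpa using hRN⟩
  obtain ⟨C, hC0, hC⟩ := hRN.exists_nonneg
  obtain ⟨χ, hχ, hχs, hχ1, hχ01, hχp⟩ := exists_cutoff (hR.and hC.bound)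
  set f : A × Phase → ℝ := fun z => χ z * R z with hfdef
  have hf : ContDiff ℝ ∞ f := contDiff_cutoff_mul hχ fun z hz => (hχp z hz).1
  have hfs : HasCompactSupport f := hχs.mul_right
  have hfN : ∀ z, ‖f z‖ ≤ C * ‖ContinuousLinearMap.snd ℝ A Phase z‖ ^ (2 ^ M * M) := fun z => by
    by_cases h : z ∈ tsupport χ
    · have h1 := (hχp z h).2
      rw [Real.norm_of_nonneg (by positivity : 0 ≤ ‖z.2‖ ^ (2 ^ M * M))] at h1
      have h2 := hχ01 z
      rw [hfdef, norm_mul, Real.norm_of_nonneg h2.1]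
      exact (mul_le_of_le_one_left (norm_nonneg _) h2.2).trans h1
    · simp only [hfdef, image_eq_zero_of_notMem_tsupport h, zero_mul, norm_zero]
      positivity
  obtain ⟨B, hB0, hB⟩ := exists_bound_of_hasCompactSupport_le hf hfs (M + 1)
  obtain ⟨C', hC'0, hC'⟩ := exists_norm_iteratedFDeriv_le_of_flat M (m := M)
    (contDiff_infty.1 hf (M + 1)) (ContinuousLinearMap.snd ℝ A Phase) hM (C := max B C)
    (fun j hj w => (hB j hj w).trans (le_max_left _ _))
    (fun w => (hfN w).trans (by gcongr; exact le_max_right _ _))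
  set e : A × Phase := (0, (1, 0)) with he
  have hen : ‖e‖ = 1 := by simp [he, Prod.norm_def]
  set π : A × Phase → A × Phase := fun z => (z.1, (0, z.2.2)) with hπ
  have hπs : ContDiff ℝ ∞ π := by fun_prop
  have hπe : ∀ z, π z + z.2.1 • e = z := fun z => by
    ext <;> simp [hπ, he]
  -- This is the Taylor polynomial in `u` at `u = 0`, of degree below `M`. Its coefficients are
  -- derivatives of `f` at points with `u = 0`, where flatness at the origin means flatness in `(v,
  -- y)`, still of order `M` after at most `M` differentiations; the remainder is `O(|u| ^ M)`.
  set R₁ : A × Phase → ℝ := fun z => ∑ j ∈ Finset.range M,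
    z.2.1 ^ j / j.factorial * iteratedFDeriv ℝ j f (π z) fun _ => e with hR₁
  have happ : ∀ j z, |iteratedFDeriv ℝ j f z fun _ => e| ≤ ‖iteratedFDeriv ℝ j f z‖ := fun j z => by
    simpa [hen] using (iteratedFDeriv ℝ j f z).le_opNorm fun _ => e
  refine ⟨R₁, ?_, ?_, ?_⟩
  · refine ContDiff.sum fun j _ => ?_
    have h1 : ContDiff ℝ ∞ fun z => iteratedFDeriv ℝ j f (π z) :=
      (hf.iteratedFDeriv_right (m := ∞) (by norm_cast)).comp hπs
    have h2 : ContDiff ℝ ∞ fun z => (iteratedFDeriv ℝ j f (π z)) fun _ => e :=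
      (ContinuousMultilinearMap.apply ℝ (fun _ : Fin j => A × Phase) ℝ fun _ => e).contDiff.comp h1
    have h3 : ContDiff ℝ ∞ fun z : A × Phase => z.2.1 ^ j / j.factorial := by fun_prop
    exact h3.mul h2
  · have hu : ∀ᶠ z in 𝓝 (0 : A × Phase), |z.2.1| < 1 := by
      have : Continuous fun z : A × Phase => |z.2.1| := by fun_prop
      exact (this.tendsto 0).eventually (gt_mem_nhds (by simp))
    refine IsBigO.of_bound (M * C') ?_
    filter_upwards [hu] with z hz
    rw [Real.norm_of_nonneg (by positivity : (0:ℝ) ≤ ‖z.2.2‖ ^ M)]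
    refine (norm_sum_le _ _).trans ?_
    have : ∀ j ∈ Finset.range M, ‖z.2.1 ^ j / j.factorial * iteratedFDeriv ℝ j f (π z) fun _ => e‖ ≤
        C' * ‖z.2.2‖ ^ M := fun j hj => by
      have h1 := (happ j (π z)).trans (hC' j (Finset.mem_range.1 hj).le (π z))
      have h2 : ‖ContinuousLinearMap.snd ℝ A Phase (π z)‖ = ‖z.2.2‖ := by
        change ‖((0 : ℝ), z.2.2)‖ = _
        rw [Prod.norm_mk, norm_zero, max_eq_right (norm_nonneg _)]
      rw [h2] at h1
      have h3 : ‖z.2.1 ^ j / (j.factorial : ℝ)‖ ≤ 1 := by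
        rw [norm_div, norm_pow, Real.norm_eq_abs, RCLike.norm_natCast]
        have : (1 : ℝ) ≤ j.factorial := by exact_mod_cast j.factorial_pos
        exact div_le_one_of_le₀ ((pow_le_one₀ (abs_nonneg _) hz.le).trans this) (by positivity)
      rw [norm_mul]
      calc _ ≤ 1 * (C' * ‖z.2.2‖ ^ M) := by gcongr; exact h1
        _ = _ := one_mul _
    refine (Finset.sum_le_sum this).trans ?_
    simp [mul_assoc]
  · refine IsBigO.of_bound B ?_
    filter_upwards [hχ1] with z hz
    have h1 := abs_sub_taylor_le M (g := fun t : ℝ => f (π z + t • e)) (by fun_prop) (C := B)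
      (fun t => by
        rw [iteratedDeriv_line hf]
        exact (happ _ _).trans (hB M (by omega) _)) z.2.1
    simp only [iteratedDeriv_line hf, hπe, zero_smul, add_zero] at h1
    have h2 : f z = R z := by simp [hfdef, hz]
    rw [h2] at h1
    rw [Real.norm_eq_abs, norm_pow, norm_norm, Real.norm_eq_abs]
    exact h1

/-- The coordinates `(v, y)`, as a complex number. -/
def stableProj (A : Type) [NormedAddCommGroup A] [NormedSpace ℝ A] : A × Phase →L[ℝ] ℂ :=
  (Complex.equivRealProdCLM.symm : ℝ × ℝ →L[ℝ] ℂ) ∘L (ContinuousLinearMap.snd ℝ ℝ (ℝ × ℝ)) ∘L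
    ContinuousLinearMap.snd ℝ A Phase

theorem stableProj_re (z : A × Phase) : (stableProj A z).re = z.2.2.1 := rfl

theorem stableProj_im (z : A × Phase) : (stableProj A z).im = z.2.2.2 := rfl

theorem norm_le_norm_stableProj (z : A × Phase) : ‖z.2.2‖ ≤ ‖stableProj A z‖ :=
  norm_prod_le_iff.2 ⟨Complex.abs_re_le_norm (stableProj A z),
    Complex.abs_im_le_norm (stableProj A z)⟩

theorem norm_stableProj_le (z : A × Phase) : ‖stableProj A z‖ ≤ 2 * ‖z.2.2‖ := by
  refine (Complex.norm_le_abs_re_add_abs_im _).trans ?_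
  rw [stableProj_re, stableProj_im]
  linarith [norm_fst_le z.2.2, norm_snd_le z.2.2, Real.norm_eq_abs z.2.2.1, Real.norm_eq_abs z.2.2.2]

/-- The linear part contracts `(v, y)` at rate at least `2 * m`. Since `F` vanishes for `v = y = 0`
and has slope at most `m`, it is bounded by `m` times the norm of `(v, y)` and costs at most half of
this rate. Complex numbers provide the Euclidean inner product. -/
theorem inner_stableProj_saddleField_le {σ₀ m : ℝ} (hm1 : 2 * m ≤ 1) (hm : 2 * m ≤ σ₀)
    {F : A × Phase → ℝ} (hF : Differentiable ℝ F) (hb : ∀ z, ‖fderiv ℝ F z‖ ≤ m)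
    (h0 : ∀ z : A × Phase, z.2.2 = 0 → F z = 0) (w : A × Phase) :
    inner ℝ (stableProj A w) (stableProj A (saddleField σ₀ F w)) ≤ -m * ‖stableProj A w‖ ^ 2 := by
  have hm0 : 0 ≤ m := (norm_nonneg _).trans (hb 0)
  have h1 : |F w| ≤ m * ‖stableProj A w‖ := by
    have h2 := norm_sub_le_of_norm_fderiv_le hF hb w (w.1, (w.2.1, 0))
    rw [h0 (w.1, (w.2.1, 0)) rfl, sub_zero] at h2
    have h3 : ‖w - (w.1, (w.2.1, 0))‖ = ‖w.2.2‖ := by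
      have : w - (w.1, (w.2.1, 0)) = (0, (0, w.2.2)) := by ext <;> simp
      rw [this, Prod.norm_mk, Prod.norm_mk, norm_zero, norm_zero, max_eq_right (norm_nonneg _),
        max_eq_right (norm_nonneg _)]
    rw [h3] at h2
    exact h2.trans (by gcongr; exact norm_le_norm_stableProj w)
  have h4 : |w.2.2.2| ≤ ‖stableProj A w‖ := Complex.abs_im_le_norm (stableProj A w)
  have h5 : w.2.2.2 * F w ≤ m * ‖stableProj A w‖ ^ 2 := by
    refine (le_abs_self _).trans ?_
    rw [abs_mul]
    calc _ ≤ ‖stableProj A w‖ * (m * ‖stableProj A w‖) := by gcongr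
      _ = _ := by ring
  have h6 : ‖stableProj A w‖ ^ 2 = w.2.2.1 ^ 2 + w.2.2.2 ^ 2 := by
    rw [← Complex.normSq_eq_norm_sq, Complex.normSq_apply, stableProj_re, stableProj_im]; ring
  rw [Complex.inner]
  simp only [Complex.mul_re, Complex.conj_re, Complex.conj_im, stableProj_re, stableProj_im,
    saddleField_apply]
  rw [h6] at h5 ⊢
  nlinarith [sq_nonneg w.2.2.1, sq_nonneg w.2.2.2, mul_nonneg (sub_nonneg.2 hm1) (sq_nonneg w.2.2.1),
    mul_nonneg (sub_nonneg.2 hm) (sq_nonneg w.2.2.2)]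

/-- A term which is sufficiently flat at the origin is removed by a `C^k` conjugation. -/
theorem exists_flat_removal {k : ℕ} (hk : 1 ≤ k) {σ₀ : ℝ} (hσ : 0 < σ₀) :
    ∃ N : ℕ, 2 ≤ N ∧ ∀ {A : Type} [NormedAddCommGroup A] [NormedSpace ℝ A] [FiniteDimensional ℝ A]
      {P R : A × Phase → ℝ} (_ : SmoothNear P) (_ : SmoothNear R) (_ : P 0 = 0)
      (_ : fderiv ℝ P 0 = 0) (_ : ∀ᶠ z in 𝓝 0, z.2.2 = 0 → P z = 0)
      (_ : R =O[𝓝 0] fun z => ‖z.2‖ ^ N),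
      ∃ Θ : A × Phase → A × Phase, ContDiff ℝ k Θ ∧ FiberedNear Θ ∧
        ((fun z => Θ z - z) =O[𝓝 0] fun z => ‖z.2‖ ^ 2) ∧
        ConjNear Θ (saddleField σ₀ fun z => P z + R z) (saddleField σ₀ P) := by
  -- One rate serves both steps: in reversed time `u` contracts at rate `1 ≥ 2 * m`, whatever the
  -- nonlinearity, and in forward time `(v, y)` contracts at rate `2 * m`, of which the nonlinear
  -- term may use one half.
  set m : ℝ := min 1 σ₀ / 2 with hmdef
  have hm : 0 < m := by positivity
  have hm1 : 2 * m ≤ 1 := by rw [hmdef]; linarith [min_le_left 1 σ₀]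
  have hmσ : 2 * m ≤ σ₀ := by rw [hmdef]; linarith [min_le_right 1 σ₀]
  obtain ⟨M, hM2, hM⟩ := exists_local_conjugation hk hm σ₀
  refine ⟨2 ^ M * M, ?_, fun {A} _ _ _ {P R} hP hR hP0 hP1 hPS hRN => ?_⟩
  · nlinarith [Nat.one_le_two_pow (n := M)]
  obtain ⟨R₁, hR₁, hR₁M, hRR₁⟩ := exists_flat_splitting M hR hRN
  have hlin : ∀ {f : A × Phase → ℝ} {g : A × Phase → ℝ} {j : ℕ}, 2 ≤ j →
      f =O[𝓝 0] (fun z => g z ^ j) → (∀ z, |g z| ≤ ‖z‖) → f =O[𝓝 0] fun z => ‖z‖ ^ 2 := by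
    intro f g j hj hf hg
    have h1 : (fun z => g z ^ j) =O[𝓝 0] fun z => ‖z‖ ^ j :=
      (IsBigO.of_bound 1 (Eventually.of_forall fun z => by simpa using hg z)).pow j
    exact hf.trans (h1.trans ((IsBigO.of_bound 1 (by
      have : ∀ᶠ z in 𝓝 (0 : A × Phase), ‖z‖ < 1 := by
        simpa using eventually_norm_sub_lt (0 : A × Phase) one_pos
      filter_upwards [this] with z hz
      simpa using pow_le_pow_of_le_one (norm_nonneg z) hz.le hj))))
  have hz2 : ∀ z : A × Phase, |‖z.2‖| ≤ ‖z‖ := fun z => by simpa using norm_snd_le z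
  have hz22 : ∀ z : A × Phase, |‖z.2.2‖| ≤ ‖z‖ := fun z => by
    simpa using (norm_snd_le z.2).trans (norm_snd_le z)
  have hN2 : 2 ≤ 2 ^ M * M := by nlinarith [Nat.one_le_two_pow (n := M)]
  have dR := hasFDerivAt_zero_of_isBigO (hlin hN2 hRN hz2)
  have dR₁ := hasFDerivAt_zero_of_isBigO (hlin hM2 hR₁M hz22)
  have R0 : R 0 = 0 := by
    obtain ⟨C, hC⟩ := (hlin hN2 hRN hz2).bound
    simpa using hC.self_of_nhds
  have R₁S : ∀ᶠ z in 𝓝 (0 : A × Phase), z.2.2 = 0 → R₁ z = 0 := by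
    obtain ⟨C, hC⟩ := hR₁M.bound
    filter_upwards [hC] with z hz h
    simpa [h, show M ≠ 0 by omega] using hz
  have R₁0 : R₁ 0 = 0 := R₁S.self_of_nhds rfl
  have dP : HasFDerivAt P (0 : A × Phase →L[ℝ] ℝ) 0 := by
    have := (hP.self_of_nhds.differentiableAt (by simp)).hasFDerivAt
    rwa [hP1] at this
  have hPR : SmoothNear fun z => P z + R z := by
    filter_upwards [hP, hR] with z h1 h2 using h1.add h2
  have hPR₁ : SmoothNear fun z => P z + R₁ z := by
    filter_upwards [hP] with z h1 using h1.add hR₁.contDiffAt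
  -- removal of the part which is flat along `u = 0`
  obtain ⟨Θ₁, hΘ₁, hΘ₁π, hΘ₁id, hΘ₁c⟩ := hM (W := ℝ) ((ContinuousLinearMap.fst ℝ ℝ (ℝ × ℝ)) ∘L
      ContinuousLinearMap.snd ℝ A Phase) (s := -1) (η := 1) (by simp) one_pos ∅ (by simp)
    (fun F _ _ _ w => by
      have e1 : ((ContinuousLinearMap.fst ℝ ℝ (ℝ × ℝ)) ∘L ContinuousLinearMap.snd ℝ A Phase)
          ((-1 : ℝ) • saddleField σ₀ F w) = -w.2.1 := by
        simp [saddleField_apply]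
      rw [e1]
      simp only [ContinuousLinearMap.comp_apply, ContinuousLinearMap.coe_fst',
        ContinuousLinearMap.coe_snd', RCLike.inner_apply, conj_trivial, Real.norm_eq_abs, sq_abs]
      nlinarith [sq_nonneg w.2.1])
    (F₁ := fun z => P z + R z) (F₂ := fun z => P z + R₁ z) hPR hPR₁ (by simp [hP0, R0])
    (by simp [hP0, R₁0]) (by simpa using (dP.fun_add dR).fderiv) (by simpa using (dP.fun_add dR₁).fderiv)
    (by simp) (by simpa using hRR₁)
  -- removal of the part which is flat along `v = y = 0`
  obtain ⟨Θ₂, hΘ₂, hΘ₂π, hΘ₂id, hΘ₂c⟩ := hM (stableProj A) (s := 1) (η := m) (by simp) hm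
    {z | z.2.2 = 0} (fun z hz r => by
      have hz : z.2.2 = 0 := hz
      simp [hz])
    (fun F hF hb h0 w => by
      rw [one_smul]
      exact inner_stableProj_saddleField_le hm1 hmσ hF hb h0 w)
    (F₁ := fun z => P z + R₁ z) (F₂ := P) hPR₁ hP (by simp [hP0, R₁0]) hP0
    (by simpa using (dP.fun_add dR₁).fderiv) hP1
    (by filter_upwards [hPS, R₁S] with z h1 h2 hz; rw [h1 hz, h2 hz, add_zero])
    (by
      have e : (fun z => P z + R₁ z - P z) = R₁ := by ext1 z; ring
      rw [e]
      exact hR₁M.trans ((IsBigO.of_bound 1 (Eventually.of_forall fun z => by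
        simpa using norm_le_norm_stableProj z)).pow M))
  have hk0 : (k : WithTop ℕ∞) ≠ 0 := by exact_mod_cast Nat.one_le_iff_ne_zero.1 hk
  have h1 : (fun z => Θ₁ z - z) =O[𝓝 0] fun z => ‖z.2‖ ^ 2 :=
    hΘ₁id.trans ((IsBigO.of_bound 1 (Eventually.of_forall fun z => by
      simpa using norm_fst_le z.2)).pow 2)
  have h2 : (fun z => Θ₂ z - z) =O[𝓝 0] fun z => ‖z.2‖ ^ 2 :=
    hΘ₂id.trans ((IsBigO.of_bound 2 (Eventually.of_forall fun z => by
      simpa using (norm_stableProj_le z).trans (by gcongr; exact norm_snd_le z.2))).pow 2)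
  have ht := tendsto_of_sub_isBigO h1
  exact ⟨fun z => Θ₂ (Θ₁ z), hΘ₂.comp hΘ₁, fiberedNear_comp ht hΘ₁π hΘ₂π, comp_sub_isBigO h1 h2,
    conjNear_comp (Eventually.of_forall (hΘ₁.differentiable hk0)) (hΘ₂.differentiable hk0) ht hΘ₁c hΘ₂c⟩

end Flat

/-! ### Order in the phase variables, and resonant polynomials. -/

section Order

variable {A : Type} [NormedAddCommGroup A] [NormedSpace ℝ A]

/-- The function `f` is of order `n` in the phase variables, uniformly in the parameters. -/
def Ord (n : ℕ) (f : A × Phase → ℝ) : Prop := f =O[𝓝 0] fun z => ‖z.2‖ ^ n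

variable {f g : A × Phase → ℝ} {m n : ℕ}

theorem Ord.add (hf : Ord n f) (hg : Ord n g) : Ord n fun z => f z + g z := IsBigO.add hf hg

theorem Ord.sub (hf : Ord n f) (hg : Ord n g) : Ord n fun z => f z - g z := IsBigO.sub hf hg

theorem Ord.mul (hf : Ord m f) (hg : Ord n g) : Ord (m + n) fun z => f z * g z := by
  simpa [Ord, pow_add] using IsBigO.mul hf hg

theorem Ord.pow (hf : Ord m f) (j : ℕ) : Ord (m * j) fun z => f z ^ j := by
  simpa [Ord, pow_mul] using IsBigO.pow hf j

theorem Ord.mono (h : m ≤ n) (hf : Ord n f) : Ord m f := by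
  refine hf.trans (IsBigO.of_bound 1 ?_)
  have : ∀ᶠ z in 𝓝 (0 : A × Phase), ‖z‖ < 1 := by
    simpa using eventually_norm_sub_lt (0 : A × Phase) one_pos
  filter_upwards [this] with z hz
  simpa using pow_le_pow_of_le_one (norm_nonneg z.2) ((norm_snd_le z).trans hz.le) h

theorem Ord.congr (hf : Ord n f) (h : ∀ᶠ z in 𝓝 0, f z = g z) : Ord n g :=
  hf.congr' h EventuallyEq.rfl

theorem ord_zero_of_continuousAt (h : ContinuousAt f 0) : Ord 0 f := by
  simpa [Ord] using h.tendsto.isBigO_one ℝ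

theorem ord_coeff {p : A → ℝ} (hp : SmoothNear p) : Ord 0 fun z : A × Phase => p z.1 :=
  ord_zero_of_continuousAt (ContinuousAt.comp (f := Prod.fst) (g := p)
    hp.self_of_nhds.continuousAt continuousAt_fst)

theorem Ord.coeff_mul {p : A → ℝ} (hp : SmoothNear p) (hf : Ord n f) :
    Ord n fun z => p z.1 * f z := by
  simpa using (ord_coeff hp).mul hf

theorem ord_u : Ord 1 fun z : A × Phase => z.2.1 :=
  IsBigO.of_bound 1 (Eventually.of_forall fun z => by simpa using norm_fst_le z.2)

theorem ord_v : Ord 1 fun z : A × Phase => z.2.2.1 :=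
  IsBigO.of_bound 1 (Eventually.of_forall fun z => by
    simpa using (norm_fst_le z.2.2).trans (norm_snd_le z.2))

theorem ord_y : Ord 1 fun z : A × Phase => z.2.2.2 :=
  IsBigO.of_bound 1 (Eventually.of_forall fun z => by
    simpa using (norm_snd_le z.2.2).trans (norm_snd_le z.2))

theorem Ord.eq_zero (hf : Ord n f) (hn : n ≠ 0) : f 0 = 0 := by
  obtain ⟨C, hC⟩ := IsBigO.bound hf
  simpa [hn] using hC.self_of_nhds

/-- The monomial `u ^ i * v ^ j * y ^ l`. -/
def mono (i j l : ℕ) (x : Phase) : ℝ := x.1 ^ i * x.2.1 ^ j * x.2.2 ^ l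

theorem ord_mono (i j l : ℕ) : Ord (i + j + l) fun z : A × Phase => mono i j l z.2 := by
  simpa [mono] using ((ord_u.pow i).mul (ord_v.pow j)).mul (ord_y.pow l)

theorem contDiff_mono (i j l : ℕ) : ContDiff ℝ ∞ (mono i j l) := by
  unfold mono
  fun_prop

/-- The induction rests on `α^(l+2) - β^(l+2) = α (α^(l+1) - β^(l+1)) + β^(l+1) (α - β)`. -/
theorem ord_pow_sub_pow {α β : A × Phase → ℝ} {q : ℕ} (hα : Ord 1 α) (hβ : Ord 1 β)
    (hq : Ord q fun z => α z - β z) (l : ℕ) :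
    Ord (l + q) fun z => α z ^ (l + 1) - β z ^ (l + 1) := by
  induction l with
  | zero => simpa using hq
  | succ l ih =>
    have h1 := hα.mul ih
    have h2 := (hβ.pow (l + 1)).mul hq
    rw [show 1 + (l + q) = l + 1 + q by ring] at h1
    rw [one_mul] at h2
    exact (h1.add h2).congr (Eventually.of_forall fun z => by ring)

theorem ord_mono_sub_mono {α β : A × Phase → ℝ} {q i j l : ℕ} (hα : Ord 1 α) (hβ : Ord 1 β)
    (hq : Ord q fun z => α z - β z) :
    Ord (i + j + l - 1 + q) fun z =>
      mono i j l (z.2.1, z.2.2.1, α z) - mono i j l (z.2.1, z.2.2.1, β z) := by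
  cases l with
  | zero => simpa [mono, Ord] using isBigO_zero _ _
  | succ l =>
    have h := ((ord_u.pow i).mul (ord_v.pow j)).mul (ord_pow_sub_pow hα hβ hq l)
    rw [one_mul, one_mul, ← add_assoc] at h
    exact h.congr (Eventually.of_forall fun z => by simp only [mono]; ring)

/-- Finite sums of resonant monomials of degree at least two and at most `N`, with coefficients
which are smooth functions of the parameters. -/
inductive NormalForm (σ₀ : ℝ) (N : ℕ) : (A × Phase → ℝ) → Prop
  | zero : NormalForm σ₀ N fun _ => 0
  | add {P : A × Phase → ℝ} {p : A → ℝ} {i j l : ℕ} : NormalForm σ₀ N P → SmoothNear p →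
      2 ≤ i + j + l → i + j + l ≤ N → (i : ℝ) - j = σ₀ * (l - 1) →
      NormalForm σ₀ N fun z => P z + p z.1 * mono i j l z.2

variable {σ₀ : ℝ} {P : A × Phase → ℝ}

theorem NormalForm.of_le (h : m ≤ n) (hP : NormalForm σ₀ m P) : NormalForm σ₀ n P := by
  induction hP with
  | zero => exact .zero
  | add _ hp h2 hN hr ih => exact .add ih hp h2 (hN.trans h) hr

theorem smoothNear_coeff {p : A → ℝ} (hp : SmoothNear p) :
    SmoothNear fun z : A × Phase => p z.1 := by
  filter_upwards [(continuous_fst.tendsto (0 : A × Phase)).eventually hp] with z hz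
  exact ContDiffAt.comp (f := Prod.fst) (g := p) z hz contDiffAt_fst

theorem smoothNear_coeff_mul_mono {p : A → ℝ} (hp : SmoothNear p) (i j l : ℕ) :
    SmoothNear fun z : A × Phase => p z.1 * mono i j l z.2 := by
  filter_upwards [smoothNear_coeff hp] with z hz
  exact hz.mul ((contDiff_mono i j l).comp contDiff_snd).contDiffAt

theorem NormalForm.smoothNear (hP : NormalForm σ₀ N P) : SmoothNear P := by
  induction hP with
  | zero => exact ContDiff.smoothNear contDiff_const
  | @add P p i j l _ hp _ _ _ ih =>
    filter_upwards [ih, smoothNear_coeff_mul_mono hp i j l] with z h1 h2 using h1.add h2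

theorem NormalForm.ord (hP : NormalForm σ₀ N P) : Ord 2 P := by
  induction hP with
  | zero => exact isBigO_zero _ _
  | @add P p i j l _ hp h2 _ _ ih => exact ih.add (((ord_mono i j l).mono h2).coeff_mul hp)

/-- A monomial surviving on `v = y = 0` is a power of `u`; its resonance relation would read `i =
-σ₀`, impossible for `σ₀ > 0`. This invariance of `v = y = 0` is needed for the contraction in the
flat part. -/
theorem NormalForm.eq_zero_of_stable (hσ : 0 < σ₀) (hP : NormalForm σ₀ N P) (z : A × Phase)
    (hz : z.2.2 = 0) : P z = 0 := by
  induction hP with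
  | zero => rfl
  | @add P p i j l _ hp h2 _ hr ih =>
    change P z + _ = 0
    rw [ih, zero_add]
    have : mono i j l z.2 = 0 := by
      rcases Nat.eq_zero_or_pos j with rfl | hj
      · rcases Nat.eq_zero_or_pos l with rfl | hl
        · have : (0 : ℝ) ≤ i := by positivity
          norm_num at hr
          linarith
        · simp [mono, hz, hl.ne']
      · simp [mono, hz, hj.ne']
    rw [this, mul_zero]

/-- Every monomial has degree at least two, so a difference of order `q` in the last argument gains
at least one further small factor. Corrections of degree `N` thus act on `P` only beyond degree `N`.
-/
theorem NormalForm.ord_sub {α β : A × Phase → ℝ} {q : ℕ} (hα : Ord 1 α) (hβ : Ord 1 β)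
    (hq : Ord q fun z => α z - β z) (hP : NormalForm σ₀ N P) :
    Ord (q + 1) fun z => P (z.1, (z.2.1, z.2.2.1, α z)) - P (z.1, (z.2.1, z.2.2.1, β z)) := by
  induction hP with
  | zero => simpa [Ord] using isBigO_zero _ _
  | @add P p i j l _ hp h2 _ hr ih =>
    have h1 : Ord (q + 1) fun z => p z.1 * (mono i j l (z.2.1, z.2.2.1, α z) -
        mono i j l (z.2.1, z.2.2.1, β z)) :=
      ((ord_mono_sub_mono hα hβ hq).mono (by omega)).coeff_mul hp
    exact (ih.add h1).congr (Eventually.of_forall fun z => by ring)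

end Order

/-! ### Formal normalization and the homological equation. -/

section Formal

variable {A : Type} [NormedAddCommGroup A] [NormedSpace ℝ A]

/-- Monomials are eigenfunctions of the linear derivation, with eigenvalue `i - j - σ l`; the
nonlinearity contributes only through the derivative in `y`. The direction has no parameter
component, so `p` behaves as a constant. -/
theorem fderiv_coeff_mul_mono {p : A → ℝ} {z : A × Phase} (hp : DifferentiableAt ℝ p z.1)
    (i j l : ℕ) (σ f : ℝ) :
    fderiv ℝ (fun z : A × Phase => p z.1 * mono i j l z.2) z
      (0, (z.2.1, -z.2.2.1, -σ * z.2.2.2 + f)) =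
    p z.1 * ((i - j - σ * l) * mono i j l z.2 +
      f * (l * (z.2.1 ^ i * z.2.2.1 ^ j * z.2.2.2 ^ (l - 1)))) := by
  set w : A × Phase := (0, (z.2.1, -z.2.2.1, -σ * z.2.2.2 + f)) with hw
  have h1 : DifferentiableAt ℝ (fun z : A × Phase => p z.1 * mono i j l z.2) z :=
    (DifferentiableAt.comp (f := Prod.fst) (g := p) z hp differentiableAt_fst).mul
      (((contDiff_mono i j l).differentiable (by simp)).comp differentiable_snd z)
  rw [← h1.lineDeriv_eq_fderiv]
  refine HasDerivAt.deriv ?_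
  have pw : ∀ (x y : ℝ) (n : ℕ), HasDerivAt (fun t : ℝ => (x + t * y) ^ n)
      (n * x ^ (n - 1) * y) 0 := fun x y n => by
    have h : HasDerivAt (fun t : ℝ => x + t * y) y 0 := by
      simpa using ((hasDerivAt_id (0 : ℝ)).mul_const y).const_add x
    simpa using h.fun_pow n
  have h2 := (((pw z.2.1 z.2.1 i).fun_mul (pw z.2.2.1 (-z.2.2.1) j)).fun_mul
    (pw z.2.2.2 (-σ * z.2.2.2 + f) l)).const_mul (p z.1)
  have e1 : (fun t : ℝ => p (z + t • w).1 * mono i j l (z + t • w).2) = fun t : ℝ => p z.1 *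
      ((z.2.1 + t * z.2.1) ^ i * (z.2.2.1 + t * -z.2.2.1) ^ j *
        (z.2.2.2 + t * (-σ * z.2.2.2 + f)) ^ l) := by
    ext1 t
    simp [hw, mono]
  rw [e1]
  refine h2.congr_deriv ?_
  have hpow : ∀ (x : ℝ) (n : ℕ), (n : ℝ) * x ^ (n - 1) * x = n * x ^ n := fun x n => by
    cases n with
    | zero => simp
    | succ n => rw [Nat.add_sub_cancel, mul_assoc, ← pow_succ]
  simp only [zero_mul, add_zero, mono]
  linear_combination (p z.1) * (z.2.2.1 ^ j * z.2.2.2 ^ l * hpow z.2.1 i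
    - z.2.1 ^ i * z.2.2.2 ^ l * hpow z.2.2.1 j - σ * z.2.1 ^ i * z.2.2.1 ^ j * hpow z.2.2.2 l)

variable {σ₀ : ℝ} {s : A →L[ℝ] ℝ} {F : A × Phase → ℝ}

/-- The nonlinearity of the family `y' = -(σ₀ + s a) y + F`, considered near `a = 0`. -/
def detuned (s : A →L[ℝ] ℝ) (F : A × Phase → ℝ) (z : A × Phase) : ℝ := F z - s z.1 * z.2.2.2

theorem saddleField_detuned (σ₀ : ℝ) (s : A →L[ℝ] ℝ) (F : A × Phase → ℝ) (z : A × Phase) :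
    saddleField σ₀ (detuned s F) z =
      (0, (z.2.1, -z.2.2.1, -(σ₀ + s z.1) * z.2.2.2 + F z)) := by
  rw [saddleField_apply, detuned]
  congr 3
  ring

/-- The failure of the coordinate `T` to satisfy the equation `T' = -(σ₀ + s a) T + P(a, u, v, T)`. -/
def defect (σ₀ : ℝ) (s : A →L[ℝ] ℝ) (F T P : A × Phase → ℝ) (z : A × Phase) : ℝ :=
  fderiv ℝ T z (saddleField σ₀ (detuned s F) z) + (σ₀ + s z.1) * T z -
    P (z.1, (z.2.1, z.2.2.1, T z))

theorem ord_one_of_sub_y {T : A × Phase → ℝ} (hT : Ord 2 fun z => T z - z.2.2.2) : Ord 1 T :=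
  ((hT.mono one_le_two).add ord_y).congr (Eventually.of_forall fun z => by ring)

/-- This is the homological equation. Adding `t` times a monomial to `T` and `p` times it to `P`
changes the defect, at degree `N`, exactly by the divisor times `t` minus `p`; the nonlinear
interactions are of higher order. -/
theorem ord_defect_sub {N : ℕ} {T P : A × Phase → ℝ} (hF : Ord 2 F) (hT : SmoothNear T)
    (hTy : Ord 2 fun z => T z - z.2.2.2) {M : ℕ} (hP : NormalForm σ₀ M P) {t p : A → ℝ}
    (ht : SmoothNear t) (hp : SmoothNear p) {i j l : ℕ} (hN : i + j + l = N) (hN2 : 2 ≤ N) :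
    Ord (N + 1) fun z => defect σ₀ s F (fun z => T z + t z.1 * mono i j l z.2)
      (fun z => P z + p z.1 * mono i j l z.2) z - defect σ₀ s F T P z -
      ((i - j - (σ₀ + s z.1) * (l - 1)) * t z.1 - p z.1) * mono i j l z.2 := by
  have htm : Ord N fun z : A × Phase => t z.1 * mono i j l z.2 :=
    ((ord_mono i j l).mono hN.ge).coeff_mul ht
  have hT'y : Ord 2 fun z => T z + t z.1 * mono i j l z.2 - z.2.2.2 :=
    (hTy.add (htm.mono hN2)).congr (Eventually.of_forall fun z => by ring)
  have hT1 := ord_one_of_sub_y hTy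
  have hT'1 := ord_one_of_sub_y hT'y
  have h1 : Ord (N + 1) fun z => P (z.1, (z.2.1, z.2.2.1, T z + t z.1 * mono i j l z.2)) -
      P (z.1, (z.2.1, z.2.2.1, T z)) :=
    hP.ord_sub hT'1 hT1 (htm.congr (Eventually.of_forall fun z => by ring))
  have h2 : Ord (N + 1) fun z => p z.1 *
      (mono i j l (z.2.1, z.2.2.1, T z + t z.1 * mono i j l z.2) - mono i j l z.2) :=
    ((ord_mono_sub_mono hT'1 ord_y hT'y).mono (by omega)).coeff_mul hp
  have h3 : Ord (N + 1) fun z => t z.1 *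
      (F z * (l * (z.2.1 ^ i * z.2.2.1 ^ j * z.2.2.2 ^ (l - 1)))) := by
    refine Ord.coeff_mul ht ?_
    rcases Nat.eq_zero_or_pos l with rfl | hl
    · simpa [Ord] using isBigO_zero _ _
    · have hl0 : Ord 0 fun _ : A × Phase => (l : ℝ) := ord_zero_of_continuousAt continuousAt_const
      exact (hF.mul (hl0.mul (ord_mono i j (l - 1)))).mono (by omega)
  refine ((h3.sub h1).sub h2).congr ?_
  filter_upwards [hT, smoothNear_coeff_mul_mono ht i j l,
    (continuous_fst.tendsto (0 : A × Phase)).eventually ht] with z hz1 hz2 hz3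
  have e1 : fderiv ℝ (fun z => T z + t z.1 * mono i j l z.2) z =
      fderiv ℝ T z + fderiv ℝ (fun z : A × Phase => t z.1 * mono i j l z.2) z :=
    fderiv_fun_add (hz1.differentiableAt (by simp)) (hz2.differentiableAt (by simp))
  have e2 := fderiv_coeff_mul_mono (z := z) (hz3.differentiableAt (by simp)) i j l (σ₀ + s z.1)
    (F z)
  simp only [defect, e1, add_apply]
  rw [saddleField_detuned, e2]
  ring

/-- Resonant monomials are put into `P`. For the others the divisor `i - j - (σ₀ + s a) (l - 1)` is
nonzero at `a = 0`, hence nearby, and the coefficient of `T` is a smooth quotient. Resonance is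
tested at `σ₀` only, so the list of monomials of `P` does not vary with the parameters. -/
theorem exists_correction {N : ℕ} (hN2 : 2 ≤ N) (hF : Ord 2 F) {ι : Type} (S : Finset ι)
    {c : ι → A → ℝ} (hc : ∀ r, SmoothNear (c r)) (I J L : ι → ℕ)
    (hIJL : ∀ r, I r + J r + L r = N) {T P : A × Phase → ℝ} (hT : SmoothNear T)
    (hTy : Ord 2 fun z => T z - z.2.2.2) (hP : NormalForm σ₀ N P) :
    ∃ T' P' : A × Phase → ℝ, SmoothNear T' ∧ (Ord 2 fun z => T' z - z.2.2.2) ∧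
      NormalForm σ₀ N P' ∧ Ord (N + 1) fun z => defect σ₀ s F T' P' z - defect σ₀ s F T P z +
        ∑ r ∈ S, c r z.1 * mono (I r) (J r) (L r) z.2 := by
  classical
  induction S using Finset.induction_on with
  | empty => exact ⟨T, P, hT, hTy, hP, by simpa [Ord] using isBigO_zero _ _⟩
  | insert r S hr ih =>
    obtain ⟨T₁, P₁, hT₁, hT₁y, hP₁, h₁⟩ := ih
    suffices ∃ t p : A → ℝ, SmoothNear t ∧ SmoothNear p ∧
        NormalForm σ₀ N (fun z : A × Phase => P₁ z + p z.1 * mono (I r) (J r) (L r) z.2) ∧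
        ∀ᶠ a in 𝓝 (0 : A), (I r - J r - (σ₀ + s a) * (L r - 1)) * t a - p a = - c r a by
      obtain ⟨t, p, ht, hp, hnf, hD⟩ := this
      have htm : SmoothNear fun z : A × Phase => t z.1 * mono (I r) (J r) (L r) z.2 :=
        smoothNear_coeff_mul_mono ht _ _ _
      have htm2 : Ord 2 fun z : A × Phase => t z.1 * mono (I r) (J r) (L r) z.2 :=
        ((ord_mono _ _ _).mono (by rw [hIJL]; exact hN2)).coeff_mul ht
      refine ⟨fun z => T₁ z + t z.1 * mono (I r) (J r) (L r) z.2, _, ?_, ?_, hnf, ?_⟩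
      · filter_upwards [hT₁, htm] with z h1 h2 using h1.add h2
      · exact (hT₁y.add htm2).congr (Eventually.of_forall fun z => by ring)
      · have h2 := ord_defect_sub (s := s) hF hT₁ hT₁y hP₁ ht hp (hIJL r) hN2
        refine (h₁.add h2).congr ?_
        filter_upwards [(continuous_fst.tendsto (0 : A × Phase)).eventually hD] with z hz
        rw [hz, Finset.sum_insert hr]
        ring
    by_cases hres : (I r : ℝ) - J r = σ₀ * (L r - 1)
    · refine ⟨fun _ => 0, c r, ContDiff.smoothNear contDiff_const, hc r,
        hP₁.add (hc r) (by rw [hIJL]; exact hN2) (hIJL r).le hres, Eventually.of_forall fun a => ?_⟩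
      ring
    · have hD : ContDiff ℝ ∞ fun a : A => (I r - J r - (σ₀ + s a) * (L r - 1) : ℝ) := by
        fun_prop
      have hD0 : ∀ᶠ a in 𝓝 (0 : A), (I r - J r - (σ₀ + s a) * (L r - 1) : ℝ) ≠ 0 := by
        refine hD.continuous.continuousAt.eventually_ne ?_
        simpa [sub_eq_zero] using hres
      refine ⟨fun a => - c r a / (I r - J r - (σ₀ + s a) * (L r - 1)), fun _ => 0, ?_,
        ContDiff.smoothNear contDiff_const, by simpa using hP₁, ?_⟩
      · filter_upwards [hc r, hD0] with a h1 h2 using h1.neg.div hD.contDiffAt h2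
      · filter_upwards [hD0] with a ha
        field_simp
        ring

theorem smoothNear_defect {T P : A × Phase → ℝ} (hF : SmoothNear F) (hT : SmoothNear T)
    (hT0 : T 0 = 0) (hP : SmoothNear P) : SmoothNear (defect σ₀ s F T P) := by
  have hc : ContinuousAt (fun z : A × Phase => (z.1, (z.2.1, z.2.2.1, T z))) 0 := by
    have := hT.self_of_nhds.continuousAt
    fun_prop
  have ht : Tendsto (fun z : A × Phase => (z.1, (z.2.1, z.2.2.1, T z))) (𝓝 0) (𝓝 0) := by
    have := hc.tendsto
    simp only [Prod.fst_zero, Prod.snd_zero, hT0] at this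
    exact this
  filter_upwards [hF, hT, ht.eventually hP] with z h1 h2 h3
  have h4 : ContDiffAt ℝ ∞ (fun z : A × Phase => (z.1, (z.2.1, z.2.2.1, T z))) z := by fun_prop
  have h5 : ContDiffAt ℝ ∞ (fun z => P (z.1, (z.2.1, z.2.2.1, T z))) z := h3.comp z h4
  have h6 : ContDiffAt ℝ ∞ (saddleField σ₀ (detuned s F)) z := by
    rw [funext (saddleField_detuned σ₀ s F)]
    fun_prop
  have h7 : ContDiffAt ℝ ∞ (fun z => fderiv ℝ T z (saddleField σ₀ (detuned s F) z)) z :=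
    (h2.fderiv_right (m := ∞) (by simp)).clm_apply h6
  have h8 : ContDiffAt ℝ ∞ (fun z => (σ₀ + s z.1) * T z) z := by fun_prop
  exact (h7.add h8).sub h5

/-- The leading term of a function of order `N`. -/
theorem exists_taylor_term [FiniteDimensional ℝ A] {e : A × Phase → ℝ} {N : ℕ}
    (he : SmoothNear e) (hN : Ord N e) : ∃ (c : (Fin N → Fin 3) → A → ℝ) (I J L : (Fin N → Fin 3) → ℕ),
      (∀ r, SmoothNear (c r)) ∧ (∀ r, I r + J r + L r = N) ∧
      Ord (N + 1) fun z => e z - ∑ r, c r z.1 * mono (I r) (J r) (L r) z.2 := by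
  obtain ⟨C, hC0, hC⟩ := IsBigO.exists_nonneg hN
  obtain ⟨χ, hχ, hχs, hχ1, hχ01, hχp⟩ := exists_cutoff (he.and hC.bound)
  set f : A × Phase → ℝ := fun z => χ z * e z with hfdef
  have hf : ContDiff ℝ ∞ f := contDiff_cutoff_mul hχ fun z hz => (hχp z hz).1
  have hfs : HasCompactSupport f := hχs.mul_right
  have hfN : ∀ z, |f z| ≤ C * ‖z.2‖ ^ N := fun z => by
    by_cases h : z ∈ tsupport χ
    · have h1 := (hχp z h).2
      rw [Real.norm_of_nonneg (by positivity : 0 ≤ ‖z.2‖ ^ N)] at h1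
      have h2 := hχ01 z
      rw [hfdef, abs_mul, abs_of_nonneg h2.1]
      exact (mul_le_of_le_one_left (abs_nonneg _) h2.2).trans h1
    · simp only [hfdef, image_eq_zero_of_notMem_tsupport h, zero_mul, abs_zero]
      positivity
  obtain ⟨B, hB0, hB⟩ := exists_bound_of_hasCompactSupport_le hf hfs (N + 1)
  set b : Fin 3 → A × Phase := ![(0, (1, 0, 0)), (0, (0, 1, 0)), (0, (0, 0, 1))] with hb
  -- The terms are indexed by words `r` in the three coordinate directions, as in the multilinear
  -- expansion of the `N`-th derivative; equal monomials need not be collected.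
  set c : (Fin N → Fin 3) → A → ℝ := fun r a =>
    (N.factorial : ℝ)⁻¹ * iteratedFDeriv ℝ N f (a, 0) fun i => b (r i) with hc
  set cnt : Fin 3 → (Fin N → Fin 3) → ℕ := fun d r => (Finset.univ.filter fun i => r i = d).card
  refine ⟨c, cnt 0, cnt 1, cnt 2, fun r => ?_, fun r => ?_, ?_⟩
  · have h1 : ContDiff ℝ ∞ fun a : A => iteratedFDeriv ℝ N f (a, 0) :=
      (hf.iteratedFDeriv_right (m := ∞) (by norm_cast)).comp (by fun_prop)
    have h2 : ContDiff ℝ ∞ fun a : A => iteratedFDeriv ℝ N f (a, 0) fun i => b (r i) :=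
      (ContinuousMultilinearMap.apply ℝ (fun _ : Fin N => A × Phase) ℝ fun i => b (r i)).contDiff.comp
        h1
    exact ContDiff.smoothNear (contDiff_const.mul h2)
  · have h := Finset.card_eq_sum_card_fiberwise (f := r) (s := Finset.univ) (t := Finset.univ)
      (fun _ _ => Finset.mem_coe.2 (Finset.mem_univ _))
    rw [Fin.sum_univ_three, Finset.card_univ, Fintype.card_fin] at h
    exact h.symm
  · refine IsBigO.of_bound B ?_
    filter_upwards [hχ1] with z hz
    set w : A × Phase := (0, z.2) with hw
    have hwn : ‖w‖ = ‖z.2‖ := by rw [hw, Prod.norm_mk, norm_zero, max_eq_right (norm_nonneg _)]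
    -- Along this segment the derivatives of order below `N` vanish at `t = 0` by flatness, and
    -- Taylor's formula at `t = 1` leaves the term of order `N` and a remainder with the factor
    -- `‖z.2‖ ^ (N + 1)`.
    set g : ℝ → ℝ := fun t => f ((z.1, 0) + t • w) with hg
    have hgs : ContDiff ℝ ∞ g := by fun_prop
    have hgj : ∀ j ≤ N + 1, ∀ t, |iteratedDeriv j g t| ≤ B * ‖z.2‖ ^ j := fun j hj t => by
      rw [hg, iteratedDeriv_line hf]
      refine ((iteratedFDeriv ℝ j f _).le_opNorm fun _ => w).trans ?_
      simp only [Finset.prod_const, Finset.card_univ, Fintype.card_fin, hwn]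
      gcongr
      exact hB j hj _
    have hg0 := iteratedDeriv_zero_eq_zero_of_flat hgs (N := N) (C := C * ‖z.2‖ ^ N)
      (fun j hj => ⟨_, hgj j (by omega)⟩) (fun t => by
        refine (hfN _).trans ?_
        simp [hw, norm_smul, mul_pow]
        ring_nf
        rfl)
    have h1 := abs_sub_taylor_le (N + 1) hgs (hgj (N + 1) le_rfl) 1
    rw [Finset.sum_range_succ, Finset.sum_eq_zero (fun j hj => by
      rw [hg0 j (Finset.mem_range.1 hj), mul_zero])] at h1
    have e1 : g 1 = e z := by simp [hg, hw, hfdef, hz]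
    have e2 : w = ∑ d, (![z.2.1, z.2.2.1, z.2.2.2] d) • b d := by
      simp [hw, hb, Fin.sum_univ_three]
    have e3 : iteratedDeriv N g 0 = ∑ r : Fin N → Fin 3,
        mono (cnt 0 r) (cnt 1 r) (cnt 2 r) z.2 * iteratedFDeriv ℝ N f (z.1, 0) fun i => b (r i) := by
      rw [hg, iteratedDeriv_line hf, zero_smul, add_zero]
      have e4 : (fun _ : Fin N => w) = fun _ => ∑ d, (![z.2.1, z.2.2.1, z.2.2.2] d) • b d :=
        funext fun _ => e2
      rw [e4, ContinuousMultilinearMap.map_sum]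
      refine Finset.sum_congr rfl fun r _ => ?_
      rw [ContinuousMultilinearMap.map_smul_univ, smul_eq_mul]
      congr 1
      rw [← Finset.prod_fiberwise (s := Finset.univ) (g := r), Fin.prod_univ_three]
      have : ∀ d, ∏ i with r i = d, ![z.2.1, z.2.2.1, z.2.2.2] (r i) =
          (![z.2.1, z.2.2.1, z.2.2.2] d) ^ cnt d r := fun d => by
        rw [Finset.prod_congr rfl (g := fun _ => ![z.2.1, z.2.2.1, z.2.2.2] d), Finset.prod_const]
        intro i hi
        rw [(Finset.mem_filter.1 hi).2]
      simp [this, mono]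
    rw [e1, e3, zero_add, one_pow, Finset.mul_sum, abs_one, one_pow, mul_one] at h1
    rw [Real.norm_eq_abs, norm_pow, norm_norm]
    refine le_of_eq_of_le ?_ h1
    congr 2
    refine Finset.sum_congr rfl fun r _ => ?_
    simp only [hc]
    ring

/-- A formal normalization up to order `N`. -/
theorem exists_formal_normalization [FiniteDimensional ℝ A] (hFs : SmoothNear F) (hF : Ord 2 F)
    (N : ℕ) : ∃ T P : A × Phase → ℝ, SmoothNear T ∧ (Ord 2 fun z => T z - z.2.2.2) ∧
      NormalForm σ₀ (N + 2) P ∧ Ord (N + 2) (defect σ₀ s F T P) := by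
  induction N with
  | zero =>
    -- For `T = y` and `P = 0` the defect is `F` itself.
    refine ⟨fun z => z.2.2.2, fun _ => 0, ContDiff.smoothNear (by fun_prop),
      by simpa [Ord] using isBigO_zero _ _, .zero, hF.congr (Eventually.of_forall fun z => ?_)⟩
    have : HasFDerivAt (fun z : A × Phase => z.2.2.2) ((ContinuousLinearMap.snd ℝ ℝ ℝ) ∘L
        (ContinuousLinearMap.snd ℝ ℝ (ℝ × ℝ)) ∘L ContinuousLinearMap.snd ℝ A Phase) z :=
      ContinuousLinearMap.hasFDerivAt ((ContinuousLinearMap.snd ℝ ℝ ℝ) ∘L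
        (ContinuousLinearMap.snd ℝ ℝ (ℝ × ℝ)) ∘L ContinuousLinearMap.snd ℝ A Phase)
    rw [defect, this.fderiv, saddleField_detuned]
    simp
    ring
  | succ N ih =>
    obtain ⟨T, P, hT, hTy, hP, hd⟩ := ih
    obtain ⟨c, I, J, L, hc, hIJL, h⟩ := exists_taylor_term (smoothNear_defect hFs hT
      ((ord_one_of_sub_y hTy).eq_zero one_ne_zero) hP.smoothNear) hd
    obtain ⟨T', P', hT', hT'y, hP', h'⟩ := exists_correction (s := s) (by omega) hF Finset.univ hc
      I J L hIJL hT hTy hP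
    exact ⟨T', P', hT', hT'y, hP'.of_le (by omega),
      (h.add h').congr (Eventually.of_forall fun z => by ring)⟩

end Formal

/-! ### Local inverses which are smooth near the origin. -/

section LocalInverse

variable {E : Type} [NormedAddCommGroup E] [NormedSpace ℝ E] [CompleteSpace E]

/-- Smoothness of the inverse on a whole neighbourhood follows because invertible operators form an
open set and the derivative is continuous. -/
theorem exists_smooth_local_inverse {Θ : E → E} (hΘ : SmoothNear Θ) (h0 : Θ 0 = 0)
    (hd : HasFDerivAt Θ (ContinuousLinearMap.id ℝ E) 0) :
    ∃ Ψ : E → E, SmoothNear Ψ ∧ Ψ 0 = 0 ∧ (∀ᶠ z in 𝓝 0, Ψ (Θ z) = z) ∧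
      ∀ᶠ w in 𝓝 0, Θ (Ψ w) = w := by
  have hd' : HasFDerivAt Θ ((ContinuousLinearEquiv.refl ℝ E : E ≃L[ℝ] E) : E →L[ℝ] E) 0 := hd
  set e := hΘ.self_of_nhds.toOpenPartialHomeomorph Θ hd' (by simp) with he
  have hcoe : ⇑e = Θ := ContDiffAt.toOpenPartialHomeomorph_coe _ hd' _
  have hsrc : (0 : E) ∈ e.source := ContDiffAt.mem_toOpenPartialHomeomorph_source _ hd' _
  have htgt : (0 : E) ∈ e.target := by
    have := e.map_source hsrc
    rwa [hcoe, h0] at this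
  have hs0 : e.symm 0 = 0 := by
    have := e.left_inv hsrc
    rwa [hcoe, h0] at this
  have hst : Tendsto e.symm (𝓝 0) (𝓝 0) := by
    have := (e.symm.continuousAt (x := 0) htgt).tendsto
    rwa [hs0] at this
  have hinv : ∀ᶠ z in 𝓝 (0 : E), fderiv ℝ Θ z ∈ range ((↑) : (E ≃L[ℝ] E) → E →L[ℝ] E) := by
    have hc : ContinuousAt (fderiv ℝ Θ) 0 :=
      (hΘ.self_of_nhds.fderiv_right (m := ∞) (by simp)).continuousAt
    refine hc.eventually_mem ?_
    rw [hd'.fderiv]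
    exact ContinuousLinearEquiv.nhds _
  refine ⟨e.symm, ?_, hs0, ?_, ?_⟩
  · filter_upwards [e.open_target.mem_nhds htgt, hst.eventually hinv, hst.eventually hΘ]
      with w hw ⟨f, hf⟩ hw2
    refine e.contDiffAt_symm (f₀' := f) hw ?_ (by rwa [hcoe])
    rw [hcoe, hf]
    exact (hw2.differentiableAt (by simp)).hasFDerivAt
  · filter_upwards [e.open_source.mem_nhds hsrc] with z hz
    rw [← hcoe]
    exact e.left_inv hz
  · filter_upwards [e.open_target.mem_nhds htgt] with z hz
    rw [← hcoe]
    exact e.right_inv hz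

end LocalInverse

/-! ### Formal and flat normalizations combined. -/

section Normalization

/-- Normalization of a family of saddles, with the parameters as additional variables. -/
theorem exists_normalization {k : ℕ} (hk : 1 ≤ k) {σ₀ : ℝ} (hσ : 0 < σ₀) :
    ∃ N : ℕ, ∀ {A : Type} [NormedAddCommGroup A] [NormedSpace ℝ A] [FiniteDimensional ℝ A]
      (s : A →L[ℝ] ℝ) {F : A × Phase → ℝ} (_ : SmoothNear F) (_ : Ord 2 F),
      ∃ (Θ : A × Phase → A × Phase) (P : A × Phase → ℝ), (∀ᶠ z in 𝓝 0, ContDiffAt ℝ k Θ z) ∧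
        FiberedNear Θ ∧ ((fun z => Θ z - z) =O[𝓝 0] fun z => ‖z.2‖ ^ 2) ∧ NormalForm σ₀ N P ∧
        ConjNear Θ (saddleField σ₀ (detuned s F)) (saddleField σ₀ (detuned s P)) := by
  obtain ⟨N, hN2, hN⟩ := exists_flat_removal hk hσ
  refine ⟨N, fun {A} _ _ _ s F hFs hF => ?_⟩
  have : CompleteSpace (A × Phase) := FiniteDimensional.complete ℝ _
  obtain ⟨T, P, hT, hTy, hP, hd⟩ := exists_formal_normalization (σ₀ := σ₀) (s := s) hFs hF (N - 2)
  rw [Nat.sub_add_cancel hN2] at hP hd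
  set Θ : A × Phase → A × Phase := fun z => (z.1, (z.2.1, z.2.2.1, T z)) with hΘ
  have hT0 : T 0 = 0 := (ord_one_of_sub_y hTy).eq_zero one_ne_zero
  have hΘ0 : Θ 0 = 0 := by
    simp only [hΘ, hT0]
    rfl
  have hΘs : SmoothNear Θ := by
    filter_upwards [hT] with z hz
    fun_prop
  have hΘy : ∀ z, Θ z - z = embedY A (T z - z.2.2.2) := fun z => by
    ext <;> simp [hΘ]
  have hΘid : (fun z => Θ z - z) =O[𝓝 0] fun z => ‖z.2‖ ^ 2 := by
    simp_rw [hΘy]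
    exact ((embedY A).isBigO_comp _ _).trans hTy
  have hΘd : HasFDerivAt Θ (ContinuousLinearMap.id ℝ (A × Phase)) 0 := by
    have h1 : (fun z => Θ z - z) =O[𝓝 0] fun z => ‖z‖ ^ 2 :=
      hΘid.trans ((IsBigO.of_bound 1 (Eventually.of_forall fun z => by
        simpa using norm_snd_le z)).pow 2)
    have h2 := (hasFDerivAt_zero_of_isBigO h1).fun_add (hasFDerivAt_id (0 : A × Phase))
    simpa using h2
  obtain ⟨Ψ, hΨs, hΨ0, hΨΘ, hΘΨ⟩ := exists_smooth_local_inverse hΘs hΘ0 hΘd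
  have hΨt : Tendsto Ψ (𝓝 0) (𝓝 0) := by
    have := hΨs.self_of_nhds.continuousAt.tendsto
    rwa [hΨ0] at this
  have hΘt : Tendsto Θ (𝓝 0) (𝓝 0) := tendsto_of_sub_isBigO hΘid
  -- In the coordinate `T` the nonlinearity is exactly `detuned s P` plus the defect, rewritten in
  -- the new coordinates by the inverse `Ψ`.
  set R : A × Phase → ℝ := fun w => defect σ₀ s F T P (Ψ w) with hR
  have hRs : SmoothNear R := by
    filter_upwards [hΨs, hΨt.eventually (smoothNear_defect (s := s) (σ₀ := σ₀) hFs hT hT0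
      hP.smoothNear)] with w h1 h2 using h2.comp w h1
  -- Since `Θ - id` is quadratic in the phase variables, `‖(Ψ w).2‖ ≤ 2 ‖w.2‖` near the origin, and
  -- the defect keeps its order after the substitution.
  have hΨ2 : (fun w => (Ψ w).2) =O[𝓝 0] fun w => w.2 := by
    obtain ⟨C, hC⟩ := hΘid.bound
    have hsmall : ∀ᶠ z in 𝓝 (0 : A × Phase), C * ‖z.2‖ < 1 / 2 := by
      have : Continuous fun z : A × Phase => C * ‖z.2‖ := by fun_prop
      exact (this.tendsto 0).eventually (gt_mem_nhds (by simp))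
    refine IsBigO.of_bound 2 ?_
    filter_upwards [hΨt.eventually hC, hΨt.eventually hsmall, hΘΨ] with w h1 h2 h3
    rw [h3, norm_pow, norm_norm] at h1
    have h4 : ‖w.2 - (Ψ w).2‖ ≤ ‖w - Ψ w‖ := norm_snd_le (w - Ψ w)
    have h5 : ‖(Ψ w).2‖ ≤ ‖w.2‖ + ‖w.2 - (Ψ w).2‖ := by
      have := norm_sub_le w.2 (w.2 - (Ψ w).2)
      rwa [sub_sub_cancel] at this
    nlinarith [norm_nonneg (Ψ w).2]
  have hRN : R =O[𝓝 0] fun z => ‖z.2‖ ^ N :=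
    (IsBigO.comp_tendsto hd hΨt).trans (hΨ2.norm_norm.pow N)
  have hl : ContDiff ℝ ∞ fun z : A × Phase => s z.1 * z.2.2.2 := by fun_prop
  -- The detuning term is only linear in the phase variables, but it is quadratic jointly with the
  -- parameters; the flat removal asks no more than this and the vanishing on `v = y = 0`.
  have hld : HasFDerivAt (fun z : A × Phase => s z.1 * z.2.2.2) (0 : A × Phase →L[ℝ] ℝ) 0 := by
    refine hasFDerivAt_zero_of_isBigO ?_
    have h1 : (fun z : A × Phase => s z.1) =O[𝓝 0] fun z => ‖z‖ :=
      ((s.isBigO_comp _ _).trans isBigO_fst_prod').norm_right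
    have h2 : (fun z : A × Phase => z.2.2.2) =O[𝓝 0] fun z => ‖z‖ :=
      IsBigO.of_bound 1 (Eventually.of_forall fun z => by
        simpa using ((norm_snd_le z.2.2).trans (norm_snd_le z.2)).trans (norm_snd_le z))
    simpa [pow_two] using h1.mul h2
  have hPd : HasFDerivAt P (0 : A × Phase →L[ℝ] ℝ) 0 := by
    refine hasFDerivAt_zero_of_isBigO ?_
    exact IsBigO.trans hP.ord ((IsBigO.of_bound 1 (Eventually.of_forall fun z => by
        simpa using norm_snd_le z)).pow 2)
  obtain ⟨Θ₂, hΘ₂, hΘ₂π, hΘ₂id, hΘ₂c⟩ := hN (P := detuned s P) (R := R)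
    (by filter_upwards [hP.smoothNear] with z hz using hz.sub hl.contDiffAt) hRs
    (by simp [detuned, hP.ord.eq_zero])
    (by
      have := (hPd.fun_sub hld).fderiv
      rwa [sub_zero] at this)
    (Eventually.of_forall fun z hz => by simp [detuned, hP.eq_zero_of_stable hσ z hz, hz]) hRN
  have hc : ConjNear Θ (saddleField σ₀ (detuned s F))
      (saddleField σ₀ fun z => detuned s P z + R z) := by
    filter_upwards [hΨΘ, hT] with z h1 h2
    have h3 : HasFDerivAt Θ ((ContinuousLinearMap.fst ℝ A Phase).prod
        (((ContinuousLinearMap.fst ℝ ℝ (ℝ × ℝ)) ∘L ContinuousLinearMap.snd ℝ A Phase).prod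
        (((ContinuousLinearMap.fst ℝ ℝ ℝ) ∘L (ContinuousLinearMap.snd ℝ ℝ (ℝ × ℝ)) ∘L
        ContinuousLinearMap.snd ℝ A Phase).prod (fderiv ℝ T z)))) z :=
      (ContinuousLinearMap.hasFDerivAt (ContinuousLinearMap.fst ℝ A Phase)).prodMk ((ContinuousLinearMap.hasFDerivAt
        ((ContinuousLinearMap.fst ℝ ℝ (ℝ × ℝ)) ∘L ContinuousLinearMap.snd ℝ A Phase)).prodMk
        ((ContinuousLinearMap.hasFDerivAt ((ContinuousLinearMap.fst ℝ ℝ ℝ) ∘L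
        (ContinuousLinearMap.snd ℝ ℝ (ℝ × ℝ)) ∘L ContinuousLinearMap.snd ℝ A Phase)).prodMk
        (h2.differentiableAt (by simp)).hasFDerivAt))
    rw [h3.fderiv, saddleField_apply σ₀ (fun z => detuned s P z + R z)]
    simp only [hR, h1, detuned]
    simp only [defect]
    rw [saddleField_detuned]
    simp only [ContinuousLinearMap.prod_apply, ContinuousLinearMap.comp_apply,
      ContinuousLinearMap.coe_fst', ContinuousLinearMap.coe_snd', hΘ]
    congr 3
    ring
  have hk0 : (k : WithTop ℕ∞) ≠ 0 := by exact_mod_cast Nat.one_le_iff_ne_zero.1 hk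
  refine ⟨fun z => Θ₂ (Θ z), P, ?_, fiberedNear_comp hΘt (Eventually.of_forall fun z => rfl) hΘ₂π,
    comp_sub_isBigO hΘid hΘ₂id, hP, conjNear_comp ?_ (hΘ₂.differentiable hk0) hΘt hc hΘ₂c⟩
  · filter_upwards [hΘs] with z hz
    exact hΘ₂.contDiffAt.comp z (hz.of_le (by exact_mod_cast le_top))
  · filter_upwards [hΘs] with z hz using hz.differentiableAt (by simp)

end Normalization

/-! ### From resonant monomials to the two polynomial normal forms. -/

section Polynomials

open MvPolynomial in
theorem irrationalForm_eq (σ : ℝ) (φ : Polynomial ℝ) :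
    irrationalForm σ φ = irrationalForm 0 φ - C σ * X 2 := by
  simp only [irrationalForm, C_0]
  ring

open MvPolynomial in
theorem rationalForm_eq (p q : ℕ) (σ : ℝ) (φ : Polynomial ℝ) (Φ : MvPolynomial (Fin 2) ℝ)
    (η : Polynomial ℝ) : rationalForm p q σ φ Φ η = rationalForm p q 0 φ Φ η - C σ * X 2 := by
  simp only [rationalForm, C_0]
  ring

open MvPolynomial in
theorem rationalForm_zero_right (p q : ℕ) (σ : ℝ) (φ : Polynomial ℝ) :
    rationalForm p q σ φ 0 0 = irrationalForm σ φ := by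
  simp [rationalForm, irrationalForm]

open MvPolynomial in
theorem totalDegree_sub_C_mul_X_le {N : ℕ} {Q : MvPolynomial (Fin 3) ℝ} (hQ : Q.totalDegree ≤ N)
    (σ : ℝ) : (Q - C σ * X 2).totalDegree ≤ N + 1 := by
  refine (totalDegree_sub _ _).trans (max_le (by omega) ((totalDegree_mul _ _).trans ?_))
  simp

open MvPolynomial in
/-- The monomial `c * u ^ i * v ^ j * Y ^ l`. -/
def monoPoly (c : ℝ) (i j l : ℕ) : MvPolynomial (Fin 3) ℝ := C c * X 0 ^ i * X 1 ^ j * X 2 ^ l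

open MvPolynomial in
theorem totalDegree_monoPoly_le (c : ℝ) (i j l : ℕ) : (monoPoly c i j l).totalDegree ≤ i + j + l := by
  unfold monoPoly
  refine (totalDegree_mul _ _).trans (add_le_add ((totalDegree_mul _ _).trans (add_le_add
    ((totalDegree_mul _ _).trans ?_) ?_)) ?_)
  · simp [totalDegree_X_pow]
  · simp [totalDegree_X_pow]
  · simp [totalDegree_X_pow]

open MvPolynomial in
theorem eval_monoPoly (c : ℝ) (i j l : ℕ) (w : Phase) :
    eval ![w.1, w.2.1, w.2.2] (monoPoly c i j l) = c * mono i j l w := by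
  simp [monoPoly, mono, mul_assoc]

/-- With its two companions this shows which of `φ`, `Φ`, `η` absorbs each type of resonant
monomial; `φ` enters the form with a minus sign, hence the subtraction. -/
theorem rationalForm_sub_monomial (p q : ℕ) (φ : Polynomial ℝ) (Φ : MvPolynomial (Fin 2) ℝ)
    (η : Polynomial ℝ) (c : ℝ) (j : ℕ) :
    rationalForm p q 0 (φ - Polynomial.C c * Polynomial.X ^ j) Φ η =
      rationalForm p q 0 φ Φ η + monoPoly c j j 1 := by
  simp only [rationalForm, monoPoly, map_sub, map_mul, map_pow, Polynomial.aeval_X,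
    Polynomial.aeval_C, MvPolynomial.algebraMap_eq, nu, mul_pow]
  ring

theorem rationalForm_add_monomial₂ (p q : ℕ) (φ : Polynomial ℝ) (Φ : MvPolynomial (Fin 2) ℝ)
    (η : Polynomial ℝ) (c : ℝ) (j m : ℕ) :
    rationalForm p q 0 φ (Φ + MvPolynomial.C c * (MvPolynomial.X 0 ^ j * MvPolynomial.X 1 ^ m)) η =
      rationalForm p q 0 φ Φ η + monoPoly c (j + p * m) j (q * m + 1) := by
  simp only [rationalForm, monoPoly, map_add, map_mul, map_pow, MvPolynomial.aeval_X,
    MvPolynomial.aeval_C, MvPolynomial.algebraMap_eq, nu, mul_pow, Matrix.cons_val_zero,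
    Matrix.cons_val_one, pow_add, pow_mul]
  ring

theorem rationalForm_add_monomial (p q : ℕ) (φ : Polynomial ℝ) (Φ : MvPolynomial (Fin 2) ℝ)
    (η : Polynomial ℝ) (c : ℝ) (i : ℕ) :
    rationalForm p q 0 φ Φ (η + Polynomial.C c * Polynomial.X ^ i) =
      rationalForm p q 0 φ Φ η + monoPoly c i (i + p) 0 := by
  simp only [rationalForm, monoPoly, map_add, map_mul, map_pow, Polynomial.aeval_X,
    Polynomial.aeval_C, MvPolynomial.algebraMap_eq, nu, mul_pow, pow_add]
  ring

/-- The resonances of a saddle with an irrational ratio of eigenvalues. -/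
theorem resonance_of_irrational {σ₀ : ℝ} (hσ : Irrational σ₀) {i j l : ℕ}
    (h : (i : ℝ) - j = σ₀ * (l - 1)) : i = j ∧ l = 1 := by
  by_cases hl : l = 1
  · subst hl
    norm_num [sub_eq_zero] at h
    exact ⟨h, rfl⟩
  · exfalso
    have h1 : ((l : ℤ) - 1 : ℤ) ≠ 0 := by omega
    refine (hσ.mul_intCast h1).ne_int ((i : ℤ) - j) ?_
    push_cast
    linarith

/-- The resonances of a saddle with a rational ratio of eigenvalues. -/
theorem resonance_of_rational {p q : ℕ} (hq : 0 < q) (hpq : p.Coprime q) {i j l : ℕ}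
    (h : (i : ℝ) - j = (p / q : ℝ) * (l - 1)) :
    (l = 0 ∧ q = 1 ∧ j = i + p) ∨ ∃ m, i = j + p * m ∧ l = q * m + 1 := by
  have hq' : (q : ℝ) ≠ 0 := by positivity
  have h1 : (q : ℝ) * (i - j) = p * (l - 1) := by
    rw [h]
    field_simp
  rcases Nat.eq_zero_or_pos l with rfl | hl
  · left
    have h2 : q * j = q * i + p := by
      have : (q * j : ℝ) = q * i + p := by
        push_cast at h1
        linarith
      exact_mod_cast this
    -- A resonant term free of `Y` forces `q ∣ p`, hence `q = 1`; this is why `η` vanishes for `q ≠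
    -- 1`.
    have h3 : q ∣ p := (Nat.dvd_add_right (Dvd.intro i rfl)).1 (h2 ▸ Dvd.intro j rfl)
    have h4 : q = 1 := Nat.dvd_one.1 (hpq ▸ Nat.dvd_gcd h3 dvd_rfl)
    subst h4
    exact ⟨rfl, rfl, by omega⟩
  · right
    obtain ⟨l, rfl⟩ := Nat.exists_eq_add_of_le' hl
    have h2 : q * i = q * j + p * l := by
      have : (q * i : ℝ) = q * j + p * l := by
        push_cast at h1
        linarith
      exact_mod_cast this
    have h3 : q ∣ p * l := (Nat.dvd_add_right (Dvd.intro j rfl)).1 (h2 ▸ Dvd.intro i rfl)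
    obtain ⟨m, rfl⟩ := hpq.symm.dvd_of_dvd_mul_left h3
    refine ⟨m, Nat.eq_of_mul_eq_mul_left hq ?_, rfl⟩
    rw [h2]
    ring

variable {A : Type} [NormedAddCommGroup A] [NormedSpace ℝ A]

theorem NormalForm.exists_irrationalForm {σ₀ : ℝ} (hσ : Irrational σ₀) {N : ℕ}
    {P : A × Phase → ℝ} (hP : NormalForm σ₀ N P) : ∃ φ : A → Polynomial ℝ,
      (∀ a, (φ a).natDegree ≤ N) ∧ (∀ᶠ a in 𝓝 0, ∀ i, ContDiffAt ℝ ∞ (fun a => (φ a).coeff i) a) ∧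
      (∀ a, (irrationalForm 0 (φ a)).totalDegree ≤ N) ∧
      ∀ a (w : Phase), MvPolynomial.eval ![w.1, w.2.1, w.2.2] (irrationalForm 0 (φ a)) = P (a, w) := by
  induction hP with
  | zero =>
    refine ⟨fun _ => 0, by simp, ?_, ?_, ?_⟩
    · simpa using Eventually.of_forall fun _ => contDiffAt_const
    · simp [irrationalForm]
    · simp [irrationalForm]
  | @add P c i j l _ hc _ hN hr ih =>
    obtain ⟨rfl, rfl⟩ := resonance_of_irrational hσ hr
    obtain ⟨φ, h1, h2, h3, h4⟩ := ih
    have e : ∀ a, irrationalForm 0 (φ a - Polynomial.C (c a) * Polynomial.X ^ i) =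
        irrationalForm 0 (φ a) + monoPoly (c a) i i 1 := fun a => by
      simpa only [rationalForm_zero_right] using rationalForm_sub_monomial 0 0 (φ a) 0 0 (c a) i
    refine ⟨fun a => φ a - Polynomial.C (c a) * Polynomial.X ^ i, fun a => ?_, ?_, fun a => ?_,
      fun a w => ?_⟩
    · exact (Polynomial.natDegree_sub_le _ _).trans (max_le (h1 a)
        ((Polynomial.natDegree_C_mul_X_pow_le _ _).trans (by omega)))
    · filter_upwards [h2, hc] with a ha1 ha2 d
      simp only [Polynomial.coeff_sub, Polynomial.coeff_C_mul]
      exact (ha1 d).sub (ha2.mul contDiffAt_const)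
    · rw [e]
      exact (MvPolynomial.totalDegree_add _ _).trans (max_le (h3 a)
        ((totalDegree_monoPoly_le _ _ _ _).trans hN))
    · rw [e, map_add, h4, eval_monoPoly]

theorem NormalForm.exists_rationalForm {p q : ℕ} (hq : 0 < q) (hpq : p.Coprime q) {σ₀ : ℝ}
    (hσ : σ₀ = p / q) {N : ℕ} {P : A × Phase → ℝ} (hP : NormalForm σ₀ N P) :
    ∃ (φ : A → Polynomial ℝ) (Φ : A → MvPolynomial (Fin 2) ℝ) (η : A → Polynomial ℝ),
      (∀ a, (φ a).natDegree ≤ N ∧ (Φ a).totalDegree ≤ N ∧ (η a).natDegree ≤ N) ∧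
      (∀ᶠ a in 𝓝 0, (∀ i, ContDiffAt ℝ ∞ (fun a => (φ a).coeff i) a) ∧
        (∀ i, ContDiffAt ℝ ∞ (fun a => (Φ a).coeff i) a) ∧
        ∀ i, ContDiffAt ℝ ∞ (fun a => (η a).coeff i) a) ∧
      (∀ a, ∀ ν : ℝ, MvPolynomial.eval ![ν, 0] (Φ a) = 0) ∧ (q ≠ 1 → ∀ a, η a = 0) ∧
      (∀ a, (rationalForm p q 0 (φ a) (Φ a) (η a)).totalDegree ≤ N) ∧
      ∀ a (w : Phase), MvPolynomial.eval ![w.1, w.2.1, w.2.2]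
        (rationalForm p q 0 (φ a) (Φ a) (η a)) = P (a, w) := by
  subst hσ
  induction hP with
  | zero =>
    refine ⟨fun _ => 0, fun _ => 0, fun _ => 0, by simp, ?_, by simp, by simp, ?_, ?_⟩
    · simpa using Eventually.of_forall fun _ => contDiffAt_const
    · simp [rationalForm]
    · simp [rationalForm]
  | @add P c i j l _ hc _ hN hr ih =>
    obtain ⟨φ, Φ, η, h1, h2, h3, h4, h5, h6⟩ := ih
    have key : ∀ {Q : MvPolynomial (Fin 3) ℝ} {a : A}, Q = rationalForm p q 0 (φ a) (Φ a) (η a) +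
        monoPoly (c a) i j l → Q.totalDegree ≤ N ∧ ∀ w : Phase,
        MvPolynomial.eval ![w.1, w.2.1, w.2.2] Q = P (a, w) + c a * mono i j l w := by
      rintro _ a rfl
      exact ⟨(MvPolynomial.totalDegree_add _ _).trans (max_le (h5 a)
        ((totalDegree_monoPoly_le _ _ _ _).trans hN)), fun w => by rw [map_add, h6, eval_monoPoly]⟩
    have hdeg : ∀ (x : ℝ) (d : ℕ), d ≤ N →
        (Polynomial.C x * Polynomial.X ^ d).natDegree ≤ N := fun x d hd =>
      (Polynomial.natDegree_C_mul_X_pow_le _ _).trans hd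
    have hsm : ∀ᶠ a in 𝓝 0, ∀ x : ℝ, ContDiffAt ℝ ∞ (fun a => c a * x) a := by
      filter_upwards [hc] with a ha x using ha.mul contDiffAt_const
    rcases resonance_of_rational hq hpq hr with ⟨rfl, hq1, rfl⟩ | ⟨m, rfl, rfl⟩
    · have e := fun a => rationalForm_add_monomial p q (φ a) (Φ a) (η a) (c a) i
      refine ⟨φ, Φ, fun a => η a + Polynomial.C (c a) * Polynomial.X ^ i, fun a =>
        ⟨(h1 a).1, (h1 a).2.1, (Polynomial.natDegree_add_le _ _).trans (max_le (h1 a).2.2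
          (hdeg _ _ (by omega)))⟩, ?_, h3, fun h => absurd hq1 h, fun a => (key (e a)).1,
        fun a => (key (e a)).2⟩
      filter_upwards [h2, hsm] with a ha1 ha2
      refine ⟨ha1.1, ha1.2.1, fun d => ?_⟩
      simp only [Polynomial.coeff_add, Polynomial.coeff_C_mul]
      exact (ha1.2.2 d).add (ha2 _)
    -- Monomials with `m = 0` go to `φ`, so those in `Φ` contain a positive power of the second
    -- variable and `Φ(ν, 0) = 0`.
    · rcases Nat.eq_zero_or_pos m with rfl | hm
      · have e := fun a => rationalForm_sub_monomial p q (φ a) (Φ a) (η a) (c a) j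
        refine ⟨fun a => φ a - Polynomial.C (c a) * Polynomial.X ^ j, Φ, η, fun a =>
          ⟨(Polynomial.natDegree_sub_le _ _).trans (max_le (h1 a).1 (hdeg _ _ (by omega))),
            (h1 a).2⟩, ?_, h3, h4, fun a => (key (e a)).1, fun a => (key (e a)).2⟩
        filter_upwards [h2, hsm] with a ha1 ha2
        refine ⟨fun d => ?_, ha1.2⟩
        simp only [Polynomial.coeff_sub, Polynomial.coeff_C_mul]
        exact (ha1.1 d).sub (ha2 _)
      · have e := fun a => rationalForm_add_monomial₂ p q (φ a) (Φ a) (η a) (c a) j m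
        have hqm : m ≤ q * m := Nat.le_mul_of_pos_left m hq
        refine ⟨φ, fun a => Φ a + MvPolynomial.C (c a) *
          (MvPolynomial.X 0 ^ j * MvPolynomial.X 1 ^ m), η, fun a =>
          ⟨(h1 a).1, (MvPolynomial.totalDegree_add _ _).trans (max_le (h1 a).2.1 ?_), (h1 a).2.2⟩,
          ?_, fun a ν => ?_, h4, fun a => (key (e a)).1, fun a => (key (e a)).2⟩
        · refine (MvPolynomial.totalDegree_mul _ _).trans ?_
          rw [MvPolynomial.totalDegree_C, zero_add]
          refine (MvPolynomial.totalDegree_mul _ _).trans ?_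
          rw [MvPolynomial.totalDegree_X_pow, MvPolynomial.totalDegree_X_pow]
          omega
        · filter_upwards [h2, hsm] with a ha1 ha2
          refine ⟨ha1.1, fun d => ?_, ha1.2.2⟩
          simp only [MvPolynomial.coeff_add, MvPolynomial.coeff_C_mul]
          exact (ha1.2.1 d).add (ha2 _)
        · simp [h3, hm.ne']

/-- Both cases at once, with a neighbourhood in parameter space which serves all coefficients. -/
theorem NormalForm.exists_forms {σ₀ : ℝ} {N : ℕ} {P : A × Phase → ℝ} (hP : NormalForm σ₀ N P) :
    ∃ T ∈ 𝓝 (0 : A), (Irrational σ₀ → ∃ φ : A → Polynomial ℝ,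
      (∀ a, (φ a).natDegree ≤ N) ∧ (∀ a ∈ T, ∀ i, ContDiffAt ℝ ∞ (fun a => (φ a).coeff i) a) ∧
      (∀ a, (irrationalForm 0 (φ a)).totalDegree ≤ N) ∧
      ∀ a (w : Phase), MvPolynomial.eval ![w.1, w.2.1, w.2.2] (irrationalForm 0 (φ a)) = P (a, w)) ∧
    ∀ p q : ℕ, 0 < q → p.Coprime q → σ₀ = p / q →
      ∃ (φ : A → Polynomial ℝ) (Φ : A → MvPolynomial (Fin 2) ℝ) (η : A → Polynomial ℝ),
      (∀ a, (φ a).natDegree ≤ N ∧ (Φ a).totalDegree ≤ N ∧ (η a).natDegree ≤ N) ∧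
      (∀ a ∈ T, (∀ i, ContDiffAt ℝ ∞ (fun a => (φ a).coeff i) a) ∧
        (∀ i, ContDiffAt ℝ ∞ (fun a => (Φ a).coeff i) a) ∧
        ∀ i, ContDiffAt ℝ ∞ (fun a => (η a).coeff i) a) ∧
      (∀ a, ∀ ν : ℝ, MvPolynomial.eval ![ν, 0] (Φ a) = 0) ∧ (q ≠ 1 → ∀ a, η a = 0) ∧
      (∀ a, (rationalForm p q 0 (φ a) (Φ a) (η a)).totalDegree ≤ N) ∧
      ∀ a (w : Phase), MvPolynomial.eval ![w.1, w.2.1, w.2.2]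
        (rationalForm p q 0 (φ a) (Φ a) (η a)) = P (a, w) := by
  by_cases hirr : Irrational σ₀
  · obtain ⟨φ, h1, h2, h3⟩ := hP.exists_irrationalForm hirr
    refine ⟨_, h2, fun _ => ⟨φ, h1, fun a ha => ha, h3⟩, fun p q _ _ h => ?_⟩
    exact absurd ⟨(p / q : ℚ), by rw [h]; push_cast; rfl⟩ hirr
  · by_cases hrat : ∃ p q : ℕ, 0 < q ∧ p.Coprime q ∧ σ₀ = p / q
    · obtain ⟨p, q, hq, hpq, hσ⟩ := hrat
      obtain ⟨φ, Φ, η, h1, h2, h3⟩ := hP.exists_rationalForm hq hpq hσ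
      refine ⟨_, h2, fun h => absurd h hirr, fun p' q' hq' hpq' hσ' => ?_⟩
      -- The reduced fraction is unique, so the neighbourhood found for one pair serves every
      -- admissible pair.
      have h4 : p * q' = p' * q := by
        have h5 : (p / q : ℝ) = p' / q' := hσ ▸ hσ'
        rw [div_eq_div_iff (by positivity) (by positivity)] at h5
        exact_mod_cast h5
      obtain rfl : q = q' := Nat.dvd_antisymm
        (hpq.symm.dvd_of_dvd_mul_left (h4 ▸ Dvd.intro_left p' rfl))
        (hpq'.symm.dvd_of_dvd_mul_left (h4 ▸ Dvd.intro_left p rfl))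
      obtain rfl : p = p' := Nat.eq_of_mul_eq_mul_right hq h4
      exact ⟨φ, Φ, η, h1, fun a ha => ha, h3⟩
    · exact ⟨univ, univ_mem, fun h => absurd h hirr, fun p q hq hpq hσ =>
        absurd ⟨p, q, hq, hpq, hσ⟩ hrat⟩

end Polynomials

/-! ### From normalizing germs to the normalizing operator. -/

section Germ

variable {n : ℕ}

/-- The nonlinearity of a family, with the parameters `(μ - μ₀, σ - σ₀)` as variables. -/
def SaddleFamily.shifted (X : SaddleFamily n) (z : (Param n × ℝ) × Phase) : ℝ :=
  X.F (X.μ₀ + z.1.1) z.2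

theorem SaddleFamily.smoothNear_shifted (X : SaddleFamily n) : SmoothNear X.shifted := by
  have hc : ContDiff ℝ ∞ fun z : (Param n × ℝ) × Phase => (X.μ₀ + z.1.1, z.2) := by fun_prop
  have ht : Tendsto (fun z : (Param n × ℝ) × Phase => (X.μ₀ + z.1.1, z.2)) (𝓝 0)
      (𝓝 (X.μ₀, 0)) := by
    have := hc.continuous.tendsto 0
    simpa using this
  filter_upwards [ht.eventually X.smooth] with z hz
  exact ContDiffAt.comp (g := fun w : Param n × Phase => X.F w.1 w.2) z hz hc.contDiffAt

/-- The assumption on `F` is pointwise in `μ`. It gives a zero value and a zero phase derivative at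
the origin for each nearby parameter; the second derivative, bounded after a cutoff, then yields a
constant uniform in the parameters. -/
theorem SaddleFamily.ord_shifted (X : SaddleFamily n) : Ord 2 X.shifted := by
  obtain ⟨χ, hχ, hχs, hχ1, -, hχp⟩ := exists_cutoff X.smoothNear_shifted
  set f : (Param n × ℝ) × Phase → ℝ := fun z => χ z * X.shifted z with hfdef
  have hf : ContDiff ℝ ∞ f := contDiff_cutoff_mul hχ hχp
  obtain ⟨C, hC⟩ := exists_bound_of_hasCompactSupport hf hχs.mul_right 2
  have hπ : Tendsto (fun z : (Param n × ℝ) × Phase => (z.1, (0 : Phase))) (𝓝 0) (𝓝 0) := by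
    have : Continuous fun z : (Param n × ℝ) × Phase => (z.1, (0 : Phase)) := by fun_prop
    exact this.tendsto 0
  have hμ : Tendsto (fun z : (Param n × ℝ) × Phase => X.μ₀ + z.1.1) (𝓝 0) (𝓝 X.μ₀) := by
    have : Continuous fun z : (Param n × ℝ) × Phase => X.μ₀ + z.1.1 := by fun_prop
    simpa using this.tendsto 0
  refine IsBigO.of_bound C ?_
  filter_upwards [hχ1, hπ.eventually hχ1.eventually_nhds, hμ.eventually X.order_two] with z h1 h2 h3
  have h4 : (fun x : Phase => f (z.1, x)) =ᶠ[𝓝 0] fun x => X.F (X.μ₀ + z.1.1) x := by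
    have : Tendsto (fun x : Phase => (z.1, x)) (𝓝 0) (𝓝 (z.1, 0)) :=
      Continuous.tendsto (by fun_prop) 0
    filter_upwards [this.eventually h2] with x hx
    simp [hfdef, hx, SaddleFamily.shifted]
  have h5 : HasFDerivAt (fun x : Phase => f (z.1, x)) (0 : Phase →L[ℝ] ℝ) 0 :=
    (hasFDerivAt_zero_of_isBigO h3).congr_of_eventuallyEq h4
  have h6 : HasFDerivAt (fun x : Phase => f (z.1, x))
      ((fderiv ℝ f (z.1, 0)).comp (ContinuousLinearMap.inr ℝ (Param n × ℝ) Phase)) 0 :=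
    HasFDerivAt.comp (f := fun x : Phase => (z.1, x)) (0 : Phase)
      (hf.differentiable (by simp) _).hasFDerivAt (hasFDerivAt_prodMk_right z.1 0)
  have h7 : fderiv ℝ f (z.1, 0) (0, z.2) = 0 := DFunLike.congr_fun (h6.unique h5) z.2
  have h8 : f (z.1, 0) = 0 := by
    obtain ⟨C, hC⟩ := h3.bound
    rw [show f (z.1, 0) = X.F (X.μ₀ + z.1.1) 0 from h4.self_of_nhds]
    simpa using hC.self_of_nhds
  have h9 := norm_taylor_one_le (contDiff_infty.1 hf 2) hC (z.1, 0) (0, z.2)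
  rw [h7, h8] at h9
  have e1 : f ((z.1, 0) + (0, z.2)) = X.shifted z := by simp [hfdef, h1]
  have e2 : ‖((0 : Param n × ℝ), z.2)‖ = ‖z.2‖ := by
    rw [Prod.norm_mk, norm_zero, max_eq_right (norm_nonneg _)]
  rw [e1, e2, sub_zero, sub_zero] at h9
  simpa using h9

/-- The map `Θ` represents a normalizing germ of class `C^k`. -/
def IsNormalizingGerm (k N : ℕ) (σ₀ : ℝ) (F : (Param n × ℝ) × Phase → ℝ)
    (Θ : (Param n × ℝ) × Phase → (Param n × ℝ) × Phase) : Prop :=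
  ∃ P : (Param n × ℝ) × Phase → ℝ, (∀ᶠ z in 𝓝 0, ContDiffAt ℝ k Θ z) ∧
    FiberedNear Θ ∧ ((fun z => Θ z - z) =O[𝓝 0] fun z => ‖z.2‖ ^ 2) ∧ NormalForm σ₀ N P ∧
    ConjNear Θ (saddleField σ₀ (detuned (ContinuousLinearMap.snd ℝ (Param n) ℝ) F))
      (saddleField σ₀ (detuned (ContinuousLinearMap.snd ℝ (Param n) ℝ) P))

/-- Equality of predicates, rather than an equivalence for each map, makes `Classical.epsilon`
choose the same map for two representatives of a germ. -/
theorem isNormalizingGerm_congr {k N : ℕ} {σ₀ : ℝ} {F F' : (Param n × ℝ) × Phase → ℝ}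
    (h : F =ᶠ[𝓝 0] F') : IsNormalizingGerm k N σ₀ F = IsNormalizingGerm k N σ₀ F' := by
  have key : ∀ {F F' : (Param n × ℝ) × Phase → ℝ}, F =ᶠ[𝓝 0] F' → ∀ Θ,
      IsNormalizingGerm k N σ₀ F Θ → IsNormalizingGerm k N σ₀ F' Θ := by
    rintro F F' h Θ ⟨P, h1, h2, h3, h4, h5⟩
    refine ⟨P, h1, h2, h3, h4, ?_⟩
    filter_upwards [h5, h] with z hz hF
    rw [← hz]
    simp only [saddleField, detuned, hF]
  funext Θ
  exact propext ⟨key h Θ, key h.symm Θ⟩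

theorem isInvertible_of_norm_sub_id_lt {E : Type} [NormedAddCommGroup E] [NormedSpace ℝ E]
    [CompleteSpace E] {L : E →L[ℝ] E} (h : ‖L - ContinuousLinearMap.id ℝ E‖ < 1) :
    L.IsInvertible := by
  obtain ⟨u, hu⟩ := isUnit_one_sub_of_norm_lt_one (x := 1 - L) (by rw [norm_sub_rev]; exact h)
  rw [sub_sub_cancel] at hu
  exact ⟨ContinuousLinearEquiv.unitsEquiv ℝ E u, hu⟩

/-- The map `G_{μ,σ}(u, v, y)` given by a germ. -/
def germMap (X : SaddleFamily n) (Θ : (Param n × ℝ) × Phase → (Param n × ℝ) × Phase)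
    (μ : Param n) (σ : ℝ) (x : Phase) : ℝ :=
  (Θ ((μ - X.μ₀, σ - X.σ₀), x)).2.2.2

/-- Near the origin `DΘ` is within `1 / 2` of the identity. On each fibre the change of coordinates
is then the identity plus a map with Lipschitz constant `1 / 2`, which gives injectivity and
invertible derivatives; the bound `‖Θ z - z‖ ≤ C ‖z.2‖ ^ 2` fixes the origin and its derivative for
every parameter. -/
theorem exists_normalizes {k N : ℕ} (hk : 1 ≤ k) (X : SaddleFamily n)
    {Θ : (Param n × ℝ) × Phase → (Param n × ℝ) × Phase}
    (hΘ : IsNormalizingGerm k N X.σ₀ X.shifted Θ) :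
    ∃ r : ℝ, Normalization.Normalizes ⟨r, N + 1, r, r, germMap X Θ⟩ X k := by
  obtain ⟨P, hs, hfib, hid, hP, hconj⟩ := hΘ
  have hk0 : (k : WithTop ℕ∞) ≠ 0 := by exact_mod_cast Nat.one_le_iff_ne_zero.1 hk
  obtain ⟨C, hC⟩ := hid.bound
  have hid' : (fun z => Θ z - z) =O[𝓝 0] fun z => ‖z‖ ^ 2 :=
    hid.trans ((IsBigO.of_bound 1 (Eventually.of_forall fun z => by
      simpa using norm_snd_le z)).pow 2)
  have hd0 : fderiv ℝ Θ 0 = ContinuousLinearMap.id ℝ ((Param n × ℝ) × Phase) := by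
    have h2 := (hasFDerivAt_zero_of_isBigO hid').fun_add
      (hasFDerivAt_id (0 : (Param n × ℝ) × Phase))
    simpa using h2.fderiv
  have hd : ∀ᶠ z in 𝓝 0, ‖fderiv ℝ Θ z - ContinuousLinearMap.id ℝ ((Param n × ℝ) × Phase)‖ <
      1 / 2 := by
    have hc : ContinuousAt (fderiv ℝ Θ) 0 :=
      (hs.self_of_nhds.fderiv_right (m := 0) (by simpa using mod_cast hk)).continuousAt
    have := (hc.sub (continuousAt_const
      (y := ContinuousLinearMap.id ℝ ((Param n × ℝ) × Phase)))).norm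
    refine this.eventually (gt_mem_nhds ?_)
    simp [hd0]
  obtain ⟨U, hU, hirr, hrat⟩ := hP.exists_forms
  have hfst := continuous_fst.tendsto (0 : (Param n × ℝ) × Phase)
  obtain ⟨R, hR, hball⟩ := Metric.eventually_nhds_iff_ball.1
    ((hs.and (hfib.and hconj)).and ((hC.and hd).and (hfst.eventually hU)))
  set D : Normalization n := ⟨R / 2, N + 1, R / 2, R / 2, germMap X Θ⟩ with hD
  -- Halving `R` leaves room for the non-strict inequality `|σ - σ₀| ≤ δ`.
  have hmem : ∀ a ∈ D.params X, ∀ x ∈ Metric.ball (0 : Phase) D.η,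
      ((a.1 - X.μ₀, a.2 - X.σ₀), x) ∈ Metric.ball (0 : (Param n × ℝ) × Phase) R := by
    intro a ha x hx
    rw [mem_ball_zero_iff] at hx ⊢
    have h1 : ‖a.1 - X.μ₀‖ < R / 2 := ha.1
    have h2 : ‖a.2 - X.σ₀‖ ≤ R / 2 := ha.2
    have h3 : ‖x‖ < R / 2 := hx
    refine lt_of_le_of_lt (norm_prod_le_iff.2 ⟨norm_prod_le_iff.2 ⟨h1.le, h2⟩, h3.le⟩) ?_
    linarith
  have hR2 : (0 : Phase) ∈ Metric.ball (0 : Phase) D.η := Metric.mem_ball_self (half_pos hR)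
  have hchange : ∀ a ∈ D.params X, ∀ x ∈ Metric.ball (0 : Phase) D.η,
      Θ ((a.1 - X.μ₀, a.2 - X.σ₀), x) = ((a.1 - X.μ₀, a.2 - X.σ₀), D.change a.1 a.2 x) := by
    intro a ha x hx
    have h := (hball _ (hmem a ha x hx)).1.2.1
    simp only [baseProj_apply, Prod.ext_iff] at h
    ext1
    · exact Prod.ext h.1.1 h.1.2
    · exact Prod.ext h.2.1 (Prod.ext h.2.2 rfl)
  have hderiv : ∀ a ∈ D.params X, ∀ x ∈ Metric.ball (0 : Phase) D.η,
      HasFDerivAt (D.change a.1 a.2) ((ContinuousLinearMap.snd ℝ (Param n × ℝ) Phase) ∘L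
        (fderiv ℝ Θ ((a.1 - X.μ₀, a.2 - X.σ₀), x)) ∘L
          ContinuousLinearMap.inr ℝ (Param n × ℝ) Phase) x := by
    intro a ha x hx
    have h1 := ((hball _ (hmem a ha x hx)).1.1.differentiableAt hk0).hasFDerivAt
    have h2 : HasFDerivAt (fun x : Phase => (Θ ((a.1 - X.μ₀, a.2 - X.σ₀), x)).2)
        ((ContinuousLinearMap.snd ℝ (Param n × ℝ) Phase) ∘L
        (fderiv ℝ Θ ((a.1 - X.μ₀, a.2 - X.σ₀), x)) ∘L
          ContinuousLinearMap.inr ℝ (Param n × ℝ) Phase) x :=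
      hasFDerivAt_snd.comp x (h1.comp x (hasFDerivAt_prodMk_right _ x))
    refine h2.congr_of_eventuallyEq ?_
    filter_upwards [Metric.isOpen_ball.mem_nhds hx] with w hw
    rw [hchange a ha w hw]
  have hsmall : ∀ a ∈ D.params X, ∀ x ∈ Metric.ball (0 : Phase) D.η,
      ‖((ContinuousLinearMap.snd ℝ (Param n × ℝ) Phase) ∘L
        (fderiv ℝ Θ ((a.1 - X.μ₀, a.2 - X.σ₀), x)) ∘L
          ContinuousLinearMap.inr ℝ (Param n × ℝ) Phase) - ContinuousLinearMap.id ℝ Phase‖ ≤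
      1 / 2 := by
    intro a ha x hx
    refine ContinuousLinearMap.opNorm_le_bound _ (by norm_num) fun w => ?_
    have h1 := (hball _ (hmem a ha x hx)).2.1.2.le
    set L := fderiv ℝ Θ ((a.1 - X.μ₀, a.2 - X.σ₀), x)
    have h2 := ((L - ContinuousLinearMap.id ℝ _).le_of_opNorm_le h1 (0, w))
    have e : ‖((0 : Param n × ℝ), w)‖ = ‖w‖ := by
      rw [Prod.norm_mk, norm_zero, max_eq_right (norm_nonneg _)]
    rw [e] at h2
    exact (norm_snd_le _).trans h2
  have hbound : ∀ a ∈ D.params X, ∀ x ∈ Metric.ball (0 : Phase) D.η,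
      ‖D.change a.1 a.2 x - x‖ ≤ C * ‖x‖ ^ 2 := by
    intro a ha x hx
    have h1 := (hball _ (hmem a ha x hx)).2.1.1
    rw [hchange a ha x hx, norm_pow, norm_norm] at h1
    exact (norm_snd_le _).trans h1
  have hpow : ∀ {Q : Param n × ℝ → MvPolynomial (Fin 3) ℝ}, (∀ a, (Q a).totalDegree ≤ N) →
      (∀ a (w : Phase), MvPolynomial.eval ![w.1, w.2.1, w.2.2] (Q a) = P (a, w)) →
      D.BringsTo X fun a => Q (a.1 - X.μ₀, a.2 - X.σ₀) - MvPolynomial.C a.2 * MvPolynomial.X 2 := by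
    intro Q hQN hQP a ha
    -- The degree `N + 1` instead of `N` accommodates the linear term `σ Y` even when `N = 0`.
    refine ⟨totalDegree_sub_C_mul_X_le (hQN _) _, fun x hx => ?_⟩
    have h1 := (hball _ (hmem a ha x hx)).1.2.2
    rw [saddleField_detuned, hchange a ha x hx, saddleField_detuned] at h1
    have h2 : ((0 : Param n × ℝ), X.field a.1 a.2 x) = (0, (x.1, -x.2.1,
        -(X.σ₀ + ContinuousLinearMap.snd ℝ (Param n) ℝ (a.1 - X.μ₀, a.2 - X.σ₀)) * x.2.2 +
          X.shifted ((a.1 - X.μ₀, a.2 - X.σ₀), x))) := by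
      simp [SaddleFamily.field, SaddleFamily.shifted]
    rw [(hderiv a ha x hx).fderiv]
    simp only [ContinuousLinearMap.comp_apply, ContinuousLinearMap.inr_apply,
      ContinuousLinearMap.coe_snd'] at h1 ⊢
    rw [h2]
    simp only [ContinuousLinearMap.coe_snd'] at h1 ⊢
    rw [h1, polyField, map_sub, hQP]
    simp only [map_mul, MvPolynomial.eval_C, MvPolynomial.eval_X]
    refine Prod.ext rfl (Prod.ext rfl ?_)
    simp
    ring
  have hcoef : ∀ {c : Param n × ℝ → ℝ}, (∀ a ∈ U, ContDiffAt ℝ ∞ c a) →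
      ContDiffOn ℝ ∞ (fun a : Param n × ℝ => c (a.1 - X.μ₀, a.2 - X.σ₀)) (D.params X) := by
    intro c hc a ha
    have h1 := hc _ (hball _ (hmem a ha 0 hR2)).2.2
    have h2 : ContDiffAt ℝ ∞ (fun a : Param n × ℝ => (a.1 - X.μ₀, a.2 - X.σ₀)) a := by fun_prop
    exact (h1.comp a h2).contDiffWithinAt
  refine ⟨R / 2, half_pos hR, half_pos hR, half_pos hR, ⟨?_, ?_, ?_, ?_, ?_⟩, fun h => ?_,
    fun p q hq hpq hσ => ?_⟩
  · rintro ⟨a, x⟩ ⟨ha, hx⟩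
    have h1 := (hball _ (hmem a ha x hx)).1.1
    have h2 : ContDiffAt ℝ k (fun z : (Param n × ℝ) × Phase =>
      ((z.1.1 - X.μ₀, z.1.2 - X.σ₀), z.2)) (a, x) := by fun_prop
    have h3 : ContDiffAt ℝ k (fun z : (Param n × ℝ) × Phase => z.2.2.2)
      (Θ ((a.1 - X.μ₀, a.2 - X.σ₀), x)) := by fun_prop
    exact (h3.comp (a, x) (h1.comp (a, x) h2)).contDiffWithinAt
  · intro a ha x hx y hy hxy
    have h1 := (convex_ball (0 : Phase) D.η).norm_image_sub_le_of_norm_hasFDerivWithin_le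
      (f := fun x => D.change a.1 a.2 x - x)
      (fun w hw => ((hderiv a ha w hw).sub (hasFDerivAt_id w)).hasFDerivWithinAt)
      (fun w hw => hsmall a ha w hw) hx hy
    rw [hxy, sub_sub_sub_cancel_left, norm_sub_rev] at h1
    have h2 : ‖y - x‖ ≤ 0 := by linarith
    exact (sub_eq_zero.1 (norm_le_zero_iff.1 h2)).symm
  · intro a ha x hx
    rw [(hderiv a ha x hx).fderiv]
    exact isInvertible_of_norm_sub_id_lt ((hsmall a ha x hx).trans_lt (by norm_num))
  · intro a ha
    have h1 := hbound a ha 0 hR2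
    have h2 : D.change a.1 a.2 0 = 0 := by simpa using h1
    exact congrArg (fun w : Phase => w.2.2) h2
  · intro a ha
    have h1 : (fun x => D.change a.1 a.2 x - x) =O[𝓝 0] fun x => ‖x‖ ^ 2 := by
      refine IsBigO.of_bound C ?_
      filter_upwards [Metric.isOpen_ball.mem_nhds hR2] with x hx
      simpa using hbound a ha x hx
    simpa using (hasFDerivAt_zero_of_isBigO h1).fun_add (hasFDerivAt_id (0 : Phase))
  · obtain ⟨φ, h1, h2, h3, h4⟩ := hirr h
    refine ⟨fun a => φ (a.1 - X.μ₀, a.2 - X.σ₀), ⟨fun a _ => (h1 _).trans N.le_succ,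
      fun i => hcoef fun a ha => h2 a ha i⟩, ?_⟩
    simpa only [← irrationalForm_eq] using hpow h3 h4
  · obtain ⟨φ, Φ, η, h1, h2, h3, h4, h5, h6⟩ := hrat p q hq hpq hσ
    refine ⟨fun a => φ (a.1 - X.μ₀, a.2 - X.σ₀), fun a => Φ (a.1 - X.μ₀, a.2 - X.σ₀),
      fun a => η (a.1 - X.μ₀, a.2 - X.σ₀), ⟨fun a _ => (h1 _).1.trans N.le_succ,
      fun i => hcoef fun a ha => (h2 a ha).1 i⟩, ⟨fun a _ => (h1 _).2.1.trans N.le_succ,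
      fun i => hcoef fun a ha => (h2 a ha).2.1 i⟩, ⟨fun a _ => (h1 _).2.2.trans N.le_succ,
      fun i => hcoef fun a ha => (h2 a ha).2.2 i⟩, fun a _ => h3 _, fun hq a _ => h4 hq _, ?_⟩
    simpa only [← rationalForm_eq] using hpow h5 h6

/-- The integer is quantified before the dimension and the family, so that it can be chosen as a
function of `σ₀` and `k` alone. -/
theorem exists_degree (σ₀ : ℝ) (k : ℕ) : ∃ N : ℕ, 1 ≤ k → ∀ {n : ℕ} (X : SaddleFamily n),
    X.σ₀ = σ₀ → ∃ Θ, IsNormalizingGerm k N X.σ₀ X.shifted Θ := by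
  by_cases h : 1 ≤ k ∧ 0 < σ₀
  · obtain ⟨N, hN⟩ := exists_normalization h.1 h.2
    refine ⟨N, fun _ {n} X hX => ?_⟩
    subst hX
    obtain ⟨Θ, P, h⟩ := hN (ContinuousLinearMap.snd ℝ (Param n) ℝ) X.smoothNear_shifted X.ord_shifted
    exact ⟨Θ, P, h⟩
  · exact ⟨0, fun hk n X hX => absurd ⟨hk, hX ▸ X.σ₀_pos⟩ h⟩

/-- The degree of the normal form. -/
def normalDegree (σ₀ : ℝ) (k : ℕ) : ℕ := (exists_degree σ₀ k).choose

/-- A normalizing germ which depends only on the germ of the family. -/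
def normalGerm (X : SaddleFamily n) (k : ℕ) :
    (Param n × ℝ) × Phase → (Param n × ℝ) × Phase :=
  Classical.epsilon (IsNormalizingGerm k (normalDegree X.σ₀ k) X.σ₀ X.shifted)

theorem isNormalizingGerm_normalGerm {k : ℕ} (hk : 1 ≤ k) (X : SaddleFamily n) :
    IsNormalizingGerm k (normalDegree X.σ₀ k) X.σ₀ X.shifted (normalGerm X k) :=
  Classical.epsilon_spec ((exists_degree X.σ₀ k).choose_spec hk X rfl)

theorem SaddleFamily.SameGerm.shifted_eventuallyEq {X X' : SaddleFamily n} (h : X.SameGerm X') :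
    X.shifted =ᶠ[𝓝 0] X'.shifted := by
  have ht : Tendsto (fun z : (Param n × ℝ) × Phase => (X.μ₀ + z.1.1, z.2)) (𝓝 0)
      (𝓝 (X.μ₀, 0)) := by
    have : Continuous fun z : (Param n × ℝ) × Phase => (X.μ₀ + z.1.1, z.2) := by fun_prop
    simpa using this.tendsto 0
  filter_upwards [ht.eventually h.2.2] with z hz
  rw [SaddleFamily.shifted, SaddleFamily.shifted, ← h.2.1]
  exact hz

theorem SaddleFamily.SameGerm.normalGerm_eq {X X' : SaddleFamily n} (h : X.SameGerm X') (k : ℕ) :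
    normalGerm X k = normalGerm X' k := by
  rw [normalGerm, normalGerm, ← h.1, isNormalizingGerm_congr h.shifted_eventuallyEq]

open Classical in
/-- The normalizing operator. -/
def normalizer (X : SaddleFamily n) (k : ℕ) : Normalization n :=
  let r : ℝ := if hk : 1 ≤ k then
    (exists_normalizes hk X (isNormalizingGerm_normalGerm hk X)).choose else 1
  ⟨r, normalDegree X.σ₀ k + 1, r, r, germMap X (normalGerm X k)⟩

theorem normalizer_normalizes {k : ℕ} (hk : 1 ≤ k) (X : SaddleFamily n) :
    (normalizer X k).Normalizes X k := by
  have h := (exists_normalizes hk X (isNormalizingGerm_normalGerm hk X)).choose_spec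
  simpa only [normalizer, dif_pos hk] using h

end Germ

end SaddleNormalForm

end

/-- There is a normalizing operator `N`, defined on all families and all `k ≥ 1`. The degree `K`
depends only on `k` and the eigenvalues `1, -1, -σ₀`, and the coordinate change is determined, as a
germ, by the germ of the family. -/
theorem mainTheorem7 :
    ∃ (N : (n : ℕ) → SaddleNormalForm.SaddleFamily n → ℕ → SaddleNormalForm.Normalization n)
      (K : ℝ → ℕ → ℕ),
      (∀ (n : ℕ) (X : SaddleNormalForm.SaddleFamily n) (k : ℕ), 1 ≤ k →
        (N n X k).Normalizes X k ∧ (N n X k).K = K X.σ₀ k) ∧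
      (∀ (n : ℕ) (X X' : SaddleNormalForm.SaddleFamily n) (k : ℕ), 1 ≤ k → X.SameGerm X' →
        (fun z : (SaddleNormalForm.Param n × ℝ) × SaddleNormalForm.Phase =>
            (N n X k).G z.1.1 z.1.2 z.2)
          =ᶠ[𝓝 ((X.μ₀, X.σ₀), 0)] fun z => (N n X' k).G z.1.1 z.1.2 z.2) := by
  refine ⟨fun n X k => SaddleNormalForm.normalizer X k,
    fun σ₀ k => SaddleNormalForm.normalDegree σ₀ k + 1,
    fun n X k hk => ⟨SaddleNormalForm.normalizer_normalizes hk X, rfl⟩,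
    fun n X X' k hk h => Eventually.of_forall fun z => ?_⟩
  -- The two choices coincide as maps, so the equality holds at every point and not only near the
  -- base point.
  simp only [SaddleNormalForm.normalizer, SaddleNormalForm.germMap, h.normalGerm_eq k, h.1, h.2.1]
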